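/- Work on $\mathbb{R}^2$. Let $\Lambda=|\partial|$ be the Fourier multiplier with symbol $|\xi|$, let $\Omega = x^1\partial_2-x^2\partial_1$ and $\Sigma = x^1\partial_1+x^2\partial_2$, and for $\iota>0$ let $Y(\partial)=\Lambda^{\iota}+\Lambda^{-\iota}$. For every $\iota>0$ there is a constant $C>0$, depending only on $\iota$, such that for all $\beta\in[0,\tfrac12)$, all $t>0$ and all complex-valued tempered distributions $f$ on $\mathbb{R}^2$, $$\left\| e^{it\Lambda^{3/2}} f \right\|_{L^\infty(\mathbb{R}^2)} \le C\, t^{-1+\frac{2\beta}{3}} \sum_{j=0}^{1}\sum_{k=0}^{3} \left\| Y(\partial)\Lambda^{\beta-\frac12}\Sigma^j\Omega^k f\right\|_{L^2(\mathbb{R}^2)} .$$ In particular (case $\beta=0$), $$\left\| e^{it\Lambda^{3/2}} f \right\|_{L^\infty(\mathbb{R}^2)} \le \frac{C}{t} \sum_{j=0}^{1}\sum_{k=0}^{3} \left\| Y(\partial)\Lambda^{-\frac12}\Sigma^j\Omega^k f\right\|_{L^2(\mathbb{R}^2)} .$$ Here the vector fields act in the sense of distributions. A Fourier multiplier $m(\partial/i)g$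 is defined when $\widehat g$ and $m\widehat g$ are functions that define tempered distributions. A norm $\|m(\partial/i)g\|_{L^p}$ is $+\infty$ if $m(\partial/i)g$ is not defined or is not a function in $L^p$. So, whenever the right-hand side is finite, $e^{it\Lambda^{3/2}}f$ is a bounded function and satisfies the stated bound. -/

import Mathlib

open MeasureTheory SchwartzMap LineDeriv FourierTransform
open scoped ENNReal SchwartzMap LineDeriv FourierTransform

noncomputable section

namespace CapillaryWaves

/-- The plane `ℝ²` with its Euclidean norm. -/
abbrev Plane : Type := EuclideanSpace ℝ (Fin 2)

/-- The tempered distribution `T` is (integration against) the function `v`. -/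
def IsRepresentedBy (T : 𝓢'(Plane, ℂ)) (v : Plane → ℂ) : Prop :=
  ∀ φ : 𝓢(Plane, ℂ), Integrable (fun x => φ x * v x) ∧ T φ = ∫ x, φ x * v x

/-- `u = m(∂ / i) f`: the Fourier transform of the tempered distribution `f` is a function `F`, and
the Fourier transform of `u` is the function `m F`. Mathlib's Fourier transform has the kernel
`exp (-2πi x·ξ)`, so that the frequency variable dual to `∂ / i` is `2πξ`. -/
def IsFourierMultiplier (m : Plane → ℂ) (f u : 𝓢'(Plane, ℂ)) : Prop :=
  ∃ F : Plane → ℂ, IsRepresentedBy (𝓕 f) F ∧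
    IsRepresentedBy (𝓕 u) (fun ξ => m ((2 * Real.pi) • ξ) * F ξ)

/-- The extended norm `‖m(∂ / i) f‖_{L^p(ℝ²)} ∈ [0, ∞]`. The distribution `m(∂ / i) f` is unique,
and so is, up to null sets, the function `v` that represents it; the norm is `∞` if
`m(∂ / i) f` is not defined or is not a function in `L^p`. -/
def multiplierNorm (m : Plane → ℂ) (p : ℝ≥0∞) (f : 𝓢'(Plane, ℂ)) : ℝ≥0∞ :=
  ⨅ (u : 𝓢'(Plane, ℂ)) (v : Plane → ℂ) (_ : IsFourierMultiplier m f u)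
    (_ : IsRepresentedBy u v), eLpNorm v p volume

/-- Multiplication of a tempered distribution by the coordinate function `xⁱ`. -/
def coordMul (i : Fin 2) (f : 𝓢'(Plane, ℂ)) : 𝓢'(Plane, ℂ) :=
  TemperedDistribution.smulLeftCLM ℂ (fun x : Plane => ((x i : ℝ) : ℂ)) f

/-- The partial derivative `∂ᵢ` of a tempered distribution. -/
def partialDeriv (i : Fin 2) (f : 𝓢'(Plane, ℂ)) : 𝓢'(Plane, ℂ) :=
  ∂_{(EuclideanSpace.single i (1 : ℝ) : Plane)} f

/-- The rotation vector field `Ω = x¹ ∂₂ - x² ∂₁`. -/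
def rotationField (f : 𝓢'(Plane, ℂ)) : 𝓢'(Plane, ℂ) :=
  coordMul 0 (partialDeriv 1 f) - coordMul 1 (partialDeriv 0 f)

/-- The spatial scaling vector field `Σ = x¹ ∂₁ + x² ∂₂`. -/
def scalingField (f : 𝓢'(Plane, ℂ)) : 𝓢'(Plane, ℂ) :=
  coordMul 0 (partialDeriv 0 f) + coordMul 1 (partialDeriv 1 f)

/-- The symbol `exp (i t |ξ|^{3/2})` of the linear group `e^{itΛ^{3/2}}`. -/
def groupSymbol (t : ℝ) (ξ : Plane) : ℂ :=
  Complex.exp (Complex.I * ((t * ‖ξ‖ ^ (3 / 2 : ℝ) : ℝ) : ℂ))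

/-- The symbol `(|ξ|^ι + |ξ|^{-ι}) |ξ|^γ` of the operator `Y(∂) Λ^γ`. -/
def weightSymbol (ι γ : ℝ) (ξ : Plane) : ℂ :=
  (((‖ξ‖ ^ ι + ‖ξ‖ ^ (-ι)) * ‖ξ‖ ^ γ : ℝ) : ℂ)

end CapillaryWaves

end

noncomputable section

namespace CapillaryWaves

/-! Let F be the Fourier transform of f and c = t(2π)^{3/2}. Formally the solution at x is the
integral of F(ξ) e^{i(c|ξ|^{3/2} + 2π x·ξ)}, and it has to be bounded by weighted L² norms of the
transforms of Σʲ Ωᵏ f. The vector fields are used before any estimate is made. Replace the phase by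
c v³|ξ|^{3/2} + 2π v² (R_{-φ}x)·ξ, that is, dilate ξ by v² and rotate x, and let P(v, φ) be the
resulting pairing with F, cut off to an annulus. Differentiating P in φ puts Ω on f; differentiating
it in v puts Σ on f, up to a cutoff error. So P(1, 0) is an average of pairings over v in (0, 1)
with weight 2v³ (`IsCutoff.pairing_eq_integral_scale`) and over φ > 0 with weight φ²e^{-φ}/2
(`eq_integral_angWeight`), at the price of one Σ and three Ω. By Fubini the averages fall on the
oscillating exponential alone (`IsCutoff.pairing_eq_integral_avgKernel`).

The averaged kernel is ∫₀¹ 2v³ e^{iτv³} A(ρv²) dv with τ = c|ξ|^{3/2} and ρ = 2π|x||ξ|, where A is a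
plane wave averaged over angles. It is at most 1, and the heart of the matter is that it is O(1/τ)
uniformly in ρ (`norm_oscInt_le`). The function A solves an inhomogeneous Bessel equation with
bounded source (`avgWave_ode`), so √s A(s) = h₊(s)e^{is} + h₋(s)e^{-is} with h± bounded and h±' =
O(s^{-3/2}). For ρv² ≥ 1 this leaves the phases τv³ ± ρv² with amplitude v²/√ρ, and a stationary
phase bound √ρ/τ that is uniform in both parameters (`norm_integral_cubic_phase_le`) gives 1/τ. For
ρv² ≤ 1, integration by parts against e^{iτv³} suffices.

Interpolating the bounds 1 and 675/τ gives t^{-1+2β/3} r^{-3/2+β} with r = |2πξ|. Now r^{-3/2+β} is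
the symbol of Y(∂)Λ^{β-1/2} times r^{-1}/(r^ι + r^{-ι}), which is square integrable on the plane
because ι > 0 (`memLp_sumWeight`). Cauchy–Schwarz and Plancherel conclude, after the cutoffs are
removed by dominated convergence. -/

/-! ### Uniform stationary phase for the cubic phase τv³ + κv². -/

open Real in
theorem integral_inv_one_add_mul_sq_le {τ : ℝ} (hτ : 0 < τ) (v₀ a b : ℝ) :
    ∫ v in a..b, 1 / (1 + τ * (v - v₀) ^ 2) ≤ π / √τ := by
  have hs : 0 < √τ := Real.sqrt_pos.2 hτ
  have hd : ∀ v ∈ Set.uIcc a b, HasDerivAt (fun v => arctan (√τ * (v - v₀)) / √τ)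
      (1 / (1 + τ * (v - v₀) ^ 2)) v := by
    intro v _
    have h := ((((hasDerivAt_id v).sub_const v₀).const_mul (√τ)).arctan).div_const (√τ)
    refine h.congr_deriv ?_
    have : (√τ * (v - v₀)) ^ 2 = τ * (v - v₀) ^ 2 := by rw [mul_pow, Real.sq_sqrt hτ.le]
    simp only [id, this]
    field_simp
  have hpos : ∀ v : ℝ, 1 + τ * (v - v₀) ^ 2 ≠ 0 := fun v => by positivity
  rw [intervalIntegral.integral_eq_sub_of_hasDerivAt hd
    (Continuous.intervalIntegrable (by fun_prop (disch := exact hpos _)) _ _), ← sub_div]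
  gcongr
  have h1 := arctan_lt_pi_div_two (√τ * (b - v₀))
  have h2 := neg_pi_div_two_lt_arctan (√τ * (a - v₀))
  linarith

theorem hasDerivAt_mul_abs (y : ℝ) : HasDerivAt (fun y : ℝ => y * |y|) (2 * |y|) y := by
  rcases lt_trichotomy y 0 with h | h | h
  · have := ((hasDerivAt_id y).mul (hasDerivAt_abs_neg h))
    refine this.congr_deriv ?_
    simp [abs_of_neg h]; ring
  · subst h
    rw [hasDerivAt_iff_isLittleO_nhds_zero]
    simp only [zero_add, abs_zero, mul_zero, sub_zero, smul_zero]
    have h0 : (fun h : ℝ => |h|) =o[nhds 0] (fun _ => (1 : ℝ)) := by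
      rw [Asymptotics.isLittleO_one_iff]
      simpa using (continuous_abs.tendsto (0 : ℝ))
    simpa using (Asymptotics.isBigO_refl (fun h : ℝ => h) (nhds 0)).mul_isLittleO h0
  · have := ((hasDerivAt_id y).mul (hasDerivAt_abs_pos h))
    refine this.congr_deriv ?_
    simp [abs_of_pos h]; ring

-- The primitive is arctan(3τ y|y|)/(3τ) with y = v - v₀. Using y|y| instead of y² keeps it
-- increasing across v₀, so its total variation is at most π/(3τ): a gain of 1/τ, not just 1/√τ.
open Real in
theorem integral_abs_div_one_add_le {τ : ℝ} (hτ : 0 < τ) (v₀ a b : ℝ) :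
    ∫ v in a..b, 2 * |v - v₀| / (1 + 9 * τ ^ 2 * (v - v₀) ^ 4) ≤ π / (3 * τ) := by
  have hd : ∀ v ∈ Set.uIcc a b,
      HasDerivAt (fun v => arctan (3 * τ * ((v - v₀) * |v - v₀|)) / (3 * τ))
      (2 * |v - v₀| / (1 + 9 * τ ^ 2 * (v - v₀) ^ 4)) v := by
    intro v _
    have h := (((((hasDerivAt_mul_abs (v - v₀)).comp_sub_const v v₀)).const_mul
      (3 * τ)).arctan).div_const (3 * τ)
    refine h.congr_deriv ?_
    have : (3 * τ * ((v - v₀) * |v - v₀|)) ^ 2 = 9 * τ ^ 2 * (v - v₀) ^ 4 := by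
      rw [mul_pow, mul_pow, mul_pow, sq_abs]; ring
    rw [this]
    field_simp
  have hpos : ∀ v : ℝ, 1 + 9 * τ ^ 2 * (v - v₀) ^ 4 ≠ 0 := fun v => by positivity
  rw [intervalIntegral.integral_eq_sub_of_hasDerivAt hd
    (Continuous.intervalIntegrable (by fun_prop (disch := exact hpos _)) _ _), ← sub_div]
  gcongr
  have h1 := arctan_lt_pi_div_two (3 * τ * ((b - v₀) * |b - v₀|))
  have h2 := neg_pi_div_two_lt_arctan (3 * τ * ((a - v₀) * |a - v₀|))
  linarith

/-- The denominator of the regularised primitive used for integration by parts near a stationary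
point. -/
def regDenom (τ y : ℝ) : ℂ := 1 + ((3 * τ * y ^ 2 : ℝ) : ℂ) * Complex.I

theorem norm_regDenom_sq (τ y : ℝ) : ‖regDenom τ y‖ ^ 2 = 1 + 9 * τ ^ 2 * y ^ 4 := by
  rw [← Complex.normSq_eq_norm_sq, regDenom, Complex.normSq_apply]
  simp only [Complex.add_re, Complex.one_re, Complex.re_ofReal_mul, Complex.I_re, Complex.add_im, Complex.one_im, Complex.im_ofReal_mul, Complex.I_im]
  ring

theorem regDenom_ne_zero (τ y : ℝ) : regDenom τ y ≠ 0 := by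
  intro h
  have := norm_regDenom_sq τ y
  rw [h, norm_zero] at this
  nlinarith [sq_nonneg (τ * y ^ 2)]

theorem norm_regDenom_pos (τ y : ℝ) : 0 < ‖regDenom τ y‖ := norm_pos_iff.2 (regDenom_ne_zero τ y)

theorem one_add_le_norm_regDenom (τ y : ℝ) : 1 + τ * y ^ 2 ≤ 2 * ‖regDenom τ y‖ := by
  refine le_of_sq_le_sq ?_ (by positivity)
  rw [mul_pow, norm_regDenom_sq]
  nlinarith [sq_nonneg (τ * y ^ 2 - 1), sq_nonneg (τ * y ^ 2)]

theorem mul_sq_le_norm_regDenom (τ y : ℝ) : τ * y ^ 2 ≤ ‖regDenom τ y‖ := by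
  refine le_of_sq_le_sq ?_ (by positivity)
  rw [norm_regDenom_sq]
  nlinarith [sq_nonneg (τ * y ^ 2)]

theorem sqrt_mul_abs_le_norm_regDenom {τ : ℝ} (hτ : 0 < τ) (y : ℝ) :
    √τ * |y| ≤ ‖regDenom τ y‖ := by
  refine le_of_sq_le_sq ?_ (by positivity)
  rw [norm_regDenom_sq, mul_pow, sq_abs, Real.sq_sqrt hτ.le]
  nlinarith [sq_nonneg (τ * y ^ 2 - 1), sq_nonneg (τ * y ^ 2)]

theorem continuous_regDenom (τ v₀ : ℝ) : Continuous fun v => regDenom τ (v - v₀) := by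
  unfold regDenom; fun_prop

/-- The regularised primitive weight `v (v - v₀) / D` used near the stationary point `v₀`. -/
def regWeight (τ v₀ v : ℝ) : ℂ := (v * (v - v₀) : ℝ) / regDenom τ (v - v₀)

/-- The derivative of `regWeight`. -/
def regWeightDeriv (τ v₀ v : ℝ) : ℂ :=
  ((v - v₀ : ℝ) * regDenom τ (v - v₀) + v * (2 - regDenom τ (v - v₀))) / regDenom τ (v - v₀) ^ 2

/-- The real part of the denominator is 1, so 2 - D is the complex conjugate of D. -/
theorem norm_two_sub_regDenom (τ y : ℝ) : ‖2 - regDenom τ y‖ = ‖regDenom τ y‖ := by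
  have : 2 - regDenom τ y = (starRingEnd ℂ) (regDenom τ y) := by
    simp only [regDenom, map_add, map_one, map_mul, Complex.conj_ofReal, Complex.conj_I]
    ring
  rw [this, RCLike.norm_conj]

theorem hasDerivAt_regWeight (τ v₀ v : ℝ) :
    HasDerivAt (regWeight τ v₀) (regWeightDeriv τ v₀ v) v := by
  have hy : HasDerivAt (fun v : ℝ => v - v₀) 1 v := (hasDerivAt_id v).sub_const v₀
  have h1 : HasDerivAt (fun v : ℝ => v * (v - v₀)) (1 * (v - v₀) + v * 1) v :=
    (hasDerivAt_id v).mul hy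
  have h2 : HasDerivAt (fun v : ℝ => regDenom τ (v - v₀))
      (((3 * τ * (2 * (v - v₀) ^ 1 * 1) : ℝ) : ℂ) * Complex.I) v :=
    ((((hy.pow 2).const_mul (3 * τ)).ofReal_comp).mul_const Complex.I).const_add 1
  refine (h1.ofReal_comp.div h2 (regDenom_ne_zero _ _)).congr_deriv ?_
  unfold regWeightDeriv
  congr 1
  unfold regDenom
  push_cast
  ring

theorem continuous_regWeightDeriv (τ v₀ : ℝ) : Continuous (regWeightDeriv τ v₀) := by
  have h := continuous_regDenom τ v₀
  have h0 : ∀ v : ℝ, regDenom τ (v - v₀) ^ 2 ≠ 0 := fun v => pow_ne_zero _ (regDenom_ne_zero _ _)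
  unfold regWeightDeriv
  exact Continuous.div (by fun_prop) (by fun_prop) h0

theorem inv_norm_regDenom_le {τ : ℝ} (hτ : 0 < τ) (y : ℝ) :
    1 / ‖regDenom τ y‖ ≤ 2 * (1 / (1 + τ * y ^ 2)) := by
  have h := one_add_le_norm_regDenom τ y
  have h0 := norm_regDenom_pos τ y
  have h1 : 0 < 1 + τ * y ^ 2 := by positivity
  rw [mul_one_div, div_le_div_iff₀ h0 h1]
  linarith

theorem integral_inv_norm_regDenom_le {τ : ℝ} (hτ : 0 < τ) (v₀ : ℝ) {a b : ℝ} (hab : a ≤ b) :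
    ∫ v in a..b, 1 / ‖regDenom τ (v - v₀)‖ ≤ 7 / √τ := by
  have hs : 0 < √τ := Real.sqrt_pos.2 hτ
  have hpos : ∀ v : ℝ, 1 + τ * (v - v₀) ^ 2 ≠ 0 := fun v => by positivity
  calc ∫ v in a..b, 1 / ‖regDenom τ (v - v₀)‖
      ≤ ∫ v in a..b, 2 * (1 / (1 + τ * (v - v₀) ^ 2)) := by
        refine intervalIntegral.integral_mono_on hab ?_ ?_ fun v _ => inv_norm_regDenom_le hτ _
        · exact (continuous_const.div (continuous_regDenom τ v₀).norm
            fun v => (norm_regDenom_pos _ _).ne').intervalIntegrable _ _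
        · exact Continuous.intervalIntegrable (by fun_prop (disch := exact hpos _)) _ _
    _ ≤ 2 * (Real.pi / √τ) := by
        rw [intervalIntegral.integral_const_mul]
        gcongr
        exact integral_inv_one_add_mul_sq_le hτ _ _ _
    _ ≤ 7 / √τ := by
        rw [mul_div_assoc']
        gcongr
        linarith [Real.pi_lt_d2]

theorem abs_div_norm_regDenom_le {τ : ℝ} (hτ : 0 < τ) (y : ℝ) :
    |y| / ‖regDenom τ y‖ ≤ 1 / √τ := by
  rw [div_le_div_iff₀ (norm_regDenom_pos _ _) (Real.sqrt_pos.2 hτ)]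
  linarith [sqrt_mul_abs_le_norm_regDenom hτ y]

theorem sq_div_norm_regDenom_le {τ : ℝ} (hτ : 0 < τ) (y : ℝ) :
    y ^ 2 / ‖regDenom τ y‖ ≤ 1 / τ := by
  rw [div_le_div_iff₀ (norm_regDenom_pos _ _) hτ]
  linarith [mul_sq_le_norm_regDenom τ y]

theorem inv_sqrt_le_sqrt_div {τ ρ : ℝ} (hτ : 0 < τ) (h : τ ≤ ρ) : 1 / √τ ≤ √ρ / τ := by
  have hs : 0 < √τ := Real.sqrt_pos.2 hτ
  rw [div_le_div_iff₀ hs hτ, one_mul]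
  nth_rewrite 1 [← Real.mul_self_sqrt hτ.le]
  gcongr

theorem div_mul_inv_sqrt_le {τ ρ : ℝ} (hτ : 0 < τ) (hρ : 0 ≤ ρ) (h : ρ ≤ τ) :
    ρ / τ * (1 / √τ) ≤ √ρ / τ := by
  have hs : 0 < √τ := Real.sqrt_pos.2 hτ
  rw [div_mul_div_comm, div_le_div_iff₀ (by positivity) hτ, mul_one]
  nth_rewrite 1 [← Real.mul_self_sqrt hρ]
  have : √ρ ≤ √τ := Real.sqrt_le_sqrt h
  have h3 : 0 ≤ √ρ * τ := by positivity
  nlinarith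

/-- The point v₀ = -2κ/(3τ) is the nonzero stationary point of τv³ + κv². If τ ≤ |κ|, then |v -
v₀|/|D| ≤ 1/√τ is already enough. If |κ| ≤ τ, the factor v must be used: it is at most |v - v₀| +
|v₀|, where the first term gives 1/τ ≤ √|κ|/τ (as |κ| ≥ 1) and the second (|κ|/τ)/√τ. -/
theorem norm_regWeight_le {τ κ : ℝ} (hτ : 0 < τ) (hκ : 1 ≤ |κ|) {v : ℝ} (hv : v ∈ Set.Icc 0 1) :
    ‖regWeight τ (-(2 * κ / (3 * τ))) v‖ ≤ 2 * (√|κ| / τ) := by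
  set v₀ := -(2 * κ / (3 * τ)) with hv₀
  have hs : 1 ≤ √|κ| := Real.one_le_sqrt.2 hκ
  have h1τ : 1 / τ ≤ √|κ| / τ := by gcongr
  have hn : ‖regWeight τ v₀ v‖ = v * (|v - v₀| / ‖regDenom τ (v - v₀)‖) := by
    rw [regWeight, norm_div, Complex.norm_real, norm_mul, Real.norm_of_nonneg hv.1,
      Real.norm_eq_abs, mul_div_assoc]
  rcases le_total τ |κ| with h | h
  · rw [hn]
    have h1 := abs_div_norm_regDenom_le hτ (v - v₀)
    have h2 := inv_sqrt_le_sqrt_div hτ h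
    have h3 : 0 ≤ |v - v₀| / ‖regDenom τ (v - v₀)‖ := by positivity
    nlinarith [hv.1, hv.2]
  · have habs : |v₀| ≤ |κ| / τ := by
      rw [hv₀, abs_neg, abs_div, abs_mul, abs_mul, abs_of_pos hτ, div_le_div_iff₀ (by positivity) hτ]
      norm_num
      nlinarith [abs_nonneg κ]
    have h1 := abs_div_norm_regDenom_le hτ (v - v₀)
    have h2 := sq_div_norm_regDenom_le hτ (v - v₀)
    have h4 := div_mul_inv_sqrt_le hτ (abs_nonneg κ) h
    have h3 : 0 ≤ |v - v₀| / ‖regDenom τ (v - v₀)‖ := by positivity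
    have h5 : v ≤ |v - v₀| + |v₀| := by
      have := abs_add_le (v - v₀) v₀
      rw [sub_add_cancel] at this
      exact (le_abs_self v).trans this
    rw [hn]
    calc v * (|v - v₀| / ‖regDenom τ (v - v₀)‖)
        ≤ (|v - v₀| + |v₀|) * (|v - v₀| / ‖regDenom τ (v - v₀)‖) := by gcongr
      _ = (v - v₀) ^ 2 / ‖regDenom τ (v - v₀)‖ + |v₀| * (|v - v₀| / ‖regDenom τ (v - v₀)‖) := by
          rw [← sq_abs]; ring
      _ ≤ 1 / τ + |κ| / τ * (1 / √τ) := by gcongr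
      _ ≤ 2 * (√|κ| / τ) := by linarith

/-- The integrand is the error left by the regularised integration by parts. For τ ≤ |κ| crude
bounds cost 15/√τ. For |κ| ≤ τ the target √|κ|/τ may be far below 1/√τ, so v is split as (v - v₀) +
v₀: the first part contributes O(1/τ), and the second carries the small factor |v₀|. There 18 = 2 +
2 + 14. -/
theorem integral_regWeightDeriv_le {τ κ : ℝ} (hτ : 0 < τ) (hκ : 1 ≤ |κ|) {b : ℝ} (hb : 0 ≤ b)
    (hb1 : b ≤ 1) :
    ∫ v in b..1, (‖regWeightDeriv τ (-(2 * κ / (3 * τ))) v‖ +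
      v ^ 2 / ‖regDenom τ (v - -(2 * κ / (3 * τ)))‖) ≤ 18 * (√|κ| / τ) := by
  set v₀ := -(2 * κ / (3 * τ)) with hv₀
  have hs : 1 ≤ √|κ| := Real.one_le_sqrt.2 hκ
  have h1τ : 1 / τ ≤ √|κ| / τ := by gcongr
  have hsτ : 0 < √τ := Real.sqrt_pos.2 hτ
  have hcD : Continuous fun v => 1 / ‖regDenom τ (v - v₀)‖ :=
    continuous_const.div (continuous_regDenom τ v₀).norm fun v => (norm_regDenom_pos _ _).ne'
  have hcI : Continuous fun v => ‖regWeightDeriv τ v₀ v‖ + v ^ 2 / ‖regDenom τ (v - v₀)‖ :=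
    (continuous_regWeightDeriv τ v₀).norm.add ((continuous_pow 2).div
      (continuous_regDenom τ v₀).norm fun v => (norm_regDenom_pos _ _).ne')
  rcases le_total τ |κ| with h | h
  · have hpt : ∀ v ∈ Set.Icc b 1, ‖regWeightDeriv τ v₀ v‖ + v ^ 2 / ‖regDenom τ (v - v₀)‖ ≤
        1 / √τ + 2 * (1 / ‖regDenom τ (v - v₀)‖) := by
      intro v hv
      have hv0 : 0 ≤ v := hb.trans hv.1
      have hD := norm_regDenom_pos τ (v - v₀)
      have h1 : ‖regWeightDeriv τ v₀ v‖ ≤ |v - v₀| / ‖regDenom τ (v - v₀)‖ +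
          v * (1 / ‖regDenom τ (v - v₀)‖) := by
        rw [regWeightDeriv, norm_div, norm_pow]
        have : ‖((v - v₀ : ℝ) : ℂ) * regDenom τ (v - v₀) + v * (2 - regDenom τ (v - v₀))‖ ≤
            (|v - v₀| + v) * ‖regDenom τ (v - v₀)‖ := by
          refine (norm_add_le _ _).trans_eq ?_
          rw [norm_mul, norm_mul, norm_two_sub_regDenom, Complex.norm_real, Complex.norm_real,
            Real.norm_eq_abs, Real.norm_of_nonneg hv0, add_mul]
        refine (div_le_div_of_nonneg_right this (by positivity)).trans_eq ?_
        field_simp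
      have h2 := abs_div_norm_regDenom_le hτ (v - v₀)
      have h3 : v ^ 2 / ‖regDenom τ (v - v₀)‖ ≤ 1 / ‖regDenom τ (v - v₀)‖ := by
        gcongr
        nlinarith [hv.2]
      have h4 : v * (1 / ‖regDenom τ (v - v₀)‖) ≤ 1 / ‖regDenom τ (v - v₀)‖ :=
        mul_le_of_le_one_left (by positivity) hv.2
      linarith
    refine (intervalIntegral.integral_mono_on hb1 (hcI.intervalIntegrable _ _)
      (Continuous.intervalIntegrable (by fun_prop) _ _) hpt).trans ?_
    rw [intervalIntegral.integral_add (by simp)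
      ((hcD.const_mul 2).intervalIntegrable _ _), intervalIntegral.integral_const_mul,
      intervalIntegral.integral_const, smul_eq_mul]
    have h1 := integral_inv_norm_regDenom_le hτ v₀ hb1
    have h2 := inv_sqrt_le_sqrt_div hτ h
    have h3 : (1 - b) * (1 / √τ) ≤ 1 / √τ :=
      mul_le_of_le_one_left (by positivity) (by linarith)
    have h4 : 7 / √τ = 7 * (1 / √τ) := by ring
    linarith [h2, (by positivity : 0 ≤ √|κ| / τ)]
  · have habs : |v₀| = 2 / 3 * (|κ| / τ) := by
      rw [hv₀, abs_neg, abs_div, abs_mul, abs_mul, abs_of_pos hτ]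
      norm_num
      field_simp
    have hκτ : |κ| / τ ≤ 1 := (div_le_one hτ).2 h
    have hκτ0 : 0 ≤ |κ| / τ := by positivity
    have hpt : ∀ v ∈ Set.Icc b 1, ‖regWeightDeriv τ v₀ v‖ + v ^ 2 / ‖regDenom τ (v - v₀)‖ ≤
        2 * |v - v₀| / (1 + 9 * τ ^ 2 * (v - v₀) ^ 4) +
          (2 * (1 / τ) + 3 * |v₀| * (1 / ‖regDenom τ (v - v₀)‖)) := by
      intro v hv
      have hD := norm_regDenom_pos τ (v - v₀)
      have h1 : ‖regWeightDeriv τ v₀ v‖ ≤ 2 * |v - v₀| / (1 + 9 * τ ^ 2 * (v - v₀) ^ 4) +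
          |v₀| * (1 / ‖regDenom τ (v - v₀)‖) := by
        rw [regWeightDeriv, norm_div, norm_pow, ← norm_regDenom_sq]
        -- In this form v - v₀ is divided by D² rather than by D, which makes its integral O(1/τ).
        have h0 : ((v - v₀ : ℝ) : ℂ) * regDenom τ (v - v₀) + v * (2 - regDenom τ (v - v₀)) =
            2 * ((v - v₀ : ℝ) : ℂ) + v₀ * (2 - regDenom τ (v - v₀)) := by
          push_cast; ring
        have : ‖((v - v₀ : ℝ) : ℂ) * regDenom τ (v - v₀) + v * (2 - regDenom τ (v - v₀))‖ ≤
            2 * |v - v₀| + |v₀| * ‖regDenom τ (v - v₀)‖ := by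
          rw [h0]
          refine (norm_add_le _ _).trans_eq ?_
          rw [norm_mul, norm_mul, norm_two_sub_regDenom, Complex.norm_real, Complex.norm_real,
            Real.norm_eq_abs, Real.norm_eq_abs, Complex.norm_ofNat]
        refine (div_le_div_of_nonneg_right this (by positivity)).trans_eq ?_
        field_simp
      have h2 : v ^ 2 / ‖regDenom τ (v - v₀)‖ ≤
          2 * (1 / τ) + 2 * |v₀| * (1 / ‖regDenom τ (v - v₀)‖) := by
        have h3 : v ^ 2 ≤ 2 * (v - v₀) ^ 2 + 2 * |v₀| := by
          have : v₀ ^ 2 ≤ |v₀| := by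
            rw [← sq_abs]
            nlinarith [abs_nonneg v₀]
          nlinarith [sq_nonneg (v - v₀ - v₀)]
        have h4 := sq_div_norm_regDenom_le hτ (v - v₀)
        calc v ^ 2 / ‖regDenom τ (v - v₀)‖
            ≤ (2 * (v - v₀) ^ 2 + 2 * |v₀|) / ‖regDenom τ (v - v₀)‖ := by gcongr
          _ = 2 * ((v - v₀) ^ 2 / ‖regDenom τ (v - v₀)‖) +
              2 * |v₀| * (1 / ‖regDenom τ (v - v₀)‖) := by ring
          _ ≤ _ := by linarith
      linarith
    have hc1 : Continuous fun v : ℝ => 2 * |v - v₀| / (1 + 9 * τ ^ 2 * (v - v₀) ^ 4) := by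
      have hpos : ∀ v : ℝ, 1 + 9 * τ ^ 2 * (v - v₀) ^ 4 ≠ 0 := fun v => by positivity
      fun_prop (disch := exact hpos _)
    refine (intervalIntegral.integral_mono_on hb1 (hcI.intervalIntegrable _ _)
      (Continuous.intervalIntegrable (by fun_prop) _ _) hpt).trans ?_
    rw [intervalIntegral.integral_add (hc1.intervalIntegrable _ _)
      (Continuous.intervalIntegrable (by fun_prop) _ _), intervalIntegral.integral_add (by simp)
      (Continuous.intervalIntegrable (by fun_prop) _ _), intervalIntegral.integral_const,
      intervalIntegral.integral_const_mul, smul_eq_mul]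
    have h1 := integral_inv_norm_regDenom_le hτ v₀ hb1
    have h2 := integral_abs_div_one_add_le hτ v₀ b 1
    have h3 : (1 - b) * (2 * (1 / τ)) ≤ 2 * (1 / τ) :=
      mul_le_of_le_one_left (by positivity) (by linarith)
    have h4 : 3 * |v₀| * ∫ v in b..1, 1 / ‖regDenom τ (v - v₀)‖ ≤
        14 * (√|κ| / τ) := by
      calc 3 * |v₀| * ∫ v in b..1, 1 / ‖regDenom τ (v - v₀)‖
          ≤ 3 * |v₀| * (7 / √τ) := by gcongr
        _ = 14 * (|κ| / τ * (1 / √τ)) := by rw [habs]; ring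
        _ ≤ 14 * (√|κ| / τ) := by
          linarith [div_mul_inv_sqrt_le hτ (abs_nonneg κ) h]
    have h5 : Real.pi / (3 * τ) ≤ 2 * (1 / τ) := by
      rw [mul_one_div, div_le_div_iff₀ (by positivity) hτ]
      nlinarith [Real.pi_lt_d2]
    linarith

open Complex in
/-- A stationary phase estimate for the cubic phase `τ v³ + κ v²`, uniform in both parameters. -/
theorem norm_integral_cubic_phase_le {τ κ b Q : ℝ} (hτ : 0 < τ) (hκ : 1 ≤ |κ|) (hb : 0 < b)
    (hb1 : b ≤ 1) {q q' : ℝ → ℂ} (hq : ∀ v ∈ Set.Icc b 1, HasDerivAt q (q' v) v)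
    (hq'c : ContinuousOn q' (Set.Icc b 1)) (hQ : ∀ v ∈ Set.Icc b 1, ‖q v‖ ≤ Q)
    (hQ' : ∀ v ∈ Set.Icc b 1, ‖q' v‖ ≤ Q * b / v ^ 2) :
    ‖∫ v in b..1, (v : ℂ) ^ 2 * q v * exp (I * ((τ * v ^ 3 + κ * v ^ 2 : ℝ) : ℂ))‖ ≤
      24 * Q * (√|κ| / τ) := by
  set v₀ := -(2 * κ / (3 * τ)) with hv₀
  set e : ℝ → ℂ := fun v => exp (I * ((τ * v ^ 3 + κ * v ^ 2 : ℝ) : ℂ)) with he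
  have hen : ∀ v, ‖e v‖ = 1 := fun v => by
    simp only [he]; rw [mul_comm]; exact norm_exp_ofReal_mul_I _
  have hec : Continuous e := by simp only [he]; fun_prop
  have hQ0 : 0 ≤ Q := (norm_nonneg _).trans (hQ 1 ⟨hb1, le_rfl⟩)
  have hu : Set.uIcc b 1 = Set.Icc b 1 := Set.uIcc_of_le hb1
  have hed : ∀ v, HasDerivAt e (I * (3 * τ * v * (v - v₀)) * e v) v := by
    intro v
    have h1 : HasDerivAt (fun v : ℝ => τ * v ^ 3 + κ * v ^ 2) (τ * (3 * v ^ 2) + κ * (2 * v)) v := by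
      simpa using ((hasDerivAt_pow 3 v).const_mul τ).fun_add ((hasDerivAt_pow 2 v).const_mul κ)
    have h2 := ((h1.ofReal_comp).const_mul I).cexp
    refine h2.congr_deriv ?_
    have : (τ * (3 * v ^ 2) + κ * (2 * v) : ℝ) = 3 * τ * v * (v - v₀) := by
      rw [hv₀]; field_simp; ring
    rw [this]
    simp only [he]
    push_cast
    ring
  have hcD := continuous_regDenom τ v₀
  have hqc : ContinuousOn q (Set.Icc b 1) := fun v hv => (hq v hv).continuousAt.continuousWithinAt
  have hMc : Continuous (regWeight τ v₀) :=
    continuous_iff_continuousAt.2 fun v => (hasDerivAt_regWeight τ v₀ v).continuousAt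
  have hM'c := continuous_regWeightDeriv τ v₀
  set G : ℝ → ℂ := fun v => q v * regWeight τ v₀ v * e v with hG
  set E₁ : ℝ → ℂ := fun v => q' v * regWeight τ v₀ v * e v with hE₁
  set E₂ : ℝ → ℂ := fun v => q v * (regWeightDeriv τ v₀ v - v ^ 2 / regDenom τ (v - v₀)) * e v
    with hE₂
  set f : ℝ → ℂ := fun v => (v : ℂ) ^ 2 * q v * e v with hf
  have hE₁c : ContinuousOn E₁ (Set.Icc b 1) := by simp only [hE₁]; fun_prop
  have hDc2 : Continuous fun v : ℝ => (v : ℂ) ^ 2 / regDenom τ (v - v₀) :=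
    Continuous.div (by fun_prop) hcD fun v => regDenom_ne_zero _ _
  have hE₂c : ContinuousOn E₂ (Set.Icc b 1) :=
    (hqc.mul (hM'c.sub hDc2).continuousOn).mul hec.continuousOn
  have hfc : ContinuousOn f (Set.Icc b 1) := by simp only [hf]; fun_prop
  have hii : ∀ {g : ℝ → ℂ}, ContinuousOn g (Set.Icc b 1) → IntervalIntegrable g volume b 1 :=
    fun hg => (hu ▸ hg).intervalIntegrable
  have hGd : ∀ v ∈ Set.uIcc b 1, HasDerivAt G (f v + (E₁ v + E₂ v)) v := by
    intro v hv
    rw [hu] at hv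
    refine (((hq v hv).fun_mul (hasDerivAt_regWeight τ v₀ v)).fun_mul (hed v)).congr_deriv ?_
    have hD := regDenom_ne_zero τ (v - v₀)
    -- Since 3iτ(v - v₀)² = D - 1, the weight times i times the phase derivative is v²(D - 1)/D.
    -- This is the wanted amplitude v² up to v²/D, which is negligible away from v₀, and nothing is
    -- singular at v₀.
    have hkey : regWeight τ v₀ v * (I * (3 * τ * v * (v - v₀))) =
        v ^ 2 - v ^ 2 / regDenom τ (v - v₀) := by
      rw [regWeight]
      field_simp
      simp only [regDenom]
      push_cast
      ring
    simp only [hf, hE₁, hE₂]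
    linear_combination (q v * e v) * hkey
  have hE₁₂c : ContinuousOn (fun v => E₁ v + E₂ v) (Set.Icc b 1) := hE₁c.add hE₂c
  have hFTC := intervalIntegral.integral_eq_sub_of_hasDerivAt hGd
    (hii (hfc.add hE₁₂c))
  rw [intervalIntegral.integral_add (hii hfc) (hii hE₁₂c),
    intervalIntegral.integral_add (hii hE₁c) (hii hE₂c)] at hFTC
  have hMle : ∀ v ∈ Set.Icc b 1, ‖regWeight τ v₀ v‖ ≤ 2 * (√|κ| / τ) := fun v hv =>
    norm_regWeight_le hτ hκ ⟨hb.le.trans hv.1, hv.2⟩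
  have hGle : ∀ v ∈ Set.Icc b 1, ‖G v‖ ≤ Q * (2 * (√|κ| / τ)) := fun v hv => by
    simp only [hG]
    rw [norm_mul, norm_mul, hen, mul_one]
    exact mul_le_mul (hQ v hv) (hMle v hv) (norm_nonneg _) hQ0
  have hE₁le : ‖∫ v in b..1, E₁ v‖ ≤ Q * (2 * (√|κ| / τ)) := by
    -- The bound Qb/v² on q' integrates to at most Q over [b, 1], whatever b is.
    have hd : ∀ v ∈ Set.uIcc b 1, HasDerivAt (fun v => -(Q * b * (2 * (√|κ| / τ)) * v⁻¹))
        (Q * b / v ^ 2 * (2 * (√|κ| / τ))) v := by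
      intro v hv
      rw [hu] at hv
      have hv0 : v ≠ 0 := (hb.trans_le hv.1).ne'
      refine (((hasDerivAt_inv hv0).const_mul (Q * b * (2 * (√|κ| / τ)))).neg).congr_deriv ?_
      field_simp
    have hci : ContinuousOn (fun v : ℝ => Q * b / v ^ 2 * (2 * (√|κ| / τ))) (Set.uIcc b 1) := by
      rw [hu]
      refine ContinuousOn.mul (ContinuousOn.div (by fun_prop) (by fun_prop) ?_) (by fun_prop)
      intro v hv
      exact pow_ne_zero _ (hb.trans_le hv.1).ne'
    refine (intervalIntegral.norm_integral_le_integral_norm hb1).trans ?_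
    refine (intervalIntegral.integral_mono_on hb1 (hii hE₁c).norm hci.intervalIntegrable
      (g := fun v => Q * b / v ^ 2 * (2 * (√|κ| / τ))) ?_).trans ?_
    · intro v hv
      simp only [hE₁]
      rw [norm_mul, norm_mul, hen, mul_one]
      exact mul_le_mul (hQ' v hv) (hMle v hv) (norm_nonneg _)
        ((norm_nonneg _).trans (hQ' v hv))
    · rw [intervalIntegral.integral_eq_sub_of_hasDerivAt hd hci.intervalIntegrable]
      have : Q * b * (2 * (√|κ| / τ)) * b⁻¹ = Q * (2 * (√|κ| / τ)) := by field_simp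
      rw [this]
      have : 0 ≤ Q * b * (2 * (√|κ| / τ)) := by positivity
      simp only [inv_one, mul_one]
      linarith
  have hE₂le : ‖∫ v in b..1, E₂ v‖ ≤ Q * (18 * (√|κ| / τ)) := by
    refine (intervalIntegral.norm_integral_le_integral_norm hb1).trans ?_
    have hci : Continuous fun v =>
        Q * (‖regWeightDeriv τ v₀ v‖ + v ^ 2 / ‖regDenom τ (v - v₀)‖) :=
      continuous_const.mul (hM'c.norm.add ((continuous_pow 2).div
      hcD.norm fun v => (norm_regDenom_pos _ _).ne'))
    refine (intervalIntegral.integral_mono_on hb1 (hii hE₂c).norm (hci.intervalIntegrable _ _)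
      ?_).trans ?_
    · intro v hv
      simp only [hE₂]
      rw [norm_mul, norm_mul, hen, mul_one]
      refine mul_le_mul (hQ v hv) ((norm_sub_le _ _).trans_eq ?_) (norm_nonneg _) hQ0
      rw [norm_div, norm_pow, norm_real, Real.norm_eq_abs, sq_abs]
    · rw [intervalIntegral.integral_const_mul]
      exact mul_le_mul_of_nonneg_left (integral_regWeightDeriv_le hτ hκ hb.le hb1) hQ0
  have hfin : ∫ v in b..1, f v = G 1 - G b - (∫ v in b..1, E₁ v) - ∫ v in b..1, E₂ v := by
    rw [← hFTC]; ring
  calc ‖∫ v in b..1, f v‖ ≤ ‖G 1‖ + ‖G b‖ + ‖∫ v in b..1, E₁ v‖ + ‖∫ v in b..1, E₂ v‖ := by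
        rw [hfin]
        exact (norm_sub_le _ _).trans (add_le_add_left ((norm_sub_le _ _).trans
          (add_le_add_left (norm_sub_le _ _) _)) _)
    _ ≤ 24 * Q * (√|κ| / τ) := by
        -- Here 24 = 2 + 2 + 2 + 18: two endpoints, the term with q', and the regularisation error.
        linarith [hGle 1 ⟨hb1, le_rfl⟩, hGle b ⟨le_rfl, hb1⟩]

/-! ### The angularly averaged plane wave and its Bessel equation. -/

open Real in
theorem integrableOn_pow_mul_exp_neg (k : ℕ) :
    IntegrableOn (fun φ : ℝ => φ ^ k * exp (-φ)) (Set.Ioi 0) := by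
  have h := Real.GammaIntegral_convergent (s := k + 1) (by positivity)
  refine h.congr_fun (fun φ hφ => ?_) measurableSet_Ioi
  simp only [add_sub_cancel_right, Real.rpow_natCast]
  ring

open Real in
theorem integral_pow_mul_exp_neg (k : ℕ) :
    ∫ φ in Set.Ioi (0 : ℝ), φ ^ k * exp (-φ) = (k.factorial : ℝ) := by
  rw [← Real.Gamma_nat_eq_factorial, Real.Gamma_eq_integral (by positivity)]
  refine setIntegral_congr_fun measurableSet_Ioi fun φ hφ => ?_
  simp only [add_sub_cancel_right, Real.rpow_natCast]
  ring

/-- The weight `φ² e^{-φ} / 2`, the fundamental solution of `(1 + d/dφ)³` on the half line. -/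
def angWeight (φ : ℝ) : ℝ := φ ^ 2 / 2 * Real.exp (-φ)

/-- The first derivative of `angWeight`. -/
def angWeightDeriv (φ : ℝ) : ℝ := (φ - φ ^ 2 / 2) * Real.exp (-φ)

/-- The second derivative of `angWeight`. -/
def angWeightDeriv₂ (φ : ℝ) : ℝ := (1 - 2 * φ + φ ^ 2 / 2) * Real.exp (-φ)

theorem hasDerivAt_angWeight (φ : ℝ) : HasDerivAt angWeight (angWeightDeriv φ) φ := by
  have h := ((hasDerivAt_pow 2 φ).div_const 2).fun_mul ((hasDerivAt_id φ).neg.exp)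
  refine h.congr_deriv ?_
  simp only [angWeightDeriv, id, Pi.neg_apply]
  push_cast
  ring

theorem hasDerivAt_angWeightDeriv (φ : ℝ) :
    HasDerivAt angWeightDeriv (angWeightDeriv₂ φ) φ := by
  have h := ((hasDerivAt_id φ).fun_sub ((hasDerivAt_pow 2 φ).div_const 2)).fun_mul
    ((hasDerivAt_id φ).neg.exp)
  refine h.congr_deriv ?_
  simp only [angWeightDeriv₂, id, Pi.neg_apply]
  push_cast
  ring

theorem continuous_angWeight : Continuous angWeight := by unfold angWeight; fun_prop

theorem angWeight_nonneg (φ : ℝ) : 0 ≤ angWeight φ := by unfold angWeight; positivity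

theorem integrableOn_angWeight : IntegrableOn angWeight (Set.Ioi 0) := by
  have h : IntegrableOn (fun φ : ℝ => 1 / 2 * (φ ^ 2 * Real.exp (-φ))) (Set.Ioi 0) :=
    (integrableOn_pow_mul_exp_neg 2).const_mul (1 / 2)
  refine h.congr_fun (fun φ _ => ?_) measurableSet_Ioi
  simp only [angWeight]; ring

theorem integrableOn_ofReal_angWeight :
    IntegrableOn (fun φ => (angWeight φ : ℂ)) (Set.Ioi 0) := integrableOn_angWeight.ofReal

theorem integral_angWeight : ∫ φ in Set.Ioi (0 : ℝ), angWeight φ = 1 := by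
  have h : ∀ φ : ℝ, angWeight φ = 1 / 2 * (φ ^ 2 * Real.exp (-φ)) := fun φ => by
    simp only [angWeight]; ring
  simp_rw [h]
  rw [integral_const_mul, integral_pow_mul_exp_neg]
  norm_num

theorem integrableOn_angWeightDeriv₂ : IntegrableOn angWeightDeriv₂ (Set.Ioi 0) := by
  have h : IntegrableOn (fun φ : ℝ => φ ^ 0 * Real.exp (-φ) - 2 * (φ ^ 1 * Real.exp (-φ)) +
      1 / 2 * (φ ^ 2 * Real.exp (-φ))) (Set.Ioi 0) :=
    ((integrableOn_pow_mul_exp_neg 0).sub ((integrableOn_pow_mul_exp_neg 1).const_mul 2)).add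
    ((integrableOn_pow_mul_exp_neg 2).const_mul (1 / 2))
  refine h.congr_fun (fun φ _ => ?_) measurableSet_Ioi
  simp only [angWeightDeriv₂]; ring

theorem integrableOn_ofReal_angWeightDeriv₂ :
    IntegrableOn (fun φ => (angWeightDeriv₂ φ : ℂ)) (Set.Ioi 0) :=
  integrableOn_angWeightDeriv₂.ofReal

theorem integral_norm_angWeightDeriv₂_le :
    ∫ φ in Set.Ioi (0 : ℝ), ‖angWeightDeriv₂ φ‖ ≤ 4 := by
  have hi : IntegrableOn (fun φ : ℝ => φ ^ 0 * Real.exp (-φ) + 2 * (φ ^ 1 * Real.exp (-φ)) +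
      1 / 2 * (φ ^ 2 * Real.exp (-φ))) (Set.Ioi 0) :=
    ((integrableOn_pow_mul_exp_neg 0).add ((integrableOn_pow_mul_exp_neg 1).const_mul 2)).add
    ((integrableOn_pow_mul_exp_neg 2).const_mul (1 / 2))
  have h : ∫ φ in Set.Ioi (0 : ℝ), (φ ^ 0 * Real.exp (-φ) + 2 * (φ ^ 1 * Real.exp (-φ)) +
      1 / 2 * (φ ^ 2 * Real.exp (-φ))) = 4 := by
    rw [integral_add, integral_add, integral_const_mul, integral_const_mul,
      integral_pow_mul_exp_neg, integral_pow_mul_exp_neg, integral_pow_mul_exp_neg]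
    · norm_num
    · exact integrableOn_pow_mul_exp_neg 0
    · exact (integrableOn_pow_mul_exp_neg 1).const_mul 2
    · exact (integrableOn_pow_mul_exp_neg 0).add ((integrableOn_pow_mul_exp_neg 1).const_mul 2)
    · exact (integrableOn_pow_mul_exp_neg 2).const_mul (1 / 2)
  rw [← h]
  refine setIntegral_mono_on integrableOn_angWeightDeriv₂.norm hi measurableSet_Ioi fun φ hφ => ?_
  have hφ0 : (0 : ℝ) < φ := hφ
  have he := Real.exp_pos (-φ)
  rw [angWeightDeriv₂, Real.norm_eq_abs, abs_mul, abs_of_pos he]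
  have : |1 - 2 * φ + φ ^ 2 / 2| ≤ 1 + 2 * φ + φ ^ 2 / 2 := by
    rw [abs_le]; constructor <;> nlinarith [sq_nonneg φ]
  calc _ ≤ (1 + 2 * φ + φ ^ 2 / 2) * Real.exp (-φ) := by gcongr
    _ = _ := by ring

open Complex in
/-- `∫_0^∞ g(φ) e^{is cos(φ + θ)} dφ`. -/
def angInt (g : ℝ → ℂ) (θ s : ℝ) : ℂ :=
  ∫ φ in Set.Ioi (0 : ℝ), g φ * exp (I * ((s * Real.cos (φ + θ) : ℝ) : ℂ))

open Complex in
theorem norm_exp_I_mul_ofReal' (x : ℝ) : ‖exp (I * (x : ℂ))‖ = 1 := by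
  rw [mul_comm]; exact norm_exp_ofReal_mul_I x

theorem norm_angInt_le {g : ℝ → ℂ} (θ s : ℝ) :
    ‖angInt g θ s‖ ≤ ∫ φ in Set.Ioi (0 : ℝ), ‖g φ‖ := by
  refine (norm_integral_le_integral_norm _).trans_eq ?_
  simp only [norm_mul, norm_exp_I_mul_ofReal', mul_one]

open Complex in
theorem integrableOn_mul_exp_cos {g : ℝ → ℂ} (hg : IntegrableOn g (Set.Ioi 0))
    (θ s : ℝ) : IntegrableOn
      (fun φ => g φ * exp (I * ((s * Real.cos (φ + θ) : ℝ) : ℂ))) (Set.Ioi 0) := by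
  refine hg.mul_bdd (c := 1) ?_ (.of_forall fun φ => (norm_exp_I_mul_ofReal' _).le)
  exact Continuous.aestronglyMeasurable (by fun_prop)

open Complex in
theorem hasDerivAt_angInt {g : ℝ → ℂ} (hg : IntegrableOn g (Set.Ioi 0)) (θ s : ℝ) :
    HasDerivAt (angInt g θ) (angInt (fun φ => g φ * (I * (Real.cos (φ + θ) : ℝ))) θ s) s := by
  refine (hasDerivAt_integral_of_dominated_loc_of_deriv_le (bound := fun φ => ‖g φ‖)
    (F' := fun s φ => g φ * (I * (Real.cos (φ + θ) : ℝ)) *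
      exp (I * ((s * Real.cos (φ + θ) : ℝ) : ℂ))) Filter.univ_mem
    (.of_forall fun s => (integrableOn_mul_exp_cos hg θ s).aestronglyMeasurable)
    (integrableOn_mul_exp_cos hg θ s) ?_ (.of_forall fun φ s _ => ?_) hg.norm
    (.of_forall fun φ s _ => ?_)).2
  · exact (hg.aestronglyMeasurable.mul (Continuous.aestronglyMeasurable (by fun_prop))).mul
      (Continuous.aestronglyMeasurable (by fun_prop))
  · rw [norm_mul, norm_mul, norm_exp_I_mul_ofReal', norm_mul, norm_I, norm_real, one_mul, mul_one]
    exact mul_le_of_le_one_right (norm_nonneg _) (Real.abs_cos_le_one _)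
  · have h1 : HasDerivAt (fun s : ℝ => s * Real.cos (φ + θ)) (Real.cos (φ + θ)) s := by
      simpa using (hasDerivAt_id s).mul_const (Real.cos (φ + θ))
    refine (((h1.ofReal_comp).const_mul I).cexp.const_mul (g φ)).congr_deriv ?_
    ring

/-- The averaged plane wave `A(s) = ∫_0^∞ φ² e^{-φ} / 2 e^{is cos(φ + θ)} dφ`. -/
def avgWave (θ s : ℝ) : ℂ := angInt (fun φ => (angWeight φ : ℂ)) θ s

open Complex in
/-- The derivative of `avgWave`. -/
def avgWaveDeriv (θ s : ℝ) : ℂ :=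
  angInt (fun φ => (angWeight φ : ℂ) * (I * (Real.cos (φ + θ) : ℝ))) θ s

open Complex in
/-- The second derivative of `avgWave`. -/
def avgWaveDeriv₂ (θ s : ℝ) : ℂ :=
  angInt (fun φ => (angWeight φ : ℂ) * (I * (Real.cos (φ + θ) : ℝ)) *
    (I * (Real.cos (φ + θ) : ℝ))) θ s

/-- The source term of the Bessel-type equation of `avgWave`. -/
def avgWaveSource (θ s : ℝ) : ℂ := angInt (fun φ => (angWeightDeriv₂ φ : ℂ)) θ s

theorem hasDerivAt_avgWave (θ s : ℝ) : HasDerivAt (avgWave θ) (avgWaveDeriv θ s) s :=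
  hasDerivAt_angInt integrableOn_ofReal_angWeight θ s

open Complex in
theorem integrableOn_mul_I_cos {g : ℝ → ℂ} (hg : IntegrableOn g (Set.Ioi 0)) (θ : ℝ) :
    IntegrableOn (fun φ => g φ * (I * (Real.cos (φ + θ) : ℝ))) (Set.Ioi 0) := by
  refine hg.mul_bdd (c := 1) (Continuous.aestronglyMeasurable (by fun_prop))
    (.of_forall fun φ => ?_)
  rw [norm_mul, norm_I, norm_real, one_mul]
  exact Real.abs_cos_le_one _

theorem hasDerivAt_avgWaveDeriv (θ s : ℝ) :
    HasDerivAt (avgWaveDeriv θ) (avgWaveDeriv₂ θ s) s :=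
  hasDerivAt_angInt (integrableOn_mul_I_cos integrableOn_ofReal_angWeight θ) θ s

theorem continuous_avgWave (θ : ℝ) : Continuous (avgWave θ) :=
  continuous_iff_continuousAt.2 fun s => (hasDerivAt_avgWave θ s).continuousAt

theorem continuous_avgWaveDeriv (θ : ℝ) : Continuous (avgWaveDeriv θ) :=
  continuous_iff_continuousAt.2 fun s => (hasDerivAt_avgWaveDeriv θ s).continuousAt

theorem continuous_avgWaveSource (θ : ℝ) : Continuous (avgWaveSource θ) :=
  continuous_iff_continuousAt.2 fun s =>
    (hasDerivAt_angInt integrableOn_ofReal_angWeightDeriv₂ θ s).continuousAt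

theorem norm_avgWave_le (θ s : ℝ) : ‖avgWave θ s‖ ≤ 1 := by
  refine (norm_angInt_le θ s).trans_eq ?_
  rw [← integral_angWeight]
  refine setIntegral_congr_fun measurableSet_Ioi fun φ _ => ?_
  simp only [Complex.norm_real]
  exact Real.norm_of_nonneg (angWeight_nonneg φ)

theorem norm_avgWaveDeriv_le (θ s : ℝ) : ‖avgWaveDeriv θ s‖ ≤ 1 := by
  refine (norm_angInt_le θ s).trans ?_
  rw [← integral_angWeight]
  refine setIntegral_mono_on (integrableOn_mul_I_cos integrableOn_ofReal_angWeight θ).norm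
    integrableOn_angWeight measurableSet_Ioi fun φ _ => ?_
  rw [norm_mul, norm_mul, Complex.norm_I, Complex.norm_real, Complex.norm_real, one_mul,
    Real.norm_of_nonneg (angWeight_nonneg φ)]
  exact mul_le_of_le_one_right (angWeight_nonneg φ) (Real.abs_cos_le_one _)

theorem norm_avgWaveSource_le (θ s : ℝ) : ‖avgWaveSource θ s‖ ≤ 4 := by
  refine (norm_angInt_le θ s).trans ?_
  simp only [Complex.norm_real]
  exact integral_norm_angWeightDeriv₂_le

-- Two integrations by parts in φ, as for the Bessel equation of J₀. The derivative of (g' + is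
-- sin(φ + θ) g) e^{is cos(φ + θ)}, with g the weight, is the integrand of the left side once sin²
-- is replaced by 1 - cos². Because g vanishes to second order at 0 there is no boundary term, and
-- only the bounded source coming from g'' remains.
open Complex Filter Topology in
theorem avgWave_ode (θ s : ℝ) :
    s ^ 2 * (avgWaveDeriv₂ θ s + avgWave θ s) + s * avgWaveDeriv θ s + avgWaveSource θ s = 0 := by
  set e : ℝ → ℂ := fun φ => exp (I * ((s * Real.cos (φ + θ) : ℝ) : ℂ)) with he
  have hed : ∀ φ, HasDerivAt e (-(I * s * (Real.sin (φ + θ) : ℝ)) * e φ) φ := by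
    intro φ
    have h1 : HasDerivAt (fun φ : ℝ => s * Real.cos (φ + θ)) (s * (-Real.sin (φ + θ) * 1)) φ :=
      (((hasDerivAt_id φ).add_const θ).cos).const_mul s
    refine (((h1.ofReal_comp).const_mul I).cexp).congr_deriv ?_
    simp only [he]
    push_cast
    ring
  have hen : ∀ φ, ‖e φ‖ = 1 := fun φ => norm_exp_I_mul_ofReal' _
  set f : ℝ → ℂ := fun φ => ((angWeightDeriv φ : ℂ) +
    I * s * (Real.sin (φ + θ) : ℝ) * (angWeight φ : ℂ)) * e φ with hf
  set f' : ℝ → ℂ := fun φ =>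
    s ^ 2 * ((angWeight φ : ℂ) * (I * (Real.cos (φ + θ) : ℝ)) *
      (I * (Real.cos (φ + θ) : ℝ)) * e φ + (angWeight φ : ℂ) * e φ) +
    s * ((angWeight φ : ℂ) * (I * (Real.cos (φ + θ) : ℝ)) * e φ) +
    (angWeightDeriv₂ φ : ℂ) * e φ with hf'
  have hfd : ∀ φ, HasDerivAt f (f' φ) φ := by
    intro φ
    have hsin : HasDerivAt (fun φ : ℝ => Real.sin (φ + θ)) (Real.cos (φ + θ) * 1) φ :=
      ((hasDerivAt_id φ).add_const θ).sin
    have h := ((hasDerivAt_angWeightDeriv φ).ofReal_comp.fun_add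
      (((hsin.ofReal_comp).const_mul (I * s)).fun_mul
        (hasDerivAt_angWeight φ).ofReal_comp)).fun_mul (hed φ)
    refine h.congr_deriv ?_
    have hcs : ((Real.sin (φ + θ) : ℝ) : ℂ) ^ 2 = 1 - ((Real.cos (φ + θ) : ℝ) : ℂ) ^ 2 := by
      rw [← ofReal_pow, Real.sin_sq]; push_cast; ring
    simp only [hf', mul_one]
    linear_combination (s ^ 2 * angWeight φ * e φ) * hcs -
      (s ^ 2 * angWeight φ * e φ) * (((Real.sin (φ + θ) : ℝ) : ℂ) ^ 2 +
        ((Real.cos (φ + θ) : ℝ) : ℂ) ^ 2) * I_sq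
  have hp0 := integrableOn_ofReal_angWeight
  have i1 := integrableOn_mul_exp_cos hp0 θ s
  have i2 := integrableOn_mul_exp_cos (integrableOn_mul_I_cos hp0 θ) θ s
  have i3 := integrableOn_mul_exp_cos (integrableOn_mul_I_cos (integrableOn_mul_I_cos hp0 θ) θ) θ s
  have i4 := integrableOn_mul_exp_cos integrableOn_ofReal_angWeightDeriv₂ θ s
  have i31 : IntegrableOn (fun φ : ℝ => (s : ℂ) ^ 2 *
      ((angWeight φ : ℂ) * (I * (Real.cos (φ + θ) : ℝ)) * (I * (Real.cos (φ + θ) : ℝ)) *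
        exp (I * ((s * Real.cos (φ + θ) : ℝ) : ℂ)) +
      (angWeight φ : ℂ) * exp (I * ((s * Real.cos (φ + θ) : ℝ) : ℂ)))) (Set.Ioi 0) :=
    (i3.add i1).const_mul ((s : ℂ) ^ 2)
  have i312 : IntegrableOn (fun φ : ℝ => (s : ℂ) ^ 2 *
      ((angWeight φ : ℂ) * (I * (Real.cos (φ + θ) : ℝ)) * (I * (Real.cos (φ + θ) : ℝ)) *
        exp (I * ((s * Real.cos (φ + θ) : ℝ) : ℂ)) +
      (angWeight φ : ℂ) * exp (I * ((s * Real.cos (φ + θ) : ℝ) : ℂ))) +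
      s * ((angWeight φ : ℂ) * (I * (Real.cos (φ + θ) : ℝ)) *
        exp (I * ((s * Real.cos (φ + θ) : ℝ) : ℂ)))) (Set.Ioi 0) :=
    i31.add (i2.const_mul _)
  have hi : IntegrableOn f' (Set.Ioi 0) :=
    i312.add i4
  have hlim : Tendsto f atTop (𝓝 0) := by
    have hw : ∀ k, Tendsto (fun φ : ℝ => φ ^ k * Real.exp (-φ)) atTop (𝓝 0) :=
      Real.tendsto_pow_mul_exp_neg_atTop_nhds_zero
    have hb : Tendsto (fun φ : ℝ => φ ^ 1 * Real.exp (-φ) + (1 + |s|) *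
        (φ ^ 2 * Real.exp (-φ))) atTop (𝓝 0) := by
      simpa using (hw 1).add ((hw 2).const_mul (1 + |s|))
    refine squeeze_zero_norm' ?_ hb
    filter_upwards [eventually_ge_atTop (0 : ℝ)] with φ hφ
    rw [norm_mul, hen, mul_one]
    refine (norm_add_le _ _).trans ?_
    have hexp := Real.exp_pos (-φ)
    have h1 : ‖(angWeightDeriv φ : ℂ)‖ ≤ φ ^ 1 * Real.exp (-φ) + φ ^ 2 * Real.exp (-φ) := by
      rw [norm_real, angWeightDeriv, norm_mul, Real.norm_of_nonneg hexp.le, ← add_mul]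
      gcongr
      rw [Real.norm_eq_abs, abs_le]
      constructor <;> nlinarith [sq_nonneg φ]
    have h2 : ‖I * s * (Real.sin (φ + θ) : ℝ) * (angWeight φ : ℂ)‖ ≤
        |s| * (φ ^ 2 * Real.exp (-φ)) := by
      rw [norm_mul, norm_mul, norm_mul, norm_I, one_mul, norm_real, norm_real, norm_real,
        Real.norm_of_nonneg (angWeight_nonneg φ), Real.norm_eq_abs, Real.norm_eq_abs, mul_assoc]
      refine mul_le_mul_of_nonneg_left ?_ (abs_nonneg _)
      have h3 := mul_le_of_le_one_left (angWeight_nonneg φ) (Real.abs_sin_le_one (φ + θ))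
      refine h3.trans ?_
      unfold angWeight
      gcongr
      linarith [sq_nonneg φ]
    linarith
  have hint := integral_Ioi_of_hasDerivAt_of_tendsto (a := 0)
    (hfd 0).continuousAt.continuousWithinAt (fun φ _ => hfd φ) hi hlim
  -- Both g(0) and g'(0) vanish; this uses the factor φ² in the weight, hence the third rotation
  -- derivative.
  have hf0 : f 0 = 0 := by simp [hf, angWeight, angWeightDeriv]
  rw [hf0, sub_zero] at hint
  rw [← hint, avgWave, avgWaveDeriv, avgWaveDeriv₂, avgWaveSource, angInt, angInt, angInt, angInt,
    ← integral_add i3 i1, ← integral_const_mul, ← integral_const_mul,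
    ← integral_add i31 (i2.const_mul _), ← integral_add i312 i4]

/-! ### Splitting the averaged wave into outgoing and incoming amplitudes. -/

open Complex in
/-- The amplitudes of the outgoing (`ε = 1`) and incoming (`ε = -1`) parts of `√s A(s)`. -/
def halfWave (ε θ s : ℝ) : ℂ :=
  1 / 2 * ((√s : ℂ) * avgWave θ s -
    ε * I * (avgWave θ s / (2 * √s) + √s * avgWaveDeriv θ s)) * exp (I * ((-ε * s : ℝ) : ℂ))

open Complex in
/-- The derivative of `halfWave`. -/
def halfWaveDeriv (ε θ s : ℝ) : ℂ :=
  ε * I / 2 * ((avgWaveSource θ s + avgWave θ s / 4) / (s * √s)) * exp (I * ((-ε * s : ℝ) : ℂ))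

-- Variation of parameters: w = √s A satisfies w'' + w = -(S + A/4) s^{-3/2} with S the source, and
-- the amplitude is (w - iεw')e^{-iεs}/2, whose derivative is -iε(w'' + w)e^{-iεs}/2.
open Complex in
theorem hasDerivAt_halfWave {ε : ℝ} (hε : ε ^ 2 = 1) (θ : ℝ) {s : ℝ} (hs : 0 < s) :
    HasDerivAt (halfWave ε θ) (halfWaveDeriv ε θ s) s := by
  have hr : 0 < √s := Real.sqrt_pos.2 hs
  have hrc : (√s : ℂ) ≠ 0 := ofReal_ne_zero.2 hr.ne'
  have hsq : (√s : ℂ) ^ 2 = s := by rw [← ofReal_pow, Real.sq_sqrt hs.le]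
  have hsr := (Real.hasDerivAt_sqrt hs.ne').ofReal_comp
  have hA := hasDerivAt_avgWave θ s
  have hA' := hasDerivAt_avgWaveDeriv θ s
  have he : HasDerivAt (fun s : ℝ => exp (I * ((-ε * s : ℝ) : ℂ)))
      (exp (I * ((-ε * s : ℝ) : ℂ)) * (I * ((-ε * 1 : ℝ) : ℂ))) s :=
    ((((hasDerivAt_id s).const_mul (-ε)).ofReal_comp).const_mul I).cexp
  have h := (((hsr.fun_mul hA).fun_sub (((hA.fun_div (hsr.const_mul 2)
    (mul_ne_zero two_ne_zero hrc)).fun_add (hsr.fun_mul hA')).const_mul (ε * I))).const_mul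
    (1 / 2)).fun_mul he
  refine h.congr_deriv ?_
  have hode := avgWave_ode θ s
  have hεc : (ε : ℂ) ^ 2 = 1 := by rw [← ofReal_pow, hε, ofReal_one]
  have hode' : avgWaveSource θ s = -(s ^ 2 * (avgWaveDeriv₂ θ s + avgWave θ s) +
    s * avgWaveDeriv θ s) := by linear_combination hode
  simp only [halfWaveDeriv]
  rw [hode', ← hsq]
  generalize exp (I * ((-ε * s : ℝ) : ℂ)) = E
  push_cast
  field_simp
  generalize (√s : ℂ) = r at *
  have hk : (ε : ℂ) ^ 2 * I ^ 2 = -1 := by rw [hεc, I_sq, one_mul]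
  linear_combination (8 * E * r ^ 2 * (avgWave θ s + 2 * r ^ 2 * avgWaveDeriv θ s)) * hk

theorem norm_halfWaveDeriv_le {ε : ℝ} (hε : |ε| = 1) (θ : ℝ) {s : ℝ} (hs : 0 < s) :
    ‖halfWaveDeriv ε θ s‖ ≤ 5 / 2 / (s * √s) := by
  have hr : 0 < √s := Real.sqrt_pos.2 hs
  rw [halfWaveDeriv, norm_mul, norm_exp_I_mul_ofReal', mul_one, norm_mul, norm_div, norm_div,
    norm_mul, norm_mul, Complex.norm_I, Complex.norm_real, Complex.norm_real, Complex.norm_real,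
    Real.norm_eq_abs, hε, Real.norm_of_nonneg hs.le, Real.norm_of_nonneg hr.le, Complex.norm_ofNat]
  have h : ‖avgWaveSource θ s + avgWave θ s / 4‖ ≤ 5 := by
    refine (norm_add_le _ _).trans ?_
    rw [norm_div, Complex.norm_ofNat]
    linarith [norm_avgWaveSource_le θ s, norm_avgWave_le θ s]
  have : 1 * 1 / 2 * (‖avgWaveSource θ s + avgWave θ s / 4‖ / (s * √s)) ≤
      1 * 1 / 2 * (5 / (s * √s)) := by gcongr
  refine this.trans_eq ?_
  ring

/-- The amplitude is at most 2 at s = 1, and its derivative is bounded by (5/2)s^{-3/2}, whose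
integral over (1, ∞) is 5. The comparison function 7 - 5/√s has exactly this initial value and
derivative. -/
theorem norm_halfWave_le {ε : ℝ} (hε : |ε| = 1) (θ : ℝ) {s : ℝ} (hs : 1 ≤ s) :
    ‖halfWave ε θ s‖ ≤ 7 := by
  have hε2 : ε ^ 2 = 1 := by rw [← sq_abs, hε, one_pow]
  have hB : ∀ x ∈ Set.Icc 1 s, HasDerivAt (fun x => 7 - 5 / √x) (5 / 2 / (x * √x)) x := by
    intro x hx
    have hx0 : 0 < x := one_pos.trans_le hx.1
    have hr : √x ≠ 0 := (Real.sqrt_pos.2 hx0).ne'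
    refine ((((Real.hasDerivAt_sqrt hx0.ne').fun_inv hr).const_mul 5).const_sub 7).congr_deriv ?_
    rw [Real.sq_sqrt hx0.le]
    field_simp
  have hpos : ∀ x ∈ Set.Icc 1 s, 0 < x := fun x hx => one_pos.trans_le hx.1
  have h := image_norm_le_of_norm_deriv_right_le_deriv_boundary' (a := 1) (b := s)
    (f := halfWave ε θ) (f' := halfWaveDeriv ε θ) (B := fun x => 7 - 5 / √x)
    (B' := fun x => 5 / 2 / (x * √x))
    (fun x hx => (hasDerivAt_halfWave hε2 θ (hpos x hx)).continuousAt.continuousWithinAt)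
    (fun x hx => (hasDerivAt_halfWave hε2 θ (hpos x ⟨hx.1, hx.2.le⟩)).hasDerivWithinAt) ?_
    (fun x hx => (hB x hx).continuousAt.continuousWithinAt)
    (fun x hx => (hB x ⟨hx.1, hx.2.le⟩).hasDerivWithinAt)
    (fun x hx => norm_halfWaveDeriv_le hε θ (hpos x ⟨hx.1, hx.2.le⟩)) ⟨hs, le_rfl⟩
  · refine h.trans ?_
    have : 0 ≤ 5 / √s := by positivity
    linarith
  · rw [halfWave, norm_mul, norm_exp_I_mul_ofReal', mul_one, norm_mul]
    have hA := norm_avgWave_le θ 1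
    have hA' := norm_avgWaveDeriv_le θ 1
    simp only [Real.sqrt_one, Complex.ofReal_one, one_mul, mul_one, div_one]
    have h1 : ‖avgWave θ 1 - ε * Complex.I * (avgWave θ 1 / 2 + avgWaveDeriv θ 1)‖ ≤ 4 := by
      refine (norm_sub_le _ _).trans ?_
      rw [norm_mul, norm_mul, Complex.norm_I, Complex.norm_real, Real.norm_eq_abs, hε, one_mul,
        one_mul]
      have := norm_add_le (avgWave θ 1 / 2) (avgWaveDeriv θ 1)
      rw [norm_div, Complex.norm_ofNat] at this
      linarith
    have h2 : ‖(1 / 2 : ℂ)‖ = 1 / 2 := by norm_num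
    rw [h2]
    linarith

open Complex in
theorem sqrt_mul_avgWave (θ : ℝ) {s : ℝ} :
    (√s : ℂ) * avgWave θ s = halfWave 1 θ s * exp (I * (s : ℂ)) +
      halfWave (-1) θ s * exp (I * ((-s : ℝ) : ℂ)) := by
  have h1 : exp (I * ((-1 * s : ℝ) : ℂ)) * exp (I * (s : ℂ)) = 1 := by
    rw [← exp_add]; simp
  have h2 : exp (I * ((- -1 * s : ℝ) : ℂ)) * exp (I * ((-s : ℝ) : ℂ)) = 1 := by
    rw [← exp_add]; simp
  rw [halfWave, halfWave, mul_assoc, h1, mul_assoc _ _ (exp (I * ((-s : ℝ) : ℂ))), h2]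
  push_cast
  ring

/-! ### Uniform 1/τ decay of the averaged oscillatory integral. -/

open Complex in
/-- The oscillatory integral `∫_0^1 2 v³ e^{iτv³} A(ρ v²) dv` (that is, with `σ = v²`,
`∫_0^1 σ e^{iτσ^{3/2}} A(ρσ) dσ`). -/
def oscInt (τ ρ θ : ℝ) : ℂ :=
  ∫ v in (0 : ℝ)..1, 2 * (v : ℂ) ^ 3 * exp (I * ((τ * v ^ 3 : ℝ) : ℂ)) * avgWave θ (ρ * v ^ 2)

open Complex in
theorem continuous_oscInt_integrand (τ ρ θ : ℝ) : Continuous fun v : ℝ =>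
    2 * (v : ℂ) ^ 3 * exp (I * ((τ * v ^ 3 : ℝ) : ℂ)) * avgWave θ (ρ * v ^ 2) := by
  have := continuous_avgWave θ
  fun_prop

theorem norm_oscInt_le_one (τ ρ θ : ℝ) : ‖oscInt τ ρ θ‖ ≤ 1 := by
  have h : ∀ v ∈ Set.uIoc (0 : ℝ) 1, ‖2 * (v : ℂ) ^ 3 *
      Complex.exp (Complex.I * ((τ * v ^ 3 : ℝ) : ℂ)) * avgWave θ (ρ * v ^ 2)‖ ≤ 2 * v ^ 3 := by
    intro v hv
    rw [Set.uIoc_of_le zero_le_one] at hv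
    rw [norm_mul, norm_mul, norm_exp_I_mul_ofReal', mul_one, norm_mul, norm_pow, Complex.norm_real,
      Complex.norm_ofNat, Real.norm_of_nonneg hv.1.le]
    exact mul_le_of_le_one_right (by have := hv.1; positivity) (norm_avgWave_le _ _)
  have h2 := intervalIntegral.norm_integral_le_of_norm_le (μ := volume) zero_le_one
    (.of_forall fun v hv => h v (by rwa [Set.uIoc_of_le zero_le_one]))
    (Continuous.intervalIntegrable (by fun_prop) 0 1)
  refine h2.trans ?_
  rw [intervalIntegral.integral_const_mul, integral_pow]
  norm_num

-- On the range ρv² ≤ 1 the wave does not oscillate, so e^{iτv³} is integrated by parts: of the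
-- weight v³, a factor v² is absorbed by the phase derivative 3τv², leaving v A(ρv²), whose value
-- and derivative are bounded.
open Complex in
theorem norm_oscInt_low_le {τ ρ b : ℝ} (hτ : 0 < τ) (hρ : 0 ≤ ρ) (hb : 0 ≤ b) (hb1 : b ≤ 1)
    (hbρ : ρ * b ^ 2 ≤ 1) (θ : ℝ) :
    ‖∫ v in (0 : ℝ)..b, 2 * (v : ℂ) ^ 3 * exp (I * ((τ * v ^ 3 : ℝ) : ℂ)) *
      avgWave θ (ρ * v ^ 2)‖ ≤ 3 / τ := by
  have hc0 := continuous_avgWave θ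
  have hc1 := continuous_avgWaveDeriv θ
  set G : ℝ → ℂ := fun v => v * avgWave θ (ρ * v ^ 2) * exp (I * ((τ * v ^ 3 : ℝ) : ℂ)) with hG
  set E : ℝ → ℂ := fun v => (avgWave θ (ρ * v ^ 2) + 2 * ρ * v ^ 2 * avgWaveDeriv θ (ρ * v ^ 2)) *
    exp (I * ((τ * v ^ 3 : ℝ) : ℂ)) with hE
  set f : ℝ → ℂ := fun v => 2 * (v : ℂ) ^ 3 * exp (I * ((τ * v ^ 3 : ℝ) : ℂ)) *
      avgWave θ (ρ * v ^ 2) with hf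
  have hfc : Continuous f := continuous_oscInt_integrand τ ρ θ
  have hEc : Continuous E := by simp only [hE]; fun_prop
  have hGd : ∀ v ∈ Set.uIcc 0 b, HasDerivAt G (3 * I * τ / 2 * f v + E v) v := by
    intro v _
    have h1 : HasDerivAt (fun v : ℝ => ρ * v ^ 2) (ρ * (2 * v)) v := by
      simpa using (hasDerivAt_pow 2 v).const_mul ρ
    have h2 : HasDerivAt (fun v : ℝ => τ * v ^ 3) (τ * (3 * v ^ 2)) v := by
      simpa using (hasDerivAt_pow 3 v).const_mul τ
    have h3 := (hasDerivAt_avgWave θ (ρ * v ^ 2)).scomp v h1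
    have h := ((hasDerivAt_id v).ofReal_comp.fun_mul h3).fun_mul
      ((h2.ofReal_comp).const_mul I).cexp
    refine h.congr_deriv ?_
    simp only [hf, hE, Function.comp, real_smul, id]
    push_cast
    ring
  have hFTC := intervalIntegral.integral_eq_sub_of_hasDerivAt hGd
    ((Continuous.add (hfc.const_mul _) hEc).intervalIntegrable _ _)
  rw [intervalIntegral.integral_add ((hfc.const_mul _).intervalIntegrable _ _)
    (hEc.intervalIntegrable _ _), intervalIntegral.integral_const_mul] at hFTC
  have hG0 : G 0 = 0 := by simp [hG]
  have hGb : ‖G b‖ ≤ 1 := by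
    simp only [hG]
    rw [norm_mul, norm_exp_I_mul_ofReal', mul_one, norm_mul, norm_real, Real.norm_of_nonneg hb]
    have := norm_avgWave_le θ (ρ * b ^ 2)
    exact mul_le_one₀ hb1 (norm_nonneg _) this
  have hEle : ‖∫ v in (0 : ℝ)..b, E v‖ ≤ 3 * |b - 0| := by
    refine intervalIntegral.norm_integral_le_of_norm_le_const fun v hv => ?_
    rw [Set.uIoc_of_le hb] at hv
    simp only [hE]
    rw [norm_mul, norm_exp_I_mul_ofReal', mul_one]
    refine (norm_add_le _ _).trans ?_
    have h1 := norm_avgWave_le θ (ρ * v ^ 2)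
    have h2 := norm_avgWaveDeriv_le θ (ρ * v ^ 2)
    have h3 : ρ * v ^ 2 ≤ 1 := by
      refine le_trans ?_ hbρ
      have := hv.1
      have := hv.2
      gcongr
    have h4 : ‖(2 * ρ * v ^ 2 : ℂ)‖ ≤ 2 := by
      have : (2 * ρ * v ^ 2 : ℂ) = ((2 * (ρ * v ^ 2) : ℝ) : ℂ) := by push_cast; ring
      rw [this, norm_real, Real.norm_of_nonneg (by positivity)]
      linarith
    rw [norm_mul]
    nlinarith [norm_nonneg (avgWaveDeriv θ (ρ * v ^ 2)), norm_nonneg (2 * ρ * v ^ 2 : ℂ)]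
  rw [sub_zero, abs_of_nonneg hb] at hEle
  -- The endpoint gives 1 and the error integral 3; dividing by 3τ/2 leaves 8/(3τ) ≤ 3/τ.
  have hmul : ‖3 * I * τ / 2‖ * ‖∫ v in (0 : ℝ)..b, f v‖ ≤ 4 := by
    rw [← norm_mul]
    have : 3 * I * τ / 2 * ∫ v in (0 : ℝ)..b, f v = G b - ∫ v in (0 : ℝ)..b, E v := by
      rw [hG0, sub_zero] at hFTC
      rw [← hFTC]; ring
    rw [this]
    refine (norm_sub_le _ _).trans ?_
    linarith
  have hn : ‖3 * I * τ / 2‖ = 3 * τ / 2 := by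
    rw [norm_div, norm_mul, norm_mul, norm_I, norm_real, Real.norm_of_nonneg hτ.le]
    norm_num
  rw [hn] at hmul
  rw [le_div_iff₀ hτ]
  linarith

-- The cubic phase estimate with κ = ερ, b = 1/√ρ and Q = 7. The decay s^{-3/2} of the amplitude's
-- derivative at s = ρv² becomes 5b/v², which is the hypothesis on q'. The constant is 168 = 24 · 7.
open Complex in
theorem norm_integral_halfWave_le {τ ρ ε : ℝ} (hτ : 0 < τ) (hρ : 1 ≤ ρ) (hε : |ε| = 1) (θ : ℝ) :
    ‖∫ v in (1 / √ρ)..1, (v : ℂ) ^ 2 * halfWave ε θ (ρ * v ^ 2) *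
      exp (I * ((τ * v ^ 3 + ε * ρ * v ^ 2 : ℝ) : ℂ))‖ ≤ 168 * (√ρ / τ) := by
  have hρ0 : 0 < ρ := one_pos.trans_le hρ
  have hr : 0 < √ρ := Real.sqrt_pos.2 hρ0
  have hr1 : 1 ≤ √ρ := Real.one_le_sqrt.2 hρ
  have hε2 : ε ^ 2 = 1 := by rw [← sq_abs, hε, one_pow]
  have hκ : |ε * ρ| = ρ := by rw [abs_mul, hε, one_mul, abs_of_pos hρ0]
  have hs : ∀ v ∈ Set.Icc (1 / √ρ) 1, 0 < v ∧ 1 ≤ ρ * v ^ 2 := by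
    intro v hv
    have hv0 : 0 < v := (by positivity : 0 < 1 / √ρ).trans_le hv.1
    refine ⟨hv0, ?_⟩
    have h := hv.1
    rw [div_le_iff₀ hr] at h
    calc (1 : ℝ) ≤ (v * √ρ) ^ 2 := one_le_pow₀ h
      _ = ρ * v ^ 2 := by rw [mul_pow, Real.sq_sqrt hρ0.le, mul_comm]
  have key := norm_integral_cubic_phase_le (τ := τ) (κ := ε * ρ) (b := 1 / √ρ) (Q := 7)
    (q := fun v => halfWave ε θ (ρ * v ^ 2))
    (q' := fun v => (ρ * (2 * v) : ℝ) • halfWaveDeriv ε θ (ρ * v ^ 2)) hτ (by rwa [hκ])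
    (by positivity) ((div_le_one hr).2 hr1) ?_ ?_ ?_ ?_
  · rw [hκ] at key
    refine key.trans_eq ?_
    ring
  · intro v hv
    have h1 : HasDerivAt (fun v : ℝ => ρ * v ^ 2) (ρ * (2 * v)) v := by
      simpa using (hasDerivAt_pow 2 v).const_mul ρ
    exact (hasDerivAt_halfWave hε2 θ (one_pos.trans_le (hs v hv).2)).scomp v h1
  · have h1 := continuous_avgWave θ
    have h2 := continuous_avgWaveSource θ
    have hn : ContinuousOn (fun v : ℝ => (avgWaveSource θ (ρ * v ^ 2) +
        avgWave θ (ρ * v ^ 2) / 4) / ((ρ * v ^ 2 : ℝ) * √(ρ * v ^ 2))) (Set.Icc (1 / √ρ) 1) := by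
      refine ContinuousOn.div (by fun_prop) (by fun_prop) fun v hv => ?_
      have h0 : 0 < ρ * v ^ 2 := one_pos.trans_le (hs v hv).2
      exact mul_ne_zero (ofReal_ne_zero.2 h0.ne') (ofReal_ne_zero.2 (Real.sqrt_pos.2 h0).ne')
    have he : Continuous fun v : ℝ => exp (I * ((-ε * (ρ * v ^ 2) : ℝ) : ℂ)) := by fun_prop
    have hv2 : Continuous fun v : ℝ => ρ * (2 * v) := by fun_prop
    exact hv2.continuousOn.smul ((continuousOn_const.mul hn).mul he.continuousOn)
  · intro v hv
    exact norm_halfWave_le hε θ (hs v hv).2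
  · intro v hv
    obtain ⟨hv0, hv1⟩ := hs v hv
    rw [norm_smul, Real.norm_of_nonneg (by positivity)]
    have hsq : √(ρ * v ^ 2) = √ρ * v := by rw [Real.sqrt_mul hρ0.le, Real.sqrt_sq hv0.le]
    calc ρ * (2 * v) * ‖halfWaveDeriv ε θ (ρ * v ^ 2)‖
        ≤ ρ * (2 * v) * (5 / 2 / (ρ * v ^ 2 * √(ρ * v ^ 2))) := by
          gcongr
          exact norm_halfWaveDeriv_le hε θ (one_pos.trans_le hv1)
      _ = 5 * (1 / √ρ) / v ^ 2 := by rw [hsq]; field_simp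
      _ ≤ 7 * (1 / √ρ) / v ^ 2 := by gcongr; norm_num

open Complex in
/-- The uniform `1 / τ` decay of `oscInt`. -/
theorem norm_oscInt_le {τ ρ : ℝ} (hτ : 0 < τ) (hρ : 0 ≤ ρ) (θ : ℝ) :
    ‖oscInt τ ρ θ‖ ≤ 675 / τ := by
  rcases le_total ρ 1 with h | h
  · refine (norm_oscInt_low_le hτ hρ zero_le_one le_rfl (by simpa using h) θ).trans ?_
    gcongr
    norm_num
  have hρ0 : 0 < ρ := one_pos.trans_le h
  have hr : 0 < √ρ := Real.sqrt_pos.2 hρ0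
  have hr1 : 1 ≤ √ρ := Real.one_le_sqrt.2 h
  -- The cut is at ρv² = 1, where the half-wave amplitudes start to be bounded.
  set b := 1 / √ρ with hb
  have hb0 : 0 < b := by positivity
  have hb1 : b ≤ 1 := (div_le_one hr).2 hr1
  have hlow := norm_oscInt_low_le hτ hρ hb0.le hb1
    (by rw [hb, div_pow, Real.sq_sqrt hρ0.le, one_pow, mul_one_div_cancel hρ0.ne']) θ
  have hcf := continuous_oscInt_integrand τ ρ θ
  have hhw : ∀ ε : ℝ, |ε| = 1 → IntervalIntegrable (fun v : ℝ => (v : ℂ) ^ 2 *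
      halfWave ε θ (ρ * v ^ 2) * exp (I * ((τ * v ^ 3 + ε * ρ * v ^ 2 : ℝ) : ℂ))) volume b 1 := by
    intro ε hε
    have hε2 : ε ^ 2 = 1 := by rw [← sq_abs, hε, one_pow]
    refine ContinuousOn.intervalIntegrable ?_
    rw [Set.uIcc_of_le hb1]
    refine ContinuousOn.mul (ContinuousOn.mul (by fun_prop) fun v hv => ?_) (by fun_prop)
    have hv0 : 0 < v := hb0.trans_le hv.1
    have h1 := (hasDerivAt_halfWave hε2 θ (by positivity : 0 < ρ * v ^ 2)).continuousAt
    exact (ContinuousAt.comp (f := fun v : ℝ => ρ * v ^ 2) h1 (by fun_prop)).continuousWithinAt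
  -- One factor v of the weight 2v³ turns A(ρv²) into √(ρv²) A(ρv²)/√ρ. The gain b = 1/√ρ cancels
  -- the √ρ of the cubic phase estimate.
  have hhigh : ∫ v in b..1, 2 * (v : ℂ) ^ 3 * exp (I * ((τ * v ^ 3 : ℝ) : ℂ)) *
      avgWave θ (ρ * v ^ 2) = 2 * b * ((∫ v in b..1, (v : ℂ) ^ 2 * halfWave 1 θ (ρ * v ^ 2) *
      exp (I * ((τ * v ^ 3 + 1 * ρ * v ^ 2 : ℝ) : ℂ))) + ∫ v in b..1, (v : ℂ) ^ 2 *
      halfWave (-1) θ (ρ * v ^ 2) * exp (I * ((τ * v ^ 3 + -1 * ρ * v ^ 2 : ℝ) : ℂ))) := by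
    rw [← intervalIntegral.integral_add (hhw 1 (by simp)) (hhw (-1) (by simp)),
      ← intervalIntegral.integral_const_mul]
    refine intervalIntegral.integral_congr fun v hv => ?_
    rw [Set.uIcc_of_le hb1] at hv
    have hv0 : 0 < v := hb0.trans_le hv.1
    have hsq : √(ρ * v ^ 2) = √ρ * v := by rw [Real.sqrt_mul hρ0.le, Real.sqrt_sq hv0.le]
    have hw := sqrt_mul_avgWave θ (s := ρ * v ^ 2)
    rw [hsq] at hw
    have he1 : exp (I * ((τ * v ^ 3 + 1 * ρ * v ^ 2 : ℝ) : ℂ)) =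
        exp (I * ((τ * v ^ 3 : ℝ) : ℂ)) * exp (I * ((ρ * v ^ 2 : ℝ) : ℂ)) := by
      rw [← exp_add]; congr 1; push_cast; ring
    have he2 : exp (I * ((τ * v ^ 3 + -1 * ρ * v ^ 2 : ℝ) : ℂ)) =
        exp (I * ((τ * v ^ 3 : ℝ) : ℂ)) * exp (I * ((-(ρ * v ^ 2) : ℝ) : ℂ)) := by
      rw [← exp_add]; congr 1; push_cast; ring
    have hbr : (b : ℂ) * (√ρ : ℂ) = 1 := by
      rw [← ofReal_mul, hb, one_div_mul_cancel hr.ne', ofReal_one]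
    simp only [he1, he2]
    rw [ofReal_mul] at hw
    linear_combination (2 * b * v ^ 2 * exp (I * ((τ * v ^ 3 : ℝ) : ℂ))) * hw -
      (2 * v ^ 3 * exp (I * ((τ * v ^ 3 : ℝ) : ℂ)) * avgWave θ (ρ * v ^ 2)) * hbr
  have h1 := norm_integral_halfWave_le hτ h (ε := 1) (by simp) θ
  have h2 := norm_integral_halfWave_le hτ h (ε := -1) (by simp) θ
  rw [oscInt, ← intervalIntegral.integral_add_adjacent_intervals (b := b)
    (hcf.intervalIntegrable _ _) (hcf.intervalIntegrable _ _), hhigh]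
  refine (norm_add_le _ _).trans ?_
  rw [norm_mul, norm_mul, norm_real, Complex.norm_ofNat, Real.norm_of_nonneg hb0.le]
  have h3 := norm_add_le (∫ v in b..1, (v : ℂ) ^ 2 * halfWave 1 θ (ρ * v ^ 2) *
      exp (I * ((τ * v ^ 3 + 1 * ρ * v ^ 2 : ℝ) : ℂ))) (∫ v in b..1, (v : ℂ) ^ 2 *
      halfWave (-1) θ (ρ * v ^ 2) * exp (I * ((τ * v ^ 3 + -1 * ρ * v ^ 2 : ℝ) : ℂ)))
  have h4 := h3.trans (add_le_add h1 h2)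
  have h5 := mul_le_mul_of_nonneg_left h4 (by positivity : 0 ≤ 2 * b)
  have h6 : 2 * b * (168 * (√ρ / τ) + 168 * (√ρ / τ)) = 672 / τ := by
    rw [hb]; field_simp; norm_num
  have h7 : 675 / τ = 3 / τ + 672 / τ := by ring
  rw [h7]
  exact add_le_add hlow (h5.trans_eq h6)

/-! ### Distributions represented by functions -/

-- Test against a bump function equal to 1 on a ball containing the compact set.
open scoped ContDiff in
theorem IsRepresentedBy.locallyIntegrable {T : 𝓢'(Plane, ℂ)} {v : Plane → ℂ}
    (h : IsRepresentedBy T v) : LocallyIntegrable v := by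
  rw [locallyIntegrable_iff]
  intro K hK
  obtain ⟨R, hR, hKR⟩ := hK.isBounded.subset_closedBall_lt 0 0
  let b : ContDiffBump (0 : Plane) := ⟨R, R + 1, hR, by linarith⟩
  have hb1 : HasCompactSupport (Complex.ofRealCLM ∘ b) := b.hasCompactSupport.comp_left rfl
  have hb2 : ContDiff ℝ ∞ (Complex.ofRealCLM ∘ b) := Complex.ofRealCLM.contDiff.comp b.contDiff
  have hi := (h (hb1.toSchwartzMap hb2)).1.integrableOn (s := K)
  refine hi.congr_fun (fun x hx => ?_) hK.measurableSet
  have : b x = 1 := b.one_of_mem_closedBall (hKR hx)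
  simp [this]

open scoped ContDiff in
theorem IsRepresentedBy.ae_eq {T : 𝓢'(Plane, ℂ)} {v w : Plane → ℂ}
    (hv : IsRepresentedBy T v) (hw : IsRepresentedBy T w) : v =ᵐ[volume] w := by
  refine ae_eq_of_integral_contDiff_smul_eq hv.locallyIntegrable hw.locallyIntegrable
    fun g hg hgc => ?_
  have hb1 : HasCompactSupport (Complex.ofRealCLM ∘ g) := hgc.comp_left rfl
  have hb2 : ContDiff ℝ ∞ (Complex.ofRealCLM ∘ g) := Complex.ofRealCLM.contDiff.comp hg
  have h := (hv (hb1.toSchwartzMap hb2)).2.symm.trans (hw (hb1.toSchwartzMap hb2)).2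
  simpa using h

theorem isRepresentedBy_toTemperedDistribution {p : ℝ≥0∞} [Fact (1 ≤ p)]
    (v : Lp ℂ p (volume : Measure Plane)) :
    IsRepresentedBy (Lp.toTemperedDistribution v) v := by
  intro φ
  refine ⟨?_, by simp⟩
  have : ENNReal.HolderConjugate p (1 - p⁻¹)⁻¹ := ENNReal.HolderConjugate.inv_one_sub_inv' Fact.out
  have h := (φ.memLp (1 - p⁻¹)⁻¹ (volume : Measure Plane)).integrable_mul (Lp.memLp v)
  exact h

theorem IsRepresentedBy.congr {T : 𝓢'(Plane, ℂ)} {v w : Plane → ℂ}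
    (hv : IsRepresentedBy T v) (h : v =ᵐ[volume] w) : IsRepresentedBy T w := by
  intro φ
  have h' : (fun x => φ x * v x) =ᵐ[volume] fun x => φ x * w x := by
    filter_upwards [h] with x hx
    rw [hx]
  exact ⟨(hv φ).1.congr h', (hv φ).2.trans (integral_congr_ae h')⟩

theorem IsRepresentedBy.unique {T S : 𝓢'(Plane, ℂ)} {v : Plane → ℂ}
    (hT : IsRepresentedBy T v) (hS : IsRepresentedBy S v) : T = S := by
  ext φ
  rw [(hT φ).2, (hS φ).2]

/-- Plancherel's theorem for tempered distributions represented by functions. -/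
theorem IsRepresentedBy.eLpNorm_fourier {u : 𝓢'(Plane, ℂ)} {v G : Plane → ℂ}
    (hv : IsRepresentedBy u v) (hG : IsRepresentedBy (𝓕 u) G) (hv2 : MemLp v 2) :
    eLpNorm G 2 = eLpNorm v 2 := by
  have h1 : IsRepresentedBy (Lp.toTemperedDistribution (hv2.toLp v)) v :=
    (isRepresentedBy_toTemperedDistribution _).congr hv2.coeFn_toLp
  have h2 : u = Lp.toTemperedDistribution (hv2.toLp v) := hv.unique h1
  rw [h2, Lp.fourier_toTemperedDistribution_eq] at hG
  have h3 := (isRepresentedBy_toTemperedDistribution _).ae_eq hG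
  rw [← eLpNorm_congr_ae h3, ← Lp.enorm_def, ← eLpNorm_congr_ae hv2.coeFn_toLp, ← Lp.enorm_def]
  rw [← ofReal_norm, ← ofReal_norm, Lp.norm_fourier_eq]

theorem exists_representation_of_multiplierNorm_lt_top {m : Plane → ℂ} {p : ℝ≥0∞}
    {f : 𝓢'(Plane, ℂ)} (h : multiplierNorm m p f < ⊤) : ∃ F, IsRepresentedBy (𝓕 f) F := by
  simp only [multiplierNorm, iInf_lt_iff] at h
  obtain ⟨u, v, ⟨F, hF, -⟩, -⟩ := h
  exact ⟨F, hF⟩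

/-- Every competitor v in the infimum either has infinite norm or is in L², and then Plancherel
applies. The function representing the transform of f is unique up to null sets, so the left side
does not depend on its choice. -/
theorem eLpNorm_le_multiplierNorm {m : Plane → ℂ} {f : 𝓢'(Plane, ℂ)} {F : Plane → ℂ}
    (hF : IsRepresentedBy (𝓕 f) F) :
    eLpNorm (fun ξ => m ((2 * Real.pi) • ξ) * F ξ) 2 ≤ multiplierNorm m 2 f := by
  refine le_iInf fun u => le_iInf fun v => le_iInf fun hu => le_iInf fun hv => ?_
  obtain ⟨F', hF', huF⟩ := hu
  by_cases hv2 : eLpNorm v 2 volume = ⊤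
  · rw [hv2]; exact le_top
  have hvm : MemLp v 2 := ⟨hv.locallyIntegrable.aestronglyMeasurable, lt_top_iff_ne_top.2 hv2⟩
  rw [← hv.eLpNorm_fourier huF hvm]
  refine (eLpNorm_congr_ae ?_).le
  filter_upwards [hF.ae_eq hF'] with ξ hξ
  rw [hξ]

/-! ### The vector fields on the Fourier side -/

/-- Rotation of the plane by a quarter turn. -/
def perp (ξ : Plane) : Plane := !₂[-ξ 1, ξ 0]

theorem hasTemperateGrowth_coord (i : Fin 2) :
    (fun x : Plane => ((x i : ℝ) : ℂ)).HasTemperateGrowth :=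
  (Complex.ofRealCLM ∘L (EuclideanSpace.proj i : Plane →L[ℝ] ℝ)).hasTemperateGrowth

/-- The Schwartz function `ξ ↦ ξⱼ ∂ᵢ ψ(ξ)`. -/
def coordDeriv (j i : Fin 2) (ψ : 𝓢(Plane, ℂ)) : 𝓢(Plane, ℂ) :=
  SchwartzMap.smulLeftCLM ℂ (fun x : Plane => ((x j : ℝ) : ℂ))
    (∂_{(EuclideanSpace.single i (1 : ℝ) : Plane)} ψ)

theorem coordDeriv_apply (j i : Fin 2) (ψ : 𝓢(Plane, ℂ)) (ξ : Plane) :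
    coordDeriv j i ψ ξ = ξ j * fderiv ℝ ψ ξ (EuclideanSpace.single i (1 : ℝ)) := by
  rw [coordDeriv, SchwartzMap.smulLeftCLM_apply_apply (hasTemperateGrowth_coord j),
    SchwartzMap.lineDerivOp_apply_eq_fderiv, smul_eq_mul]

theorem inner_single_eq (i : Fin 2) (x : Plane) :
    inner ℝ x (EuclideanSpace.single i (1 : ℝ)) = x i := by
  simp [EuclideanSpace.inner_single_right]

theorem smulLeftCLM_inner_single (i : Fin 2) (ψ : 𝓢(Plane, ℂ)) :
    SchwartzMap.smulLeftCLM ℂ (inner ℝ · (EuclideanSpace.single i (1 : ℝ) : Plane)) ψ =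
      SchwartzMap.smulLeftCLM ℂ (fun x : Plane => ((x i : ℝ) : ℂ)) ψ := by
  ext x
  rw [SchwartzMap.smulLeftCLM_apply_apply (by fun_prop),
    SchwartzMap.smulLeftCLM_apply_apply (hasTemperateGrowth_coord i), inner_single_eq]
  rfl

-- The factors 2πi from differentiation and from multiplication cancel, as do the signs, so Ω and Σ
-- act on the frequency side by first order operators without constants.
open Complex in
theorem fourier_coordMul_partialDeriv (i j : Fin 2) (f : 𝓢'(Plane, ℂ)) (ψ : 𝓢(Plane, ℂ)) :
    (𝓕 (coordMul i (partialDeriv j f))) ψ = (𝓕 f) (coordDeriv j i ψ) := by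
  rw [TemperedDistribution.fourier_apply, TemperedDistribution.fourier_apply, coordMul,
    TemperedDistribution.smulLeftCLM_apply_apply, partialDeriv,
    TemperedDistribution.lineDerivOp_apply_apply]
  congr 1
  have h1 := SchwartzMap.fourier_lineDerivOp_eq ψ (EuclideanSpace.single i (1 : ℝ) : Plane)
  rw [smulLeftCLM_inner_single] at h1
  have h2 := SchwartzMap.lineDerivOp_fourier_eq
    (∂_{(EuclideanSpace.single i (1 : ℝ) : Plane)} ψ) (EuclideanSpace.single j (1 : ℝ) : Plane)
  rw [smulLeftCLM_inner_single, h1, lineDerivOp_smul, ← coordDeriv, fourier_smul] at h2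
  have hc : (2 * (Real.pi : ℂ) * I) ≠ 0 := two_pi_I_ne_zero
  have h3 : (2 * (Real.pi : ℂ) * I) • (-∂_{(EuclideanSpace.single j (1 : ℝ) : Plane)}
      (SchwartzMap.smulLeftCLM ℂ (fun x : Plane => ((x i : ℝ) : ℂ)) (𝓕 ψ))) =
      (2 * (Real.pi : ℂ) * I) • 𝓕 (coordDeriv j i ψ) := by
    rw [smul_neg, h2, neg_smul, neg_neg]
  exact smul_right_injective _ hc h3

theorem perp_eq (ξ : Plane) : perp ξ =
    ξ 0 • EuclideanSpace.single 1 (1 : ℝ) - ξ 1 • EuclideanSpace.single 0 (1 : ℝ) := by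
  ext i
  fin_cases i <;> simp [perp]

theorem eq_sum_single (ξ : Plane) : ξ =
    ξ 0 • EuclideanSpace.single 0 (1 : ℝ) + ξ 1 • EuclideanSpace.single 1 (1 : ℝ) := by
  ext i
  fin_cases i <;> simp

/-- Ω commutes with the Fourier transform and is divergence free, hence antisymmetric. This weak
form, unlike a formula for F', needs no regularity of F. -/
theorem integral_rotationField {f : 𝓢'(Plane, ℂ)} {F F' : Plane → ℂ}
    (hF : IsRepresentedBy (𝓕 f) F) (hF' : IsRepresentedBy (𝓕 (rotationField f)) F')
    (ψ : 𝓢(Plane, ℂ)) :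
    ∫ ξ, ψ ξ * F' ξ = -∫ ξ, fderiv ℝ ψ ξ (perp ξ) * F ξ := by
  have h : (𝓕 (rotationField f)) ψ = -(𝓕 f) (coordDeriv 0 1 ψ - coordDeriv 1 0 ψ) := by
    rw [map_sub, ← fourier_coordMul_partialDeriv, ← fourier_coordMul_partialDeriv, neg_sub]
    rfl
  rw [(hF' ψ).2, (hF _).2] at h
  rw [h]
  congr 2
  ext ξ
  rw [sub_apply, coordDeriv_apply, coordDeriv_apply, perp_eq, map_sub, map_smul,
    map_smul, Complex.real_smul, Complex.real_smul]

/-- The transform of Σf is -div(ξF), whose weak form has ξ·∇ on the test function. -/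
theorem integral_scalingField {f : 𝓢'(Plane, ℂ)} {F F' : Plane → ℂ}
    (hF : IsRepresentedBy (𝓕 f) F) (hF' : IsRepresentedBy (𝓕 (scalingField f)) F')
    (ψ : 𝓢(Plane, ℂ)) :
    ∫ ξ, ψ ξ * F' ξ = ∫ ξ, fderiv ℝ ψ ξ ξ * F ξ := by
  have h : (𝓕 (scalingField f)) ψ = (𝓕 f) (coordDeriv 0 0 ψ + coordDeriv 1 1 ψ) := by
    rw [map_add, ← fourier_coordMul_partialDeriv, ← fourier_coordMul_partialDeriv]
    rfl
  rw [(hF' ψ).2, (hF _).2] at h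
  rw [h]
  congr 1
  ext ξ
  rw [add_apply, coordDeriv_apply, coordDeriv_apply]
  have hs := congrArg (fderiv ℝ ψ ξ) (eq_sum_single ξ)
  rw [map_add, map_smul, map_smul, Complex.real_smul, Complex.real_smul] at hs
  rw [hs]

/-! ### Test functions: radial cutoffs times rotated and dilated phases -/

open scoped ContDiff in
/-- A smooth function on the line with compact support in `(0, ∞)`. -/
structure IsCutoff (a : ℝ → ℝ) : Prop where
  contDiff : ContDiff ℝ ∞ a
  support : ∃ r R : ℝ, 0 < r ∧ ∀ s, a s ≠ 0 → r ≤ s ∧ s ≤ R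

/-- The derivative `2 s a'(s)` of `ξ ↦ a(‖ξ‖²)` along the scaling vector field. -/
def scaleCutoff (a : ℝ → ℝ) (s : ℝ) : ℝ := 2 * s * deriv a s

open scoped ContDiff in
theorem IsCutoff.scaleCutoff {a : ℝ → ℝ} (ha : IsCutoff a) : IsCutoff (scaleCutoff a) := by
  refine ⟨?_, ?_⟩
  · have : ContDiff ℝ ∞ (deriv a) := (contDiff_infty_iff_deriv.1 ha.contDiff).2
    unfold CapillaryWaves.scaleCutoff
    fun_prop
  · obtain ⟨r, R, hr, h⟩ := ha.support
    refine ⟨r, R, hr, fun s hs => ?_⟩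
    have hd : deriv a s ≠ 0 := right_ne_zero_of_mul hs
    have h1 : tsupport a ⊆ Set.Icc r R :=
      closure_minimal (fun s hs => h s hs) isClosed_Icc
    exact h1 (support_deriv_subset hd)

theorem IsCutoff.continuous {a : ℝ → ℝ} (ha : IsCutoff a) : Continuous a := ha.contDiff.continuous

theorem IsCutoff.hasCompactSupport {a : ℝ → ℝ} (ha : IsCutoff a) {E : Type*} [Zero E]
    {g : Plane → E} (hg : ∀ ξ, a (‖ξ‖ ^ 2) = 0 → g ξ = 0) : HasCompactSupport g := by
  obtain ⟨r, R, hr, h⟩ := ha.support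
  refine HasCompactSupport.of_support_subset_isCompact
    (isCompact_closedBall (0 : Plane) √R) fun ξ hξ => ?_
  have h1 : a (‖ξ‖ ^ 2) ≠ 0 := fun h0 => hξ (hg ξ h0)
  rw [mem_closedBall_zero_iff]
  exact Real.le_sqrt_of_sq_le (h _ h1).2

/-- The vector `x` rotated by the angle `-φ`. -/
def rot (φ : ℝ) (x : Plane) : Plane := Real.cos φ • x - Real.sin φ • perp x

theorem norm_perp (x : Plane) : ‖perp x‖ = ‖x‖ := by
  rw [EuclideanSpace.norm_eq, EuclideanSpace.norm_eq]
  simp [perp, Fin.sum_univ_two, add_comm]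

theorem inner_plane (x y : Plane) : inner ℝ x y = x 0 * y 0 + x 1 * y 1 := by
  simp [PiLp.inner_apply, Fin.sum_univ_two, mul_comm]

theorem inner_perp_right (x ξ : Plane) : inner ℝ x (perp ξ) = -inner ℝ (perp x) ξ := by
  simp only [inner_plane, perp]
  simp

theorem inner_rot (φ : ℝ) (x ξ : Plane) : inner ℝ (rot φ x) ξ =
    Real.cos φ * inner ℝ x ξ - Real.sin φ * inner ℝ (perp x) ξ := by
  rw [rot, inner_sub_left, real_inner_smul_left, real_inner_smul_left]

theorem inner_rot_perp (φ : ℝ) (x ξ : Plane) : inner ℝ (rot φ x) (perp ξ) =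
    -(Real.sin φ * inner ℝ x ξ + Real.cos φ * inner ℝ (perp x) ξ) := by
  rw [inner_rot, inner_perp_right, inner_perp_right]
  have : perp (perp x) = -x := by
    ext i
    fin_cases i <;> simp [perp]
  rw [this, inner_neg_left]
  ring

theorem abs_inner_rot_le (φ : ℝ) (x ξ : Plane) : |inner ℝ (rot φ x) ξ| ≤ 2 * ‖x‖ * ‖ξ‖ := by
  refine (abs_real_inner_le_norm _ _).trans ?_
  gcongr
  refine (norm_sub_le _ _).trans ?_
  rw [norm_smul, norm_smul, norm_perp, Real.norm_eq_abs, Real.norm_eq_abs]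
  nlinarith [Real.abs_cos_le_one φ, Real.abs_sin_le_one φ, norm_nonneg x]

/-- The phase `c v³ |ξ|^{3/2} + 2π v² (R_{-φ} x) · ξ`. -/
def phase (c : ℝ) (x : Plane) (v φ : ℝ) (ξ : Plane) : ℝ :=
  c * v ^ 3 * (‖ξ‖ ^ 2) ^ (3 / 4 : ℝ) + 2 * Real.pi * v ^ 2 * inner ℝ (rot φ x) ξ

/-- The test function `a(|ξ|²) e^{i phase}`. -/
def testFn (a : ℝ → ℝ) (c : ℝ) (x : Plane) (v φ : ℝ) (ξ : Plane) : ℂ :=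
  a (‖ξ‖ ^ 2) * Complex.exp (Complex.I * (phase c x v φ ξ : ℂ))

theorem norm_testFn (a : ℝ → ℝ) (c : ℝ) (x : Plane) (v φ : ℝ) (ξ : Plane) :
    ‖testFn a c x v φ ξ‖ = |a (‖ξ‖ ^ 2)| := by
  rw [testFn, norm_mul, norm_exp_I_mul_ofReal', mul_one, Complex.norm_real, Real.norm_eq_abs]

theorem continuous_phase (c : ℝ) :
    Continuous fun q : Plane × ℝ × ℝ × Plane => phase c q.1 q.2.1 q.2.2.1 q.2.2.2 := by
  simp only [phase, inner_rot]
  have h0 : (0 : ℝ) ≤ 3 / 4 := by norm_num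
  have hp : Continuous perp := by
    have : perp = fun ξ : Plane =>
        ξ 0 • EuclideanSpace.single 1 (1 : ℝ) - ξ 1 • EuclideanSpace.single 0 (1 : ℝ) :=
      funext perp_eq
    rw [this]
    fun_prop
  have hr : Continuous fun s : ℝ => s ^ (3 / 4 : ℝ) := Real.continuous_rpow_const h0
  have h1 : Continuous fun q : Plane × ℝ × ℝ × Plane => (‖q.2.2.2‖ ^ 2) ^ (3 / 4 : ℝ) :=
    hr.comp (by fun_prop)
  fun_prop

theorem IsCutoff.continuous_testFn {a : ℝ → ℝ} (ha : IsCutoff a) (c : ℝ) :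
    Continuous fun q : Plane × ℝ × ℝ × Plane => testFn a c q.1 q.2.1 q.2.2.1 q.2.2.2 := by
  have h1 := continuous_phase c
  have h2 := ha.continuous
  unfold testFn
  fun_prop

open Complex in
/-- The radial factor of the test functions. -/
def radialFactor (a : ℝ → ℝ) (κ s : ℝ) : ℂ := a s * exp (I * ((κ * s ^ (3 / 4 : ℝ) : ℝ) : ℂ))

-- The power s^{3/4} is singular only at s = 0, where the cutoff vanishes identically. Smoothness is
-- what makes the test functions Schwartz, so that the distributional identities for Ω and Σ apply
-- to them.
open scoped ContDiff in
theorem IsCutoff.contDiff_radialFactor {a : ℝ → ℝ} (ha : IsCutoff a) (κ : ℝ) :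
    ContDiff ℝ ∞ (radialFactor a κ) := by
  obtain ⟨r, R, hr, h⟩ := ha.support
  rw [contDiff_iff_contDiffAt]
  intro s
  rcases lt_or_ge s r with hs | hs
  · have h0 : radialFactor a κ =ᶠ[nhds s] fun _ => 0 := by
      filter_upwards [Iio_mem_nhds hs] with y hy
      have : a y = 0 := by
        by_contra h1
        exact absurd (h y h1).1 (not_le.2 hy)
      simp [radialFactor, this]
    exact contDiffAt_const.congr_of_eventuallyEq h0
  · have hs0 : s ≠ 0 := (hr.trans_le hs).ne'
    have h1 : ContDiffAt ℝ ∞ (fun s : ℝ => κ * s ^ (3 / 4 : ℝ)) s :=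
      contDiffAt_const.mul (contDiffAt_id.rpow_const_of_ne hs0)
    have h2 : ContDiffAt ℝ ∞ (fun s : ℝ => ((κ * s ^ (3 / 4 : ℝ) : ℝ) : ℂ)) s :=
      Complex.ofRealCLM.contDiff.contDiffAt.comp s h1
    have h3 : ContDiffAt ℝ ∞ (fun s : ℝ => ((a s : ℝ) : ℂ)) s :=
      Complex.ofRealCLM.contDiff.contDiffAt.comp s ha.contDiff.contDiffAt
    exact h3.mul ((contDiffAt_const.mul h2).cexp)

open Complex in
theorem testFn_eq (a : ℝ → ℝ) (c : ℝ) (x : Plane) (v φ : ℝ) (ξ : Plane) :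
    testFn a c x v φ ξ = radialFactor a (c * v ^ 3) (‖ξ‖ ^ 2) *
      exp (I * ((2 * Real.pi * v ^ 2 * inner ℝ (rot φ x) ξ : ℝ) : ℂ)) := by
  rw [testFn, radialFactor, phase, mul_assoc (a _ : ℂ), ← exp_add]
  congr 2
  push_cast
  ring

open scoped ContDiff in
theorem IsCutoff.contDiff_testFn {a : ℝ → ℝ} (ha : IsCutoff a) (c : ℝ) (x : Plane) (v φ : ℝ) :
    ContDiff ℝ ∞ (testFn a c x v φ) := by
  rw [funext (testFn_eq a c x v φ)]
  refine ContDiff.mul ((ha.contDiff_radialFactor _).comp (contDiff_norm_sq ℝ)) ?_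
  have h : ContDiff ℝ ∞ fun ξ : Plane => 2 * Real.pi * v ^ 2 * inner ℝ (rot φ x) ξ :=
    contDiff_const.mul (contDiff_const.inner ℝ contDiff_id)
  exact (contDiff_const.mul (Complex.ofRealCLM.contDiff.comp h)).cexp

theorem IsCutoff.hasCompactSupport_testFn {a : ℝ → ℝ} (ha : IsCutoff a) (c : ℝ) (x : Plane)
    (v φ : ℝ) : HasCompactSupport (testFn a c x v φ) :=
  ha.hasCompactSupport fun ξ h => by simp [testFn, h]

/-- The test function as a Schwartz function. -/
def IsCutoff.schwartzTestFn {a : ℝ → ℝ} (ha : IsCutoff a) (c : ℝ) (x : Plane) (v φ : ℝ) :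
    𝓢(Plane, ℂ) :=
  (ha.hasCompactSupport_testFn c x v φ).toSchwartzMap (ha.contDiff_testFn c x v φ)

open Complex in
theorem IsCutoff.fderiv_testFn {a : ℝ → ℝ} (ha : IsCutoff a) (c : ℝ) (x : Plane) (v φ : ℝ)
    {ξ : Plane} (hξ : ξ ≠ 0) (w : Plane) :
    fderiv ℝ (testFn a c x v φ) ξ w =
      (2 * inner ℝ ξ w * deriv a (‖ξ‖ ^ 2) : ℝ) * exp (I * (phase c x v φ ξ : ℂ)) +
      testFn a c x v φ ξ * (I * ((c * v ^ 3 * (3 / 4 * (‖ξ‖ ^ 2) ^ (-1 / 4 : ℝ) *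
        (2 * inner ℝ ξ w)) + 2 * Real.pi * v ^ 2 * inner ℝ (rot φ x) w : ℝ) : ℂ)) := by
  have hs : ‖ξ‖ ^ 2 ≠ 0 := by positivity
  have hγ : HasDerivAt (fun ε : ℝ => ξ + ε • w) w 0 := by
    simpa using ((hasDerivAt_id (0 : ℝ)).smul_const w).const_add ξ
  have hγ0 : ξ + (0 : ℝ) • w = ξ := by simp
  have hN : HasDerivAt (fun ε : ℝ => ‖ξ + ε • w‖ ^ 2) (2 * inner ℝ ξ w) 0 := by
    have := hγ.norm_sq
    rwa [hγ0] at this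
  have ha1 : HasDerivAt a (deriv a (‖ξ‖ ^ 2)) (‖ξ + (0 : ℝ) • w‖ ^ 2) := by
    rw [hγ0]
    exact (ha.contDiff.differentiable (by simp) _).hasDerivAt
  have h1 := (ha1.comp (0 : ℝ) hN).ofReal_comp
  have hr : HasDerivAt (fun s : ℝ => s ^ (3 / 4 : ℝ)) (3 / 4 * (‖ξ‖ ^ 2) ^ (-1 / 4 : ℝ))
      (‖ξ + (0 : ℝ) • w‖ ^ 2) := by
    rw [hγ0]
    have := Real.hasDerivAt_rpow_const (x := ‖ξ‖ ^ 2) (p := 3 / 4) (Or.inl hs)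
    convert this using 2
    norm_num
  have h2 := (hr.comp (0 : ℝ) hN).const_mul (c * v ^ 3)
  have h3 : HasDerivAt (fun ε : ℝ => 2 * Real.pi * v ^ 2 * inner ℝ (rot φ x) (ξ + ε • w))
      (2 * Real.pi * v ^ 2 * inner ℝ (rot φ x) w) 0 := by
    have := ((hasDerivAt_const (0 : ℝ) (rot φ x)).inner ℝ hγ).const_mul (2 * Real.pi * v ^ 2)
    simpa using this
  have h4 := (((h2.fun_add h3).ofReal_comp).const_mul I).cexp
  have h5 := h1.fun_mul h4
  have h6 : HasDerivAt (fun ε : ℝ => testFn a c x v φ (ξ + ε • w))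
      (fderiv ℝ (testFn a c x v φ) ξ w) 0 := by
    have hd : HasFDerivAt (testFn a c x v φ) (fderiv ℝ (testFn a c x v φ) ξ)
        (ξ + (0 : ℝ) • w) := by
      rw [hγ0]
      exact ((ha.contDiff_testFn c x v φ).differentiable (by simp) _).hasFDerivAt
    exact hd.comp_hasDerivAt (0 : ℝ) hγ
  refine (h6.unique h5).trans ?_
  simp only [Function.comp, hγ0, testFn, phase]
  push_cast
  ring

theorem IsCutoff.eq_zero {a : ℝ → ℝ} (ha : IsCutoff a) : a 0 = 0 := by
  obtain ⟨r, R, hr, h⟩ := ha.support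
  by_contra h0
  exact absurd (h 0 h0).1 (not_le.2 hr)

open Complex in
theorem IsCutoff.fderiv_testFn_perp {a : ℝ → ℝ} (ha : IsCutoff a) (c : ℝ) (x : Plane) (v φ : ℝ)
    (ξ : Plane) : fderiv ℝ (testFn a c x v φ) ξ (perp ξ) =
      testFn a c x v φ ξ * (I * ((2 * Real.pi * v ^ 2 * inner ℝ (rot φ x) (perp ξ) : ℝ) : ℂ)) := by
  rcases eq_or_ne ξ 0 with rfl | hξ
  · have : perp 0 = 0 := by ext i; fin_cases i <;> simp [perp]
    simp [this]
  · have h0 : inner ℝ ξ (perp ξ) = 0 := by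
      simp only [inner_plane, perp]
      simp
      ring
    rw [ha.fderiv_testFn c x v φ hξ, h0]
    simp

open Complex in
theorem IsCutoff.fderiv_testFn_self {a : ℝ → ℝ} (ha : IsCutoff a) (c : ℝ) (x : Plane) (v φ : ℝ)
    (ξ : Plane) : fderiv ℝ (testFn a c x v φ) ξ ξ =
      testFn (CapillaryWaves.scaleCutoff a) c x v φ ξ + testFn a c x v φ ξ *
      (I * ((3 / 2 * c * v ^ 3 * (‖ξ‖ ^ 2) ^ (3 / 4 : ℝ) +
        2 * Real.pi * v ^ 2 * inner ℝ (rot φ x) ξ : ℝ) : ℂ)) := by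
  rcases eq_or_ne ξ 0 with rfl | hξ
  · simp [testFn, CapillaryWaves.scaleCutoff, ha.eq_zero]
  · have hs : 0 < ‖ξ‖ ^ 2 := by positivity
    rw [ha.fderiv_testFn c x v φ hξ, real_inner_self_eq_norm_sq]
    have hr : (‖ξ‖ ^ 2) ^ (-1 / 4 : ℝ) * ‖ξ‖ ^ 2 = (‖ξ‖ ^ 2) ^ (3 / 4 : ℝ) := by
      nth_rewrite 2 [← Real.rpow_one (‖ξ‖ ^ 2)]
      rw [← Real.rpow_add hs]
      norm_num
    rw [← hr]
    simp only [testFn, CapillaryWaves.scaleCutoff]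
    push_cast
    ring

/-! ### Pairings with the test functions -/

/-- The pairing of `F` with the test function. -/
def pairing (a : ℝ → ℝ) (c : ℝ) (x : Plane) (F : Plane → ℂ) (v φ : ℝ) : ℂ :=
  ∫ ξ, testFn a c x v φ ξ * F ξ

theorem IsCutoff.integrable_mul {a : ℝ → ℝ} (ha : IsCutoff a) {F : Plane → ℂ}
    (hF : LocallyIntegrable F) {g : Plane → ℝ} (hg : Continuous g) :
    Integrable fun ξ => |a (‖ξ‖ ^ 2)| * g ξ * ‖F ξ‖ := by
  have hc : Continuous fun ξ : Plane => |a (‖ξ‖ ^ 2)| * g ξ := by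
    have := ha.continuous
    fun_prop
  have hs : HasCompactSupport fun ξ : Plane => |a (‖ξ‖ ^ 2)| * g ξ :=
    ha.hasCompactSupport fun ξ h => by simp [h]
  have hN : LocallyIntegrable fun ξ => ‖F ξ‖ := fun ξ => (hF ξ).norm
  exact hN.integrable_smul_left_of_hasCompactSupport hc hs

theorem IsCutoff.integrable_abs_mul {a : ℝ → ℝ} (ha : IsCutoff a) {F : Plane → ℂ}
    (hF : LocallyIntegrable F) : Integrable fun ξ => |a (‖ξ‖ ^ 2)| * ‖F ξ‖ := by
  simpa using ha.integrable_mul hF (g := fun _ => 1) continuous_const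

theorem IsCutoff.continuous_testFn_right {a : ℝ → ℝ} (ha : IsCutoff a) (c : ℝ) (x : Plane)
    (v φ : ℝ) : Continuous (testFn a c x v φ) := (ha.contDiff_testFn c x v φ).continuous

theorem IsCutoff.integrable_testFn_mul {a : ℝ → ℝ} (ha : IsCutoff a) {F : Plane → ℂ}
    (hF : LocallyIntegrable F) (c : ℝ) (x : Plane) (v φ : ℝ) :
    Integrable fun ξ => testFn a c x v φ ξ * F ξ := by
  refine (ha.integrable_abs_mul hF).mono'
    ((ha.continuous_testFn_right c x v φ).aestronglyMeasurable.mul hF.aestronglyMeasurable)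
    (.of_forall fun ξ => ?_)
  rw [norm_mul, norm_testFn]

theorem IsCutoff.norm_pairing_le {a : ℝ → ℝ} (c : ℝ) (x : Plane) (F : Plane → ℂ)
    (v φ : ℝ) : ‖pairing a c x F v φ‖ ≤ ∫ ξ, |a (‖ξ‖ ^ 2)| * ‖F ξ‖ := by
  refine (norm_integral_le_integral_norm _).trans_eq ?_
  simp only [norm_mul, norm_testFn]

open Complex in
theorem hasDerivAt_testFn_angle (a : ℝ → ℝ) (c : ℝ) (x : Plane) (v φ : ℝ) (ξ : Plane) :
    HasDerivAt (fun φ => testFn a c x v φ ξ) (testFn a c x v φ ξ *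
      (I * ((2 * Real.pi * v ^ 2 * inner ℝ (rot φ x) (perp ξ) : ℝ) : ℂ))) φ := by
  have h1 : HasDerivAt (fun φ => phase c x v φ ξ)
      (2 * Real.pi * v ^ 2 * inner ℝ (rot φ x) (perp ξ)) φ := by
    have := (((((Real.hasDerivAt_cos φ).mul_const (inner ℝ x ξ)).fun_sub
      ((Real.hasDerivAt_sin φ).mul_const (inner ℝ (perp x) ξ))).const_mul
        (2 * Real.pi * v ^ 2)).const_add (c * v ^ 3 * (‖ξ‖ ^ 2) ^ (3 / 4 : ℝ)))
    simp only [phase, inner_rot]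
    refine this.congr_deriv ?_
    rw [← inner_rot, inner_rot_perp]
    ring
  refine (((h1.ofReal_comp).const_mul I).cexp.const_mul ((a (‖ξ‖ ^ 2) : ℝ) : ℂ)).congr_deriv ?_
  rw [testFn]
  ring

open Complex in
theorem hasDerivAt_testFn_scale (a : ℝ → ℝ) (c : ℝ) (x : Plane) (v φ : ℝ) (ξ : Plane) :
    HasDerivAt (fun v => testFn a c x v φ ξ) (testFn a c x v φ ξ *
      (I * ((3 * c * v ^ 2 * (‖ξ‖ ^ 2) ^ (3 / 4 : ℝ) +
        4 * Real.pi * v * inner ℝ (rot φ x) ξ : ℝ) : ℂ))) v := by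
  have h1 : HasDerivAt (fun v => phase c x v φ ξ) (3 * c * v ^ 2 * (‖ξ‖ ^ 2) ^ (3 / 4 : ℝ) +
        4 * Real.pi * v * inner ℝ (rot φ x) ξ) v := by
    have := ((((hasDerivAt_pow 3 v).const_mul c).mul_const ((‖ξ‖ ^ 2) ^ (3 / 4 : ℝ))).fun_add
      (((hasDerivAt_pow 2 v).const_mul (2 * Real.pi)).mul_const (inner ℝ (rot φ x) ξ)))
    refine this.congr_deriv ?_
    push_cast
    ring
  refine (((h1.ofReal_comp).const_mul I).cexp.const_mul ((a (‖ξ‖ ^ 2) : ℝ) : ℂ)).congr_deriv ?_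
  rw [testFn]
  ring

theorem continuous_inner_rot_perp (φ : ℝ) (x : Plane) :
    Continuous fun ξ => inner ℝ (rot φ x) (perp ξ) := by
  simp only [inner_perp_right]
  fun_prop

theorem continuous_norm_sq_rpow :
    Continuous fun ξ : Plane => (‖ξ‖ ^ 2) ^ (3 / 4 : ℝ) :=
  (Real.continuous_rpow_const (by norm_num)).comp (by fun_prop)

open Complex in
theorem IsCutoff.hasDerivAt_pairing_angle {a : ℝ → ℝ} (ha : IsCutoff a) {F : Plane → ℂ}
    (hF : LocallyIntegrable F) (c : ℝ) (x : Plane) (v φ : ℝ) :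
    HasDerivAt (fun φ => pairing a c x F v φ)
      (∫ ξ, fderiv ℝ (testFn a c x v φ) ξ (perp ξ) * F ξ) φ := by
  simp only [ha.fderiv_testFn_perp]
  refine (hasDerivAt_integral_of_dominated_loc_of_deriv_le (s := Set.univ)
    (F := fun φ ξ => testFn a c x v φ ξ * F ξ)
    (F' := fun φ ξ => testFn a c x v φ ξ *
      (I * ((2 * Real.pi * v ^ 2 * inner ℝ (rot φ x) (perp ξ) : ℝ) : ℂ)) * F ξ)
    (bound := fun ξ => |a (‖ξ‖ ^ 2)| * (2 * Real.pi * v ^ 2 * (2 * ‖x‖ * ‖ξ‖)) * ‖F ξ‖)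
    Filter.univ_mem
    (.of_forall fun φ => (ha.integrable_testFn_mul hF c x v φ).aestronglyMeasurable)
    (ha.integrable_testFn_mul hF c x v φ) ?_ (.of_forall fun ξ φ _ => ?_)
    (ha.integrable_mul hF (by fun_prop)) (.of_forall fun ξ φ _ => ?_)).2
  · have h1 := ha.continuous_testFn_right c x v φ
    have h2 := continuous_inner_rot_perp φ x
    exact (Continuous.aestronglyMeasurable (by fun_prop)).mul hF.aestronglyMeasurable
  · rw [norm_mul, norm_mul, norm_testFn, norm_mul, norm_I, one_mul, norm_real, norm_mul,
      Real.norm_of_nonneg (by positivity : 0 ≤ 2 * Real.pi * v ^ 2), Real.norm_eq_abs]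
    gcongr
    refine (abs_inner_rot_le φ x (perp ξ)).trans_eq ?_
    rw [norm_perp]
  · exact (hasDerivAt_testFn_angle a c x v φ ξ).mul_const (F ξ)

open Complex in
theorem IsCutoff.hasDerivAt_pairing_scale {a : ℝ → ℝ} (ha : IsCutoff a) {F : Plane → ℂ}
    (hF : LocallyIntegrable F) (c : ℝ) (x : Plane) (v φ : ℝ) :
    HasDerivAt (fun v => pairing a c x F v φ) (∫ ξ, testFn a c x v φ ξ *
      (I * ((3 * c * v ^ 2 * (‖ξ‖ ^ 2) ^ (3 / 4 : ℝ) +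
        4 * Real.pi * v * inner ℝ (rot φ x) ξ : ℝ) : ℂ)) * F ξ) v := by
  have hcr := continuous_norm_sq_rpow
  refine (hasDerivAt_integral_of_dominated_loc_of_deriv_le (s := Metric.ball v 1)
    (F := fun v ξ => testFn a c x v φ ξ * F ξ)
    (F' := fun v ξ => testFn a c x v φ ξ *
      (I * ((3 * c * v ^ 2 * (‖ξ‖ ^ 2) ^ (3 / 4 : ℝ) +
        4 * Real.pi * v * inner ℝ (rot φ x) ξ : ℝ) : ℂ)) * F ξ)
    (bound := fun ξ => |a (‖ξ‖ ^ 2)| * (3 * |c| * (|v| + 1) ^ 2 * (‖ξ‖ ^ 2) ^ (3 / 4 : ℝ) +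
      4 * Real.pi * (|v| + 1) * (2 * ‖x‖ * ‖ξ‖)) * ‖F ξ‖)
    (Metric.ball_mem_nhds v one_pos)
    (.of_forall fun v => (ha.integrable_testFn_mul hF c x v φ).aestronglyMeasurable)
    (ha.integrable_testFn_mul hF c x v φ) ?_ (.of_forall fun ξ w hw => ?_)
    (ha.integrable_mul hF (by fun_prop)) (.of_forall fun ξ w _ => ?_)).2
  · have h1 := ha.continuous_testFn_right c x v φ
    exact (Continuous.aestronglyMeasurable (by fun_prop)).mul hF.aestronglyMeasurable
  · have hw1 : |w| ≤ |v| + 1 := by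
      rw [Metric.mem_ball, Real.dist_eq] at hw
      have := abs_add_le (w - v) v
      rw [sub_add_cancel] at this
      linarith
    rw [norm_mul, norm_mul, norm_testFn, norm_mul, norm_I, one_mul, norm_real, Real.norm_eq_abs]
    gcongr
    refine (abs_add_le _ _).trans ?_
    rw [abs_mul, abs_mul, abs_mul, abs_mul, abs_mul, abs_mul, abs_pow,
      abs_of_nonneg (by positivity : 0 ≤ (‖ξ‖ ^ 2) ^ (3 / 4 : ℝ)), abs_of_pos Real.pi_pos,
      Nat.abs_ofNat, Nat.abs_ofNat]
    gcongr
    exact abs_inner_rot_le φ x ξ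
  · exact (hasDerivAt_testFn_scale a c x w φ ξ).mul_const (F ξ)

/-- The phase depends on v and ξ only through v²ξ, so v∂ᵥ acts on it as 2ξ·∇. The test function
differs by its cutoff, which ξ·∇ also hits; this is the subtracted term. -/
theorem IsCutoff.mul_deriv_pairing_scale {a : ℝ → ℝ} (ha : IsCutoff a) {F : Plane → ℂ}
    (hF : LocallyIntegrable F) (c : ℝ) (x : Plane) (v φ : ℝ)
    (hi : Integrable fun ξ => fderiv ℝ (testFn a c x v φ) ξ ξ * F ξ) :
    v * (∫ ξ, testFn a c x v φ ξ *
      (Complex.I * ((3 * c * v ^ 2 * (‖ξ‖ ^ 2) ^ (3 / 4 : ℝ) +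
        4 * Real.pi * v * inner ℝ (rot φ x) ξ : ℝ) : ℂ)) * F ξ) =
      2 * ((∫ ξ, fderiv ℝ (testFn a c x v φ) ξ ξ * F ξ) -
        pairing (CapillaryWaves.scaleCutoff a) c x F v φ) := by
  rw [pairing, ← integral_sub hi (ha.scaleCutoff.integrable_testFn_mul hF c x v φ),
    ← integral_const_mul, ← integral_const_mul]
  congr 1
  ext ξ
  rw [ha.fderiv_testFn_self]
  push_cast
  ring

theorem IsCutoff.continuous_pairing_angle {a : ℝ → ℝ} (ha : IsCutoff a) {F : Plane → ℂ}
    (hF : LocallyIntegrable F) (c : ℝ) (x : Plane) (v : ℝ) :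
    Continuous fun φ => pairing a c x F v φ :=
  continuous_iff_continuousAt.2 fun φ => (ha.hasDerivAt_pairing_angle hF c x v φ).continuousAt

theorem IsCutoff.continuous_pairing_scale {a : ℝ → ℝ} (ha : IsCutoff a) {F : Plane → ℂ}
    (hF : LocallyIntegrable F) (c : ℝ) (x : Plane) (φ : ℝ) :
    Continuous fun v => pairing a c x F v φ :=
  continuous_iff_continuousAt.2 fun v => (ha.hasDerivAt_pairing_scale hF c x v φ).continuousAt

theorem IsCutoff.hasDerivAt_pairing_rotationField {a : ℝ → ℝ} (ha : IsCutoff a)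
    {f : 𝓢'(Plane, ℂ)} {F F' : Plane → ℂ} (hF : IsRepresentedBy (𝓕 f) F)
    (hF' : IsRepresentedBy (𝓕 (rotationField f)) F') (c : ℝ) (x : Plane) (v φ : ℝ) :
    HasDerivAt (fun φ => pairing a c x F v φ) (-pairing a c x F' v φ) φ := by
  refine (ha.hasDerivAt_pairing_angle hF.locallyIntegrable c x v φ).congr_deriv ?_
  have h := integral_rotationField hF hF' (ha.schwartzTestFn c x v φ)
  rw [← neg_eq_iff_eq_neg] at h
  exact h.symm

/-- The fundamental theorem of calculus for v⁴ times the pairing on [0, 1]. The power v⁴ kills the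
value at v = 0 and leaves the weight 2v³, which the kernel estimates need near v = 0. -/
theorem IsCutoff.pairing_eq_integral_scale {a : ℝ → ℝ} (ha : IsCutoff a)
    {f : 𝓢'(Plane, ℂ)} {F F' : Plane → ℂ} (hF : IsRepresentedBy (𝓕 f) F)
    (hF' : IsRepresentedBy (𝓕 (scalingField f)) F') (c : ℝ) (x : Plane) (φ : ℝ) :
    pairing a c x F 1 φ = ∫ v in (0 : ℝ)..1, 2 * (v : ℂ) ^ 3 *
      (2 * pairing a c x F v φ + pairing a c x F' v φ -
        pairing (CapillaryWaves.scaleCutoff a) c x F v φ) := by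
  have hFl := hF.locallyIntegrable
  have hd : ∀ v ∈ Set.uIcc (0 : ℝ) 1, HasDerivAt (fun v : ℝ => (v : ℂ) ^ 4 * pairing a c x F v φ)
      (2 * (v : ℂ) ^ 3 * (2 * pairing a c x F v φ + pairing a c x F' v φ -
        pairing (CapillaryWaves.scaleCutoff a) c x F v φ)) v := by
    intro v _
    have h1 : HasDerivAt (fun v : ℝ => (v : ℂ) ^ 4) (4 * (v : ℂ) ^ 3) v := by
      simpa using (hasDerivAt_pow 4 (v : ℂ)).comp_ofReal
    refine (h1.fun_mul (ha.hasDerivAt_pairing_scale hFl c x v φ)).congr_deriv ?_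
    have hS := integral_scalingField hF hF' (ha.schwartzTestFn c x v φ)
    have hi : Integrable fun ξ => fderiv ℝ (testFn a c x v φ) ξ ξ * F ξ := by
      have := (hF (coordDeriv 0 0 (ha.schwartzTestFn c x v φ) +
        coordDeriv 1 1 (ha.schwartzTestFn c x v φ))).1
      refine this.congr (.of_forall fun ξ => ?_)
      simp only [add_apply, coordDeriv_apply]
      have hs := congrArg (fderiv ℝ (ha.schwartzTestFn c x v φ) ξ) (eq_sum_single ξ)
      rw [map_add, map_smul, map_smul, Complex.real_smul, Complex.real_smul] at hs
      rw [← hs]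
      rfl
    have hm := ha.mul_deriv_pairing_scale hFl c x v φ hi
    have hS' : pairing a c x F' v φ = ∫ ξ, fderiv ℝ (testFn a c x v φ) ξ ξ * F ξ := hS
    rw [← hS'] at hm
    linear_combination (v : ℂ) ^ 3 * hm
  have c1 := ha.continuous_pairing_scale hFl c x φ
  have c2 := ha.continuous_pairing_scale hF'.locallyIntegrable c x φ
  have c3 := ha.scaleCutoff.continuous_pairing_scale hFl c x φ
  rw [intervalIntegral.integral_eq_sub_of_hasDerivAt hd
    (Continuous.intervalIntegrable (by fun_prop) _ _)]
  simp

/-- Recovering `h₀(0)` from averages of `h₀` and its first three derivatives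
`h₀' = -h₁`, `h₁' = -h₂`, `h₂' = -h₃`. -/
theorem eq_integral_angWeight {h₀ h₁ h₂ h₃ : ℝ → ℂ} (d₀ : ∀ φ, HasDerivAt h₀ (-h₁ φ) φ)
    (d₁ : ∀ φ, HasDerivAt h₁ (-h₂ φ) φ) (d₂ : ∀ φ, HasDerivAt h₂ (-h₃ φ) φ)
    (c₃ : Continuous h₃) {B : ℝ} (b₀ : ∀ φ, ‖h₀ φ‖ ≤ B) (b₁ : ∀ φ, ‖h₁ φ‖ ≤ B)
    (b₂ : ∀ φ, ‖h₂ φ‖ ≤ B) (b₃ : ∀ φ, ‖h₃ φ‖ ≤ B) :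
    h₀ 0 = ∫ φ in Set.Ioi (0 : ℝ),
      (angWeight φ : ℂ) * (h₀ φ + 3 * h₁ φ + 3 * h₂ φ + h₃ φ) := by
  have c₀ : Continuous h₀ := continuous_iff_continuousAt.2 fun φ => (d₀ φ).continuousAt
  have c₁ : Continuous h₁ := continuous_iff_continuousAt.2 fun φ => (d₁ φ).continuousAt
  have c₂ : Continuous h₂ := continuous_iff_continuousAt.2 fun φ => (d₂ φ).continuousAt
  set p₁ : ℝ → ℝ := fun φ => φ * Real.exp (-φ) with hp₁
  set p₀ : ℝ → ℝ := fun φ => Real.exp (-φ) with hp₀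
  have dp₁ : ∀ φ, HasDerivAt p₁ (p₀ φ - p₁ φ) φ := by
    intro φ
    refine ((hasDerivAt_id φ).fun_mul ((hasDerivAt_id φ).neg.exp)).congr_deriv ?_
    simp only [hp₁, hp₀, id, Pi.neg_apply]
    ring
  have dp₀ : ∀ φ, HasDerivAt p₀ (-p₀ φ) φ := by
    intro φ
    refine ((hasDerivAt_id φ).neg.exp).congr_deriv ?_
    simp only [hp₀, id, Pi.neg_apply]
    ring
  -- The integrand is the weight times (1 - d/dφ)³h₀, and G collects the boundary terms of three
  -- integrations by parts. It tends to 0 at infinity, and G(0) = -h₀(0), since among the three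
  -- weights only e^{-φ} is nonzero at 0.
  set G : ℝ → ℂ := fun φ => -((angWeight φ : ℂ) * (h₀ φ + 2 * h₁ φ + h₂ φ) +
    (p₁ φ : ℂ) * (h₀ φ + h₁ φ) + (p₀ φ : ℂ) * h₀ φ) with hG
  have hd : ∀ φ, HasDerivAt G
      ((angWeight φ : ℂ) * (h₀ φ + 3 * h₁ φ + 3 * h₂ φ + h₃ φ)) φ := by
    intro φ
    have h := ((((hasDerivAt_angWeight φ).ofReal_comp.fun_mul
      (((d₀ φ).fun_add ((d₁ φ).const_mul 2)).fun_add (d₂ φ))).fun_add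
      ((dp₁ φ).ofReal_comp.fun_mul ((d₀ φ).fun_add (d₁ φ)))).fun_add
      ((dp₀ φ).ofReal_comp.fun_mul (d₀ φ))).fun_neg
    refine h.congr_deriv ?_
    have : angWeightDeriv φ = p₁ φ - angWeight φ := by
      simp only [angWeightDeriv, angWeight, hp₁]; ring
    rw [this]
    push_cast
    ring
  have hi : IntegrableOn (fun φ => (angWeight φ : ℂ) * (h₀ φ + 3 * h₁ φ + 3 * h₂ φ + h₃ φ))
      (Set.Ioi 0) := by
    refine integrableOn_ofReal_angWeight.mul_bdd (c := B + 3 * B + 3 * B + B)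
      (Continuous.aestronglyMeasurable (by fun_prop)) (.of_forall fun φ => ?_)
    refine (norm_add_le _ _).trans (add_le_add ((norm_add_le _ _).trans
      (add_le_add ((norm_add_le _ _).trans (add_le_add (b₀ φ) ?_)) ?_)) (b₃ φ))
    · rw [norm_mul, Complex.norm_ofNat]; gcongr; exact b₁ φ
    · rw [norm_mul, Complex.norm_ofNat]; gcongr; exact b₂ φ
  have hlim : Filter.Tendsto G Filter.atTop (nhds 0) := by
    have hw : ∀ k, Filter.Tendsto (fun φ : ℝ => φ ^ k * Real.exp (-φ)) Filter.atTop (nhds 0) :=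
      Real.tendsto_pow_mul_exp_neg_atTop_nhds_zero
    have hb : Filter.Tendsto (fun φ : ℝ => φ ^ 2 * Real.exp (-φ) * (4 * B) +
        φ ^ 1 * Real.exp (-φ) * (2 * B) + φ ^ 0 * Real.exp (-φ) * B) Filter.atTop (nhds 0) := by
      simpa using (((hw 2).mul_const (4 * B)).add ((hw 1).mul_const (2 * B))).add
        ((hw 0).mul_const B)
    refine squeeze_zero_norm' ?_ hb
    filter_upwards [Filter.eventually_ge_atTop (0 : ℝ)] with φ hφ
    have hexp := Real.exp_pos (-φ)
    have hB : 0 ≤ B := (norm_nonneg _).trans (b₀ 0)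
    rw [hG, norm_neg]
    refine (norm_add_le _ _).trans (add_le_add ((norm_add_le _ _).trans (add_le_add ?_ ?_)) ?_)
    · rw [norm_mul, Complex.norm_real, Real.norm_of_nonneg (angWeight_nonneg φ)]
      refine mul_le_mul ?_ ?_ (norm_nonneg _) (by positivity)
      · unfold angWeight
        gcongr
        linarith [sq_nonneg φ]
      · refine (norm_add_le _ _).trans ?_
        have h1 := norm_add_le (h₀ φ) (2 * h₁ φ)
        rw [norm_mul, Complex.norm_ofNat] at h1
        linarith [b₀ φ, b₁ φ, b₂ φ]
    · rw [norm_mul, Complex.norm_real, Real.norm_of_nonneg (by positivity)]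
      simp only [hp₁, pow_one]
      gcongr
      linarith [norm_add_le (h₀ φ) (h₁ φ), b₀ φ, b₁ φ]
    · rw [norm_mul, Complex.norm_real, Real.norm_of_nonneg (by positivity)]
      simp only [hp₀, pow_zero, one_mul]
      gcongr
      exact b₀ φ
  have hint := integral_Ioi_of_hasDerivAt_of_tendsto (a := 0)
    (hd 0).continuousAt.continuousWithinAt (fun φ _ => hd φ) hi hlim
  rw [hint]
  simp [hG, hp₁, hp₀, angWeight]

/-! ### The averaged kernel -/

/-- The polar data `x · ξ + i (perp x) · ξ` of a pair of points. -/
def polarPair (x ξ : Plane) : ℂ := ⟨inner ℝ x ξ, inner ℝ (perp x) ξ⟩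

/-- The kernel obtained by averaging the phase over rotations and dilations. -/
def avgKernel (c : ℝ) (x ξ : Plane) : ℂ :=
  oscInt (c * (‖ξ‖ ^ 2) ^ (3 / 4 : ℝ)) (2 * Real.pi * ‖polarPair x ξ‖) (Complex.arg (polarPair x ξ))

/-- In polar form, rotating x shifts the angle between x and ξ. This matches the phase with the one
in `oscInt`, with θ the argument of the polar pair. -/
theorem phase_eq (c : ℝ) (x : Plane) (v φ : ℝ) (ξ : Plane) : phase c x v φ ξ =
    c * (‖ξ‖ ^ 2) ^ (3 / 4 : ℝ) * v ^ 3 + 2 * Real.pi * ‖polarPair x ξ‖ * v ^ 2 *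
      Real.cos (φ + Complex.arg (polarPair x ξ)) := by
  have h1 := Complex.norm_mul_cos_arg (polarPair x ξ)
  have h2 := Complex.norm_mul_sin_arg (polarPair x ξ)
  have h1' : (polarPair x ξ).re = inner ℝ x ξ := rfl
  have h2' : (polarPair x ξ).im = inner ℝ (perp x) ξ := rfl
  rw [phase, inner_rot, Real.cos_add, ← h1', ← h2']
  linear_combination (-(2 * Real.pi * v ^ 2 * Real.cos φ)) * h1 +
    (2 * Real.pi * v ^ 2 * Real.sin φ) * h2

theorem norm_avgKernel_le_one (c : ℝ) (x ξ : Plane) : ‖avgKernel c x ξ‖ ≤ 1 :=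
  norm_oscInt_le_one _ _ _

theorem norm_avgKernel_le {c : ℝ} (hc : 0 < c) (x : Plane) {ξ : Plane} (hξ : ξ ≠ 0) :
    ‖avgKernel c x ξ‖ ≤ 675 / (c * (‖ξ‖ ^ 2) ^ (3 / 4 : ℝ)) :=
  norm_oscInt_le (by positivity) (by positivity) _

open Complex in
theorem IsCutoff.integrable_prod {a : ℝ → ℝ} (ha : IsCutoff a) {F : Plane → ℂ}
    (hF : LocallyIntegrable F) (c : ℝ) (x : Plane) :
    Integrable (fun q : (ℝ × ℝ) × Plane => (angWeight q.1.1 : ℂ) * (2 * (q.1.2 : ℂ) ^ 3) *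
      (testFn a c x q.1.2 q.1.1 q.2 * F q.2))
      (((volume.restrict (Set.Ioi 0)).prod (volume.restrict (Set.Ioc 0 1))).prod volume) := by
  have h1 : Integrable (fun v : ℝ => 2 * (v : ℂ) ^ 3) (volume.restrict (Set.Ioc 0 1)) :=
    (Continuous.integrableOn_Icc (by fun_prop)).mono_set Set.Ioc_subset_Icc_self
  have h2 := (Integrable.mul_prod (L := ℂ) integrableOn_ofReal_angWeight h1).norm.mul_prod
    (ha.integrable_abs_mul hF)
  refine h2.mono' ?_ (.of_forall fun q => ?_)
  · have hc1 : Continuous fun q : (ℝ × ℝ) × Plane => testFn a c x q.1.2 q.1.1 q.2 :=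
      (ha.continuous_testFn c).comp (f := fun q : (ℝ × ℝ) × Plane => (x, q.1.2, q.1.1, q.2))
        (by fun_prop)
    have hc2 := continuous_angWeight
    have hc3 : Continuous fun q : (ℝ × ℝ) × Plane =>
      (angWeight q.1.1 : ℂ) * (2 * (q.1.2 : ℂ) ^ 3) := by fun_prop
    exact hc3.aestronglyMeasurable.mul (hc1.aestronglyMeasurable.mul
      hF.aestronglyMeasurable.comp_snd)
  · rw [norm_mul, norm_mul (testFn _ _ _ _ _ _), norm_testFn]

open Complex in
theorem integral_kernel_eq (a : ℝ → ℝ) (c : ℝ) (x ξ : Plane) (z : ℂ) :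
    ∫ v in Set.Ioc (0 : ℝ) 1, ∫ φ in Set.Ioi (0 : ℝ), (angWeight φ : ℂ) * (2 * (v : ℂ) ^ 3) *
      (testFn a c x v φ ξ * z) = a (‖ξ‖ ^ 2) * avgKernel c x ξ * z := by
  rw [avgKernel, oscInt, intervalIntegral.integral_of_le zero_le_one, ← integral_const_mul,
    ← integral_mul_const]
  congr 1
  ext v
  rw [avgWave, angInt, ← integral_const_mul, ← integral_const_mul, ← integral_mul_const]
  congr 1
  ext φ
  have he : exp (I * (phase c x v φ ξ : ℂ)) =
      exp (I * ((c * (‖ξ‖ ^ 2) ^ (3 / 4 : ℝ) * v ^ 3 : ℝ) : ℂ)) *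
      exp (I * ((2 * Real.pi * ‖polarPair x ξ‖ * v ^ 2 *
        Real.cos (φ + arg (polarPair x ξ)) : ℝ) : ℂ)) := by
    rw [← exp_add, ← mul_add, ← ofReal_add, ← phase_eq]
  rw [testFn, he]
  ring

-- Fubini: the averages over φ and v move from the pairing to its exponential. The cutoff and the
-- local integrability of F provide absolute convergence.
open Complex in
theorem IsCutoff.integral_pairing_eq {a : ℝ → ℝ} (ha : IsCutoff a) {F : Plane → ℂ}
    (hF : LocallyIntegrable F) (c : ℝ) (x : Plane) :
    IntegrableOn (fun φ : ℝ => (angWeight φ : ℂ) *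
      ∫ v in (0 : ℝ)..1, 2 * (v : ℂ) ^ 3 * pairing a c x F v φ) (Set.Ioi 0) ∧
    ∫ φ in Set.Ioi (0 : ℝ), (angWeight φ : ℂ) *
      ∫ v in (0 : ℝ)..1, 2 * (v : ℂ) ^ 3 * pairing a c x F v φ =
    ∫ ξ, a (‖ξ‖ ^ 2) * avgKernel c x ξ * F ξ := by
  have hi := ha.integrable_prod hF c x
  have hl := hi.integral_prod_left
  have heq : ∀ φ : ℝ, (angWeight φ : ℂ) * ∫ v in (0 : ℝ)..1, 2 * (v : ℂ) ^ 3 *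
      pairing a c x F v φ = ∫ v in Set.Ioc (0 : ℝ) 1, ∫ ξ, (angWeight φ : ℂ) * (2 * (v : ℂ) ^ 3) *
      (testFn a c x v φ ξ * F ξ) := by
    intro φ
    rw [intervalIntegral.integral_of_le zero_le_one, ← integral_const_mul]
    congr 1
    ext v
    rw [integral_const_mul, pairing, ← mul_assoc]
  simp only [heq]
  refine ⟨hl.integral_prod_left, ?_⟩
  rw [← integral_prod _ hl, integral_integral_swap hi]
  refine integral_congr_ae ?_
  filter_upwards [hi.prod_left_ae] with ξ hξ
  rw [integral_prod_symm _ hξ]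
  exact integral_kernel_eq a c x ξ (F ξ)

/-- The combination `F₀ + 3 F₁ + 3 F₂ + F₃`. -/
def binomSum (F : ℕ → Plane → ℂ) (ξ : Plane) : ℂ := F 0 ξ + 3 * F 1 ξ + 3 * F 2 ξ + F 3 ξ

theorem locallyIntegrable_binomSum {F : ℕ → Plane → ℂ} (hF : ∀ k < 4, LocallyIntegrable (F k)) :
    LocallyIntegrable (binomSum F) := by
  have h1 : LocallyIntegrable fun ξ => (3 : ℂ) • F 1 ξ :=
    (hF 1 (by norm_num)).smul (3 : ℂ)
  have h2 : LocallyIntegrable fun ξ => (3 : ℂ) • F 2 ξ :=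
    (hF 2 (by norm_num)).smul (3 : ℂ)
  exact (((hF 0 (by norm_num)).add h1).add h2).add (hF 3 (by norm_num))

theorem IsCutoff.pairing_binomSum {a : ℝ → ℝ} (ha : IsCutoff a) {F : ℕ → Plane → ℂ}
    (hF : ∀ k < 4, LocallyIntegrable (F k)) (c : ℝ) (x : Plane) (v φ : ℝ) :
    pairing a c x (binomSum F) v φ = pairing a c x (F 0) v φ + 3 * pairing a c x (F 1) v φ +
      3 * pairing a c x (F 2) v φ + pairing a c x (F 3) v φ := by
  have h := fun k (hk : k < 4) => ha.integrable_testFn_mul (hF k hk) c x v φ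
  have e0 := h 0 (by norm_num)
  have e1 := (h 1 (by norm_num)).const_mul 3
  have e2 := (h 2 (by norm_num)).const_mul 3
  have e3 := h 3 (by norm_num)
  have e01 : Integrable fun ξ => testFn a c x v φ ξ * F 0 ξ + 3 * (testFn a c x v φ ξ * F 1 ξ) :=
    e0.add e1
  have e012 : Integrable fun ξ => testFn a c x v φ ξ * F 0 ξ +
    3 * (testFn a c x v φ ξ * F 1 ξ) + 3 * (testFn a c x v φ ξ * F 2 ξ) := e01.add e2
  simp only [pairing, ← integral_const_mul]
  rw [← integral_add e0 e1, ← integral_add e01 e2, ← integral_add e012 e3]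
  congr 1
  ext ξ
  simp only [binomSum]
  ring

/-- The pairing of `F₀` with a cut off plane wave, in terms of the averaged kernel and the
functions `F k`, `F' k` representing the Fourier transforms of `Ωᵏ f`, `Σ Ωᵏ f`. -/
theorem IsCutoff.pairing_eq_integral_avgKernel {a : ℝ → ℝ} (ha : IsCutoff a)
    {f : 𝓢'(Plane, ℂ)} {F F' : ℕ → Plane → ℂ}
    (hF : ∀ k < 4, IsRepresentedBy (𝓕 (rotationField^[k] f)) (F k))
    (hF' : ∀ k < 4, IsRepresentedBy (𝓕 (scalingField (rotationField^[k] f))) (F' k))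
    (c : ℝ) (x : Plane) :
    pairing a c x (F 0) 1 0 =
      (∫ ξ, a (‖ξ‖ ^ 2) * avgKernel c x ξ * (2 * binomSum F ξ + binomSum F' ξ)) -
      ∫ ξ, CapillaryWaves.scaleCutoff a (‖ξ‖ ^ 2) * avgKernel c x ξ * binomSum F ξ := by
  have hFl : ∀ k < 4, LocallyIntegrable (F k) := fun k hk => (hF k hk).locallyIntegrable
  have hFl' : ∀ k < 4, LocallyIntegrable (F' k) := fun k hk => (hF' k hk).locallyIntegrable
  have hb := locallyIntegrable_binomSum hFl
  have hb' := locallyIntegrable_binomSum hFl'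
  have hb2 : LocallyIntegrable fun ξ => (2 : ℂ) • binomSum F ξ := hb.smul (2 : ℂ)
  have hP : LocallyIntegrable fun ξ => 2 * binomSum F ξ + binomSum F' ξ := hb2.add hb'
  have hd : ∀ k, k + 1 < 4 → ∀ φ, HasDerivAt (fun φ => pairing a c x (F k) 1 φ)
      (-pairing a c x (F (k + 1)) 1 φ) φ := by
    intro k hk φ
    refine ha.hasDerivAt_pairing_rotationField (hF k (by omega)) ?_ c x 1 φ
    have h := hF (k + 1) hk
    rwa [Function.iterate_succ_apply'] at h
  set B : ℕ → ℝ := fun k => ∫ ξ, |a (‖ξ‖ ^ 2)| * ‖F k ξ‖ with hB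
  have hB0 : ∀ k, 0 ≤ B k := fun k => integral_nonneg fun ξ => by positivity
  have hBle : ∀ k φ, ‖pairing a c x (F k) 1 φ‖ ≤ B k := fun k φ =>
    IsCutoff.norm_pairing_le c x (F k) 1 φ
  have hA := eq_integral_angWeight (B := B 0 + B 1 + B 2 + B 3) (hd 0 (by norm_num))
    (hd 1 (by norm_num)) (hd 2 (by norm_num))
    (ha.continuous_pairing_angle (hFl 3 (by norm_num)) c x 1)
    (fun φ => by linarith [hBle 0 φ, hB0 0, hB0 1, hB0 2, hB0 3])
    (fun φ => by linarith [hBle 1 φ, hB0 0, hB0 1, hB0 2, hB0 3])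
    (fun φ => by linarith [hBle 2 φ, hB0 0, hB0 1, hB0 2, hB0 3])
    (fun φ => by linarith [hBle 3 φ, hB0 0, hB0 1, hB0 2, hB0 3])
  have hS : ∀ φ, pairing a c x (F 0) 1 φ + 3 * pairing a c x (F 1) 1 φ +
      3 * pairing a c x (F 2) 1 φ + pairing a c x (F 3) 1 φ =
      (∫ v in (0 : ℝ)..1, 2 * (v : ℂ) ^ 3 *
        pairing a c x (fun ξ => 2 * binomSum F ξ + binomSum F' ξ) v φ) -
      ∫ v in (0 : ℝ)..1, 2 * (v : ℂ) ^ 3 *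
        pairing (CapillaryWaves.scaleCutoff a) c x (binomSum F) v φ := by
    intro φ
    have hk := fun k (hk : k < 4) => ha.pairing_eq_integral_scale (hF k hk) (hF' k hk) c x φ
    have hcont : ∀ k < 4, Continuous fun v : ℝ => 2 * (v : ℂ) ^ 3 *
        (2 * pairing a c x (F k) v φ + pairing a c x (F' k) v φ -
          pairing (CapillaryWaves.scaleCutoff a) c x (F k) v φ) := by
      intro k hk
      have c1 := ha.continuous_pairing_scale (hFl k hk) c x φ
      have c2 := ha.continuous_pairing_scale (hFl' k hk) c x φ
      have c3 := ha.scaleCutoff.continuous_pairing_scale (hFl k hk) c x φ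
      fun_prop
    have i0 := (hcont 0 (by norm_num)).intervalIntegrable (μ := volume) 0 1
    have i1 := ((hcont 1 (by norm_num)).intervalIntegrable (μ := volume) 0 1).const_mul 3
    have i2 := ((hcont 2 (by norm_num)).intervalIntegrable (μ := volume) 0 1).const_mul 3
    have i3 := (hcont 3 (by norm_num)).intervalIntegrable (μ := volume) 0 1
    rw [hk 0 (by norm_num), hk 1 (by norm_num), hk 2 (by norm_num), hk 3 (by norm_num),
      ← intervalIntegral.integral_const_mul, ← intervalIntegral.integral_const_mul,
      ← intervalIntegral.integral_add i0 i1, ← intervalIntegral.integral_add (i0.add i1) i2,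
      ← intervalIntegral.integral_add ((i0.add i1).add i2) i3, ← intervalIntegral.integral_sub]
    · refine intervalIntegral.integral_congr fun v _ => ?_
      have e1 := ha.pairing_binomSum hFl c x v φ
      have e2 := ha.pairing_binomSum hFl' c x v φ
      have e3 := ha.scaleCutoff.pairing_binomSum hFl c x v φ
      have e4 : pairing a c x (fun ξ => 2 * binomSum F ξ + binomSum F' ξ) v φ =
          2 * pairing a c x (binomSum F) v φ + pairing a c x (binomSum F') v φ := by
        simp only [pairing]
        rw [← integral_const_mul, ← integral_add
          ((ha.integrable_testFn_mul hb c x v φ).const_mul 2) (ha.integrable_testFn_mul hb' c x v φ)]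
        congr 1
        ext ξ
        ring
      rw [e4, e1, e2, e3]
      ring
    · have := ha.continuous_pairing_scale hP c x φ
      exact Continuous.intervalIntegrable (by fun_prop) _ _
    · have := ha.scaleCutoff.continuous_pairing_scale hb c x φ
      exact Continuous.intervalIntegrable (by fun_prop) _ _
  obtain ⟨j1, e1⟩ := ha.integral_pairing_eq hP c x
  obtain ⟨j2, e2⟩ := ha.scaleCutoff.integral_pairing_eq hb c x
  rw [hA, ← e1, ← e2, ← integral_sub j1 j2]
  congr 1
  ext φ
  rw [zero_add, hS φ, mul_sub]

/-! ### Weights -/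

/-- The square integrable weight `r⁻¹ / (r^ι + r^{-ι})`. -/
def sumWeight (ι r : ℝ) : ℝ := r⁻¹ / (r ^ ι + r ^ (-ι))

theorem measurable_sumWeight (ι : ℝ) : Measurable (sumWeight ι) := by
  unfold sumWeight; fun_prop

theorem sumWeight_nonneg (ι : ℝ) {r : ℝ} (hr : 0 ≤ r) : 0 ≤ sumWeight ι r := by
  unfold sumWeight; positivity

/-- Used with κ = ι near 0 and κ = -ι near infinity: keeping one term of the denominator makes the
exponent -1 + 2ι or -1 - 2ι, integrable at that end. -/
theorem mul_sumWeight_sq_le {ι r κ : ℝ} (hr : 0 < r) (hκ : r ^ (-κ) ≤ r ^ ι + r ^ (-ι)) :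
    r * sumWeight ι r ^ 2 ≤ r ^ (2 * κ - 1) := by
  have h1 : sumWeight ι r ≤ r ^ (κ - 1) := by
    rw [sumWeight, div_le_iff₀ (by positivity)]
    calc r⁻¹ = r ^ (κ - 1) * r ^ (-κ) := by
          rw [← Real.rpow_add hr, ← Real.rpow_neg_one]; congr 1; ring
      _ ≤ r ^ (κ - 1) * (r ^ ι + r ^ (-ι)) := by gcongr
  calc r * sumWeight ι r ^ 2 ≤ r * (r ^ (κ - 1)) ^ 2 := by
        have := sumWeight_nonneg ι hr.le
        gcongr
    _ = r ^ (2 * κ - 1) := by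
        nth_rewrite 1 [← Real.rpow_one r]
        rw [← Real.rpow_natCast, ← Real.rpow_mul hr.le, ← Real.rpow_add hr]
        congr 1
        push_cast
        ring

theorem integrableOn_mul_sumWeight_sq {ι : ℝ} (hι : 0 < ι) :
    IntegrableOn (fun r => r * sumWeight ι r ^ 2) (Set.Ioi 0) := by
  have hm : Measurable fun r => r * sumWeight ι r ^ 2 := by
    have := measurable_sumWeight ι
    fun_prop
  rw [← Set.Ioc_union_Ioi_eq_Ioi zero_le_one]
  refine IntegrableOn.union ?_ ?_
  · have h := (intervalIntegral.intervalIntegrable_rpow' (a := 0) (b := 1)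
      (r := 2 * ι - 1) (by linarith)).1
    refine Integrable.mono' h hm.aestronglyMeasurable ?_
    filter_upwards [ae_restrict_mem measurableSet_Ioc] with r hr
    have hr0 : 0 < r := hr.1
    rw [Real.norm_of_nonneg (by positivity)]
    exact mul_sumWeight_sq_le hr0 (le_add_of_nonneg_left (by positivity))
  · have h := integrableOn_Ioi_rpow_of_lt (a := 2 * (-ι) - 1) (by linarith) one_pos
    refine Integrable.mono' h hm.aestronglyMeasurable ?_
    filter_upwards [ae_restrict_mem measurableSet_Ioi] with r hr
    have hr0 : 0 < r := one_pos.trans hr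
    rw [Real.norm_of_nonneg (by positivity)]
    refine mul_sumWeight_sq_le hr0 ?_
    rw [neg_neg]
    exact le_add_of_nonneg_right (by positivity)

theorem memLp_sumWeight {ι : ℝ} (hι : 0 < ι) :
    MemLp (fun ξ : Plane => sumWeight ι ‖(2 * Real.pi) • ξ‖) 2 := by
  have hpi : 0 < 2 * Real.pi := by positivity
  have hm : Measurable fun ξ : Plane => sumWeight ι ‖(2 * Real.pi) • ξ‖ :=
    (measurable_sumWeight ι).comp (by fun_prop)
  rw [memLp_two_iff_integrable_sq hm.aestronglyMeasurable]
  have hn : ∀ ξ : Plane, ‖(2 * Real.pi) • ξ‖ = 2 * Real.pi * ‖ξ‖ := fun ξ => by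
    rw [norm_smul, Real.norm_of_nonneg hpi.le]
  simp only [hn]
  rw [integrable_fun_norm_addHaar volume (f := fun r => sumWeight ι (2 * Real.pi * r) ^ 2)]
  have h := integrableOn_mul_sumWeight_sq hι
  rw [← mul_zero (2 * Real.pi), ← integrableOn_Ioi_comp_mul_left_iff _ _ hpi] at h
  refine IntegrableOn.congr_fun (h.const_mul (2 * Real.pi)⁻¹) (fun r _ => ?_) measurableSet_Ioi
  simp only [finrank_euclideanSpace, Fintype.card_fin, smul_eq_mul]
  field_simp
  simp only [Nat.add_one_sub_one, pow_one]
  ring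

/-- With X = 1/(t r^{3/2}) the kernel is at most min(1, 675X), hence at most 675 X^{1-2β/3}, because
the exponent lies in [0, 1]. -/
theorem norm_avgKernel_le_rpow {t β : ℝ} (ht : 0 < t) (hβ : 0 ≤ β) (hβ' : β < 1 / 2) (x : Plane)
    {ξ : Plane} (hξ : ξ ≠ 0) : ‖avgKernel (t * (2 * Real.pi) ^ (3 / 2 : ℝ)) x ξ‖ ≤
      675 * t ^ (-1 + 2 * β / 3) * ‖(2 * Real.pi) • ξ‖ ^ (-(3 / 2) + β) := by
  have hpi : 0 < 2 * Real.pi := by positivity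
  set r := ‖(2 * Real.pi) • ξ‖ with hr
  have hr0 : 0 < r := norm_pos_iff.2 (smul_ne_zero hpi.ne' hξ)
  have hcr : t * (2 * Real.pi) ^ (3 / 2 : ℝ) * (‖ξ‖ ^ 2) ^ (3 / 4 : ℝ) = t * r ^ (3 / 2 : ℝ) := by
    rw [hr, norm_smul, Real.norm_of_nonneg hpi.le, Real.mul_rpow hpi.le (norm_nonneg _),
      ← Real.rpow_natCast, ← Real.rpow_mul (norm_nonneg _), mul_assoc]
    norm_num
  have h1 := norm_avgKernel_le_one (t * (2 * Real.pi) ^ (3 / 2 : ℝ)) x ξ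
  have h2 := norm_avgKernel_le (by positivity : 0 < t * (2 * Real.pi) ^ (3 / 2 : ℝ)) x hξ
  rw [hcr] at h2
  set X := (t * r ^ (3 / 2 : ℝ))⁻¹ with hX
  have hX0 : 0 < X := by positivity
  have hXp : X ^ (1 - 2 * β / 3) = t ^ (-1 + 2 * β / 3) * r ^ (-(3 / 2) + β) := by
    rw [hX, Real.inv_rpow (by positivity), ← Real.rpow_neg (by positivity),
      Real.mul_rpow ht.le (by positivity), ← Real.rpow_mul hr0.le]
    congr 2 <;> ring
  rw [mul_assoc, ← hXp]
  rcases le_total X 1 with h | h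
  · calc _ ≤ 675 * X := by rwa [hX, ← div_eq_mul_inv]
      _ ≤ 675 * X ^ (1 - 2 * β / 3) := by
        gcongr
        nth_rewrite 1 [← Real.rpow_one X]
        exact Real.rpow_le_rpow_of_exponent_ge hX0 h (by linarith)
  · have := Real.one_le_rpow h (by linarith : 0 ≤ 1 - 2 * β / 3)
    linarith

theorem rpow_eq_sumWeight_mul {ι β r : ℝ} (hr : 0 < r) :
    r ^ (-(3 / 2) + β) = sumWeight ι r * ((r ^ ι + r ^ (-ι)) * r ^ (β - 1 / 2)) := by
  rw [sumWeight, ← mul_assoc, div_mul_cancel₀ _ (by positivity), ← Real.rpow_neg_one,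
    ← Real.rpow_add hr]
  congr 1
  ring

/-- Cauchy–Schwarz after factoring r^{-3/2+β} into the square integrable weight and the symbol of
Y(∂)Λ^{β-1/2}. -/
theorem lintegral_weight_mul_le {ι β : ℝ} {F : Plane → ℂ}
    (hF : AEStronglyMeasurable F) :
    ∫⁻ ξ, ‖((‖(2 * Real.pi) • ξ‖ ^ (-(3 / 2) + β) : ℝ) : ℂ) * F ξ‖ₑ ≤
      eLpNorm (fun ξ : Plane => sumWeight ι ‖(2 * Real.pi) • ξ‖) 2 *
      eLpNorm (fun ξ => weightSymbol ι (β - 1 / 2) ((2 * Real.pi) • ξ) * F ξ) 2 := by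
  have hm : Measurable fun ξ : Plane => sumWeight ι ‖(2 * Real.pi) • ξ‖ :=
    (measurable_sumWeight ι).comp (by fun_prop)
  have hw : Measurable fun ξ : Plane => weightSymbol ι (β - 1 / 2) ((2 * Real.pi) • ξ) := by
    unfold weightSymbol; fun_prop
  have h := eLpNorm_smul_le_mul_eLpNorm (p := 2) (q := 2) (r := 1)
    (hw.aestronglyMeasurable.mul hF) hm.aestronglyMeasurable
  refine le_trans (le_of_eq ?_) h
  rw [eLpNorm_one_eq_lintegral_enorm]
  refine lintegral_congr_ae ?_
  have h0 : ∀ᵐ ξ : Plane, ξ ≠ 0 := by simp [ae_iff]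
  filter_upwards [h0] with ξ hξ
  have hr0 : 0 < ‖(2 * Real.pi) • ξ‖ := norm_pos_iff.2 (smul_ne_zero (by positivity) hξ)
  rw [Pi.smul_apply', Pi.mul_apply, weightSymbol, Complex.real_smul,
    rpow_eq_sumWeight_mul (ι := ι) hr0]
  push_cast
  ring_nf

/-! ### Cutoff sequences -/

-- Smooth steps at the scales 1/(n+1) and n+1. The operator s d/ds is invariant under dilation, so
-- the error cutoffs are bounded uniformly in n; they tend to 0 pointwise because the transition
-- regions move off to 0 and infinity.
open scoped ContDiff in
theorem exists_cutoff_sequence : ∃ (a : ℕ → ℝ → ℝ) (M : ℝ), (∀ n, IsCutoff (a n)) ∧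
    (∀ n s, |a n s| ≤ 1) ∧ (∀ n s, |scaleCutoff (a n) s| ≤ M) ∧
    (∀ s, 0 < s → ∀ᶠ n in Filter.atTop, a n s = 1) ∧
    (∀ s, 0 < s → ∀ᶠ n in Filter.atTop, scaleCutoff (a n) s = 0) := by
  set T := Real.smoothTransition with hT
  set D := deriv T with hD
  have hTd : ∀ y, HasDerivAt T (D y) y := fun y =>
    ((Real.smoothTransition.contDiff (n := 1)).differentiable (by simp) y).hasDerivAt
  have hDc : Continuous D :=
    (Real.smoothTransition.contDiff (n := 1)).continuous_deriv (by simp)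
  have hD0 : ∀ y, y ∉ Set.Icc (0 : ℝ) 1 → D y = 0 := by
    intro y hy
    rw [Set.mem_Icc, not_and_or, not_le, not_le] at hy
    rcases hy with hy | hy
    · have : T =ᶠ[nhds y] fun _ => 0 := by
        filter_upwards [Iio_mem_nhds hy] with z hz
        exact Real.smoothTransition.zero_of_nonpos (le_of_lt hz)
      rw [hD, this.deriv_eq, deriv_const]
    · have : T =ᶠ[nhds y] fun _ => 1 := by
        filter_upwards [Ioi_mem_nhds hy] with z hz
        exact Real.smoothTransition.one_of_one_le (le_of_lt hz)
      rw [hD, this.deriv_eq, deriv_const]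
  obtain ⟨M, hM⟩ := hDc.bounded_above_of_compact_support
    (HasCompactSupport.of_support_subset_isCompact isCompact_Icc
      (fun y hy => by_contra fun h => hy (hD0 y h)))
  have hM0 : 0 ≤ M := (norm_nonneg _).trans (hM 0)
  have hTabs : ∀ y, |T y| ≤ 1 := fun y => by
    rw [abs_of_nonneg (Real.smoothTransition.nonneg y)]
    exact Real.smoothTransition.le_one y
  set a : ℕ → ℝ → ℝ := fun n s => T (2 - s / (n + 1)) * T ((n + 1) * s - 1) with ha
  have had : ∀ n s, deriv (a n) s = D (2 - s / (n + 1)) * (-(1 / ((n : ℝ) + 1))) *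
      T ((n + 1) * s - 1) + T (2 - s / (n + 1)) * (D ((n + 1) * s - 1) * ((n : ℝ) + 1)) := by
    intro n s
    have h1 : HasDerivAt (fun s : ℝ => 2 - s / ((n : ℝ) + 1)) (-(1 / ((n : ℝ) + 1))) s :=
      ((hasDerivAt_id s).div_const _).const_sub 2
    have h2 : HasDerivAt (fun s : ℝ => ((n : ℝ) + 1) * s - 1) ((n : ℝ) + 1) s := by
      simpa using ((hasDerivAt_id s).const_mul ((n : ℝ) + 1)).sub_const 1
    exact (((hTd _).comp s h1).fun_mul ((hTd _).comp s h2)).deriv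
  have hev : ∀ s : ℝ, 0 < s → ∀ᶠ n : ℕ in Filter.atTop,
      1 < 2 - s / ((n : ℝ) + 1) ∧ 1 < ((n : ℝ) + 1) * s - 1 := by
    intro s hs
    filter_upwards [Filter.eventually_ge_atTop ⌈s⌉₊, Filter.eventually_ge_atTop ⌈2 / s⌉₊]
      with n h1 h2
    have h1' : s ≤ n := (Nat.le_ceil s).trans (by exact_mod_cast h1)
    have h2' : 2 / s ≤ n := (Nat.le_ceil _).trans (by exact_mod_cast h2)
    have hn : (0 : ℝ) < (n : ℝ) + 1 := by positivity
    constructor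
    · have : s / ((n : ℝ) + 1) < 1 := by rw [div_lt_one hn]; linarith
      linarith
    · rw [div_le_iff₀ hs] at h2'
      linarith
  refine ⟨a, 8 * M, fun n => ⟨?_, ?_⟩, fun n s => ?_, fun n s => ?_, fun s hs => ?_, fun s hs => ?_⟩
  · have hTc : ContDiff ℝ ∞ T := Real.smoothTransition.contDiff
    exact (hTc.comp (contDiff_const.sub (contDiff_id.div_const _))).mul
      (hTc.comp ((contDiff_const.mul contDiff_id).sub contDiff_const))
  · have hn : (0 : ℝ) < (n : ℝ) + 1 := by positivity
    refine ⟨1 / ((n : ℝ) + 1), 2 * ((n : ℝ) + 1), by positivity, fun s hs => ⟨?_, ?_⟩⟩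
    · by_contra! h
      rw [lt_div_iff₀ hn] at h
      refine hs ?_
      simp only [ha]
      rw [hT, Real.smoothTransition.zero_of_nonpos (x := ((n : ℝ) + 1) * s - 1) (by linarith),
        mul_zero]
    · by_contra! h
      rw [← lt_div_iff₀ hn] at h
      refine hs ?_
      simp only [ha]
      rw [hT, Real.smoothTransition.zero_of_nonpos (x := 2 - s / ((n : ℝ) + 1)) (by linarith),
        zero_mul]
  · simp only [ha, abs_mul]
    exact mul_le_one₀ (hTabs _) (abs_nonneg _) (hTabs _)
  · have hn : (0 : ℝ) < (n : ℝ) + 1 := by positivity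
    -- With y the argument of a step, s/(n+1) is 2 - y and (n+1)s is y + 1; both are at most 2 where
    -- D is nonzero. The factor 2 in 2s a'(s) and the two steps give 8M.
    have key : ∀ y, |D y| * |y - 2| ≤ 2 * M ∧ |D y| * |y + 1| ≤ 2 * M := by
      intro y
      by_cases hy : y ∈ Set.Icc (0 : ℝ) 1
      · have h1 : |y - 2| ≤ 2 := by rw [abs_le]; constructor <;> linarith [hy.1, hy.2]
        have h2 : |y + 1| ≤ 2 := by rw [abs_le]; constructor <;> linarith [hy.1, hy.2]
        have h3 : |D y| ≤ M := hM y
        constructor <;> nlinarith [abs_nonneg (D y)]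
      · rw [hD0 y hy]
        simp [hM0]
    have h1 := (key (2 - s / ((n : ℝ) + 1))).1
    have h2 := (key (((n : ℝ) + 1) * s - 1)).2
    have e : scaleCutoff (a n) s =
        2 * (D (2 - s / (n + 1)) * ((2 - s / ((n : ℝ) + 1)) - 2) * T ((n + 1) * s - 1)) +
        2 * (D ((n + 1) * s - 1) * ((((n : ℝ) + 1) * s - 1) + 1) * T (2 - s / (n + 1))) := by
      rw [scaleCutoff, had]
      ring
    rw [e]
    refine (abs_add_le _ _).trans ?_
    rw [abs_mul, abs_mul, abs_mul, abs_mul, abs_mul, abs_mul, Nat.abs_ofNat]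
    have g1 := mul_le_of_le_one_right (a := |D (2 - s / (n + 1))| * |2 - s / ((n : ℝ) + 1) - 2|)
      (by positivity) (hTabs ((n + 1) * s - 1))
    have g2 := mul_le_of_le_one_right
      (a := |D ((n + 1) * s - 1)| * |((n : ℝ) + 1) * s - 1 + 1|)
      (by positivity) (hTabs (2 - s / (n + 1)))
    linarith
  · filter_upwards [hev s hs] with n hn
    simp only [ha]
    rw [hT, Real.smoothTransition.one_of_one_le hn.1.le,
      Real.smoothTransition.one_of_one_le hn.2.le, mul_one]
  · filter_upwards [hev s hs] with n hn
    rw [scaleCutoff, had, hD0 _ fun h => absurd h.2 (not_le.2 hn.1),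
      hD0 _ fun h => absurd h.2 (not_le.2 hn.2)]
    ring

/-! ### The dispersive estimate -/

/-- The polar angle is discontinuous in ξ, so the kernel is rewritten as a double integral of the
jointly continuous test function with constant cutoff 1. -/
theorem stronglyMeasurable_avgKernel (c : ℝ) (x : Plane) : StronglyMeasurable (avgKernel c x) := by
  have h : avgKernel c x = fun ξ => ∫ v in Set.Ioc (0 : ℝ) 1, ∫ φ in Set.Ioi (0 : ℝ),
      (angWeight φ : ℂ) * (2 * (v : ℂ) ^ 3) * (testFn (fun _ => 1) c x v φ ξ * 1) := by
    ext ξ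
    rw [integral_kernel_eq]
    simp
  have hc : Continuous fun q : (Plane × ℝ) × ℝ => (angWeight q.2 : ℂ) * (2 * (q.1.2 : ℂ) ^ 3) *
      (testFn (fun _ => 1) c x q.1.2 q.2 q.1.1 * 1) := by
    have h1 : Continuous fun q : (Plane × ℝ) × ℝ => phase c x q.1.2 q.2 q.1.1 :=
      (continuous_phase c).comp (f := fun q : (Plane × ℝ) × ℝ => (x, q.1.2, q.2, q.1.1))
        (by fun_prop)
    have h2 := continuous_angWeight
    unfold testFn
    fun_prop
  rw [h]
  exact hc.stronglyMeasurable.integral_prod_right.integral_prod_right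

theorem IsCutoff.continuous_pairing_point {a : ℝ → ℝ} (ha : IsCutoff a) {F : Plane → ℂ}
    (hF : LocallyIntegrable F) (c v φ : ℝ) : Continuous fun x => pairing a c x F v φ := by
  refine continuous_of_dominated (fun x => (ha.integrable_testFn_mul hF c x v φ).1)
    (fun x => .of_forall fun ξ => ?_) (ha.integrable_abs_mul hF) (.of_forall fun ξ => ?_)
  · rw [norm_mul, norm_testFn]
  · have h : Continuous fun x => testFn a c x v φ ξ :=
      (ha.continuous_testFn c).comp (f := fun x : Plane => (x, v, φ, ξ)) (by fun_prop)
    fun_prop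

open Complex in
theorem testFn_one_zero (a : ℝ → ℝ) (t : ℝ) (x ξ : Plane) :
    testFn a (t * (2 * Real.pi) ^ (3 / 2 : ℝ)) x 1 0 ξ =
      a (‖ξ‖ ^ 2) * groupSymbol t ((2 * Real.pi) • ξ) *
        exp (((2 * Real.pi * inner ℝ x ξ : ℝ) : ℂ) * I) := by
  have hpi : 0 < 2 * Real.pi := by positivity
  have hr : rot 0 x = x := by simp [rot]
  have hn : t * (2 * Real.pi) ^ (3 / 2 : ℝ) * (‖ξ‖ ^ 2) ^ (3 / 4 : ℝ) =
      t * ‖(2 * Real.pi) • ξ‖ ^ (3 / 2 : ℝ) := by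
    rw [norm_smul, Real.norm_of_nonneg hpi.le, Real.mul_rpow hpi.le (norm_nonneg _),
      ← Real.rpow_natCast, ← Real.rpow_mul (norm_nonneg _), mul_assoc]
    norm_num
  rw [testFn, groupSymbol, mul_assoc, ← exp_add, phase, hr, ← hn]
  congr 2
  push_cast
  ring

/-- Integrating the pairings against a Fourier transform. -/
theorem IsCutoff.integral_fourier_mul_pairing {a : ℝ → ℝ} (ha : IsCutoff a) {F : Plane → ℂ}
    (hF : LocallyIntegrable F) (t : ℝ) (ψ : 𝓢(Plane, ℂ)) :
    ∫ x, (𝓕 ψ) x * pairing a (t * (2 * Real.pi) ^ (3 / 2 : ℝ)) x F 1 0 =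
      ∫ ξ, a (‖ξ‖ ^ 2) * (ψ ξ * (groupSymbol t ((2 * Real.pi) • ξ) * F ξ)) := by
  set c := t * (2 * Real.pi) ^ (3 / 2 : ℝ) with hc
  have hi : Integrable (fun q : Plane × Plane => (𝓕 ψ) q.1 * (testFn a c q.1 1 0 q.2 * F q.2))
      (volume.prod volume) := by
    refine ((𝓕 ψ).integrable.norm.mul_prod (ha.integrable_abs_mul hF)).mono' ?_
      (.of_forall fun q => ?_)
    · have h1 : Continuous fun q : Plane × Plane => testFn a c q.1 1 0 q.2 :=
        (ha.continuous_testFn c).comp (f := fun q : Plane × Plane => (q.1, 1, 0, q.2))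
          (by fun_prop)
      exact ((𝓕 ψ).continuous.comp continuous_fst).aestronglyMeasurable.mul
        (h1.aestronglyMeasurable.mul hF.aestronglyMeasurable.comp_snd)
    · rw [norm_mul, norm_mul (testFn _ _ _ _ _ _), norm_testFn]
  simp only [pairing, ← integral_const_mul]
  rw [integral_integral_swap hi]
  congr 1
  ext ξ
  -- Fourier inversion for ψ: the x-integral of the plane wave against the transform of ψ gives back
  -- ψ(ξ).
  have hψ : ψ ξ = ∫ x, Complex.exp (((2 * Real.pi * inner ℝ x ξ : ℝ) : ℂ) * Complex.I) •
      (𝓕 ψ) x := by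
    rw [← Real.fourierInv_eq', ← SchwartzMap.fourierInv_coe, FourierTransform.fourierInv_fourier_eq]
  rw [hψ, ← integral_mul_const, ← integral_const_mul]
  congr 1
  ext x
  rw [hc, testFn_one_zero, smul_eq_mul]
  ring

theorem norm_groupSymbol (t : ℝ) (ξ : Plane) : ‖groupSymbol t ξ‖ = 1 := norm_exp_I_mul_ofReal' _

theorem measurable_groupSymbol (t : ℝ) :
    Measurable fun ξ : Plane => groupSymbol t ((2 * Real.pi) • ξ) := by
  unfold groupSymbol
  fun_prop

open Filter Topology in
/-- If the truncated pairings converge boundedly, their limit represents `e^{itΛ^{3/2}} f`. -/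
theorem multiplierNorm_groupSymbol_le_of_tendsto {f : 𝓢'(Plane, ℂ)} {F : Plane → ℂ}
    (hF : IsRepresentedBy (𝓕 f) F) {a : ℕ → ℝ → ℝ} (ha : ∀ n, IsCutoff (a n))
    (ha1 : ∀ n s, |a n s| ≤ 1) (hlim : ∀ s, 0 < s → ∀ᶠ n in atTop, a n s = 1) {t B : ℝ}
    {v : Plane → ℂ} (hB : ∀ n x, ‖pairing (a n) (t * (2 * Real.pi) ^ (3 / 2 : ℝ)) x F 1 0‖ ≤ B)
    (hv : ∀ x, Tendsto (fun n => pairing (a n) (t * (2 * Real.pi) ^ (3 / 2 : ℝ)) x F 1 0) atTop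
      (𝓝 (v x))) :
    multiplierNorm (groupSymbol t) ⊤ f ≤ eLpNorm v ⊤ := by
  have hFl := hF.locallyIntegrable
  have hc := fun n => (ha n).continuous_pairing_point hFl (t * (2 * Real.pi) ^ (3 / 2 : ℝ)) 1 0
  have hvm : AEStronglyMeasurable v :=
    aestronglyMeasurable_of_tendsto_ae atTop (fun n => (hc n).aestronglyMeasurable)
      (.of_forall hv)
  have hvB : ∀ x, ‖v x‖ ≤ B := fun x =>
    le_of_tendsto (hv x).norm (.of_forall fun n => hB n x)
  have hvL : MemLp v ⊤ := memLp_top_of_bound hvm B (.of_forall hvB)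
  have hu : IsRepresentedBy (Lp.toTemperedDistribution (hvL.toLp v)) v :=
    (isRepresentedBy_toTemperedDistribution _).congr hvL.coeFn_toLp
  have hmF : ∀ ψ : 𝓢(Plane, ℂ), Integrable
      fun ξ => ψ ξ * (groupSymbol t ((2 * Real.pi) • ξ) * F ξ) := fun ψ => by
    refine (hF ψ).1.norm.mono' (ψ.continuous.aestronglyMeasurable.mul
      ((measurable_groupSymbol t).aestronglyMeasurable.mul hFl.aestronglyMeasurable))
      (.of_forall fun ξ => ?_)
    rw [norm_mul, norm_mul, norm_groupSymbol, one_mul, ← norm_mul]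
  refine iInf_le_of_le (Lp.toTemperedDistribution (hvL.toLp v)) (iInf_le_of_le v
    (iInf_le_of_le ⟨F, hF, fun ψ => ⟨hmF ψ, ?_⟩⟩ (iInf_le_of_le hu le_rfl)))
  rw [TemperedDistribution.fourier_apply, (hu _).2]
  have h1 : Tendsto (fun n => ∫ x, (𝓕 ψ) x *
      pairing (a n) (t * (2 * Real.pi) ^ (3 / 2 : ℝ)) x F 1 0) atTop
      (𝓝 (∫ x, (𝓕 ψ) x * v x)) := by
    refine tendsto_integral_of_dominated_convergence (fun x => ‖(𝓕 ψ) x‖ * B)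
      (fun n => ((𝓕 ψ).continuous.mul (hc n)).aestronglyMeasurable)
      ((𝓕 ψ).integrable.norm.mul_const B) (fun n => .of_forall fun x => ?_)
      (.of_forall fun x => (hv x).const_mul _)
    rw [norm_mul]
    exact mul_le_mul_of_nonneg_left (hB n x) (norm_nonneg _)
  simp only [fun n => (ha n).integral_fourier_mul_pairing hFl t ψ] at h1
  -- Both sides of the Fubini identity converge. The spatial side is dominated by B times a Schwartz
  -- function, the frequency side by the integrable product of ψ and F.
  refine tendsto_nhds_unique h1 (tendsto_integral_of_dominated_convergence
    (fun ξ => ‖ψ ξ * (groupSymbol t ((2 * Real.pi) • ξ) * F ξ)‖) (fun n => ?_) (hmF ψ).norm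
    (fun n => .of_forall fun ξ => ?_) ?_)
  · have := (ha n).continuous
    exact (Continuous.aestronglyMeasurable (by fun_prop)).mul (hmF ψ).1
  · rw [norm_mul, Complex.norm_real, Real.norm_eq_abs]
    exact mul_le_of_le_one_left (norm_nonneg _) (ha1 n _)
  · have h0 : ∀ᵐ ξ : Plane, ξ ≠ 0 := by simp [ae_iff]
    filter_upwards [h0] with ξ hξ
    refine tendsto_const_nhds.congr' ?_
    filter_upwards [hlim (‖ξ‖ ^ 2) (by positivity)] with n hn
    rw [hn, Complex.ofReal_one, one_mul]

theorem norm_binomSum_le (F : ℕ → Plane → ℂ) (ξ : Plane) :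
    ‖binomSum F ξ‖ ≤ 3 * ∑ k ∈ Finset.range 4, ‖F k ξ‖ := by
  have h1 : ‖binomSum F ξ‖ ≤ ‖F 0 ξ‖ + ‖3 * F 1 ξ‖ + ‖3 * F 2 ξ‖ + ‖F 3 ξ‖ := norm_add₄_le
  rw [norm_mul, norm_mul, Complex.norm_ofNat] at h1
  simp only [Finset.sum_range_succ, Finset.sum_range_zero]
  linarith [norm_nonneg (F 0 ξ), norm_nonneg (F 3 ξ)]

open Filter Topology in
theorem multiplierNorm_groupSymbol_le_of_representations {ι β t : ℝ} (hι : 0 < ι) (hβ : 0 ≤ β)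
    (hβ' : β < 1 / 2) (ht : 0 < t) {f : 𝓢'(Plane, ℂ)} {F : ℕ → ℕ → Plane → ℂ}
    (hF : ∀ j < 2, ∀ k < 4, IsRepresentedBy (𝓕 (scalingField^[j] (rotationField^[k] f))) (F j k))
    (hN : ∀ j < 2, ∀ k < 4,
      eLpNorm (fun ξ => weightSymbol ι (β - 1 / 2) ((2 * Real.pi) • ξ) * F j k ξ) 2 < ⊤) :
    multiplierNorm (groupSymbol t) ⊤ f ≤ ENNReal.ofReal (675 * t ^ (-1 + 2 * β / 3)) *
      (6 * eLpNorm (fun ξ : Plane => sumWeight ι ‖(2 * Real.pi) • ξ‖) 2 *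
      ∑ j ∈ Finset.range 2, ∑ k ∈ Finset.range 4,
        eLpNorm (fun ξ => weightSymbol ι (β - 1 / 2) ((2 * Real.pi) • ξ) * F j k ξ) 2) := by
  obtain ⟨a, M, ha, ha1, hM, hlim, hlim'⟩ := exists_cutoff_sequence
  have hM0 : 0 ≤ M := (abs_nonneg _).trans (hM 0 0)
  set A := 675 * t ^ (-1 + 2 * β / 3) with hA
  have hA0 : 0 ≤ A := by positivity
  set c := t * (2 * Real.pi) ^ (3 / 2 : ℝ) with hc
  set w : Plane → ℝ := fun ξ => ‖(2 * Real.pi) • ξ‖ ^ (-(3 / 2) + β) with hw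
  have hw0 : ∀ ξ, 0 ≤ w ξ := fun ξ => by positivity
  have hwm : Measurable w := by fun_prop
  set K := eLpNorm (fun ξ : Plane => sumWeight ι ‖(2 * Real.pi) • ξ‖) 2 with hK
  set N : ℕ → ℕ → ℝ≥0∞ := fun j k =>
    eLpNorm (fun ξ => weightSymbol ι (β - 1 / 2) ((2 * Real.pi) • ξ) * F j k ξ) 2 with hNdef
  have hFl : ∀ j < 2, ∀ k < 4, LocallyIntegrable (F j k) :=
    fun j hj k hk => (hF j hj k hk).locallyIntegrable
  set b := binomSum (F 0) with hb
  set g := fun ξ => 2 * binomSum (F 0) ξ + binomSum (F 1) ξ with hg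
  have hbl : LocallyIntegrable b := locallyIntegrable_binomSum (hFl 0 (by norm_num))
  have hgl : LocallyIntegrable g := by
    have h2 : LocallyIntegrable fun ξ => (2 : ℂ) • binomSum (F 0) ξ := hbl.smul (2 : ℂ)
    exact h2.add (locallyIntegrable_binomSum (hFl 1 (by norm_num)))
  -- the weighted majorant
  set S : Plane → ℝ := fun ξ => ∑ j ∈ Finset.range 2, ∑ k ∈ Finset.range 4, ‖F j k ξ‖ with hS
  have hS2 : ∀ ξ, S ξ = ∑ k ∈ Finset.range 4, ‖F 0 k ξ‖ + ∑ k ∈ Finset.range 4, ‖F 1 k ξ‖ :=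
    fun ξ => by simp [hS, Finset.sum_range_succ]
  -- The factor 6 is 2 · 3: the coefficient 2 in front of the binomial sum times its largest
  -- coefficient.
  have hgS : ∀ ξ, ‖g ξ‖ ≤ 6 * S ξ := fun ξ => by
    have h1 := norm_binomSum_le (F 0) ξ
    have h2 := norm_binomSum_le (F 1) ξ
    have h3 : ‖g ξ‖ ≤ ‖2 * binomSum (F 0) ξ‖ + ‖binomSum (F 1) ξ‖ := norm_add_le _ _
    rw [norm_mul, Complex.norm_ofNat] at h3
    have h4 : 0 ≤ ∑ k ∈ Finset.range 4, ‖F 1 k ξ‖ := by positivity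
    rw [hS2]
    linarith
  have hbS : ∀ ξ, ‖b ξ‖ ≤ 6 * S ξ := fun ξ => by
    have h1 := norm_binomSum_le (F 0) ξ
    have h3 : 0 ≤ ∑ k ∈ Finset.range 4, ‖F 0 k ξ‖ := by positivity
    have h4 : 0 ≤ ∑ k ∈ Finset.range 4, ‖F 1 k ξ‖ := by positivity
    rw [hS2]
    linarith
  have hwF : ∀ j < 2, ∀ k < 4, ∫⁻ ξ, ‖(w ξ : ℂ) * F j k ξ‖ₑ ≤ K * N j k :=
    fun j hj k hk => lintegral_weight_mul_le (hFl j hj k hk).aestronglyMeasurable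
  have hKtop : K < ⊤ := (memLp_sumWeight hι).2
  have hwFm : ∀ j < 2, ∀ k < 4, AEStronglyMeasurable fun ξ => (w ξ : ℂ) * F j k ξ :=
    fun j hj k hk => (Complex.measurable_ofReal.comp hwm).aestronglyMeasurable.mul
      (hFl j hj k hk).aestronglyMeasurable
  have hwSeq : ∀ ξ, w ξ * S ξ = ∑ j ∈ Finset.range 2, ∑ k ∈ Finset.range 4,
      ‖(w ξ : ℂ) * F j k ξ‖ := fun ξ => by
    simp only [hS, Finset.mul_sum, norm_mul, Complex.norm_real, Real.norm_of_nonneg (hw0 ξ)]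
  have hwS : Integrable fun ξ => w ξ * S ξ := by
    simp only [hwSeq]
    refine integrable_finsetSum _ fun j hj => integrable_finsetSum _ fun k hk => ?_
    rw [Finset.mem_range] at hj hk
    exact Integrable.norm ⟨hwFm j hj k hk,
      (hwF j hj k hk).trans_lt (ENNReal.mul_lt_top hKtop (hN j hj k hk))⟩
  have hwSlint : ∫⁻ ξ, ENNReal.ofReal (w ξ * S ξ) ≤
      K * ∑ j ∈ Finset.range 2, ∑ k ∈ Finset.range 4, N j k := by
    simp only [Finset.mul_sum]
    have e : ∀ ξ, ENNReal.ofReal (w ξ * S ξ) = ∑ j ∈ Finset.range 2, ∑ k ∈ Finset.range 4,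
        ‖(w ξ : ℂ) * F j k ξ‖ₑ := fun ξ => by
      rw [hwSeq, ENNReal.ofReal_sum_of_nonneg fun _ _ => by positivity]
      refine Finset.sum_congr rfl fun j _ => ?_
      rw [ENNReal.ofReal_sum_of_nonneg fun _ _ => by positivity]
      exact Finset.sum_congr rfl fun k _ => ofReal_norm _
    simp only [e]
    rw [lintegral_finsetSum' _ fun j hj => Finset.aemeasurable_fun_sum _ fun k hk =>
      (hwFm j (Finset.mem_range.1 hj) k (Finset.mem_range.1 hk)).enorm]
    refine Finset.sum_le_sum fun j hj => ?_
    rw [lintegral_finsetSum' _ fun k hk =>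
      (hwFm j (Finset.mem_range.1 hj) k (Finset.mem_range.1 hk)).enorm]
    exact Finset.sum_le_sum fun k hk => hwF j (Finset.mem_range.1 hj) k (Finset.mem_range.1 hk)
  -- pointwise bounds
  have h0 : ∀ᵐ ξ : Plane, ξ ≠ 0 := by simp [ae_iff]
  have hpt : ∀ {s B : ℝ} {z : ℂ} (x : Plane) {ξ : Plane}, ξ ≠ 0 → |s| ≤ B → ‖z‖ ≤ 6 * S ξ →
      ‖(s : ℂ) * avgKernel c x ξ * z‖ ≤ 6 * A * B * (w ξ * S ξ) := by
    intro s B z x ξ hξ hs hz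
    have hk : ‖avgKernel c x ξ‖ ≤ A * w ξ := norm_avgKernel_le_rpow ht hβ hβ' x hξ
    rw [norm_mul, norm_mul, Complex.norm_real, Real.norm_eq_abs]
    calc |s| * ‖avgKernel c x ξ‖ * ‖z‖ ≤ B * (A * w ξ) * (6 * S ξ) := by
          have : 0 ≤ B := (abs_nonneg _).trans hs
          have := hw0 ξ
          gcongr
      _ = _ := by ring
  have hkm : ∀ x, AEStronglyMeasurable (avgKernel c x) :=
    fun x => (stronglyMeasurable_avgKernel c x).aestronglyMeasurable
  have hcm : ∀ {χ : ℝ → ℝ}, IsCutoff χ →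
      AEStronglyMeasurable fun ξ : Plane => ((χ (‖ξ‖ ^ 2) : ℝ) : ℂ) := fun hχ => by
    have := hχ.continuous
    exact Continuous.aestronglyMeasurable (by fun_prop)
  set J := ∫ ξ, w ξ * S ξ with hJ
  -- The limit of the truncated pairings: the cutoffs tend to 1, and the error term with the
  -- differentiated cutoff tends to 0. So M enters only the dominating bounds, not the final
  -- constant.
  set v : Plane → ℂ := fun x => ∫ ξ, avgKernel c x ξ * g ξ with hv
  have hpair := fun n x => (ha n).pairing_eq_integral_avgKernel
    (F := F 0) (F' := F 1) (hF 0 (by norm_num)) (hF 1 (by norm_num)) c x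
  have hint : ∀ {χ : ℝ → ℝ} {B : ℝ} {z : Plane → ℂ}, (∀ s, |χ s| ≤ B) →
      (∀ ξ, ‖z ξ‖ ≤ 6 * S ξ) → ∀ x,
      ‖∫ ξ, (χ (‖ξ‖ ^ 2) : ℂ) * avgKernel c x ξ * z ξ‖ ≤ 6 * A * B * J := by
    intro χ B z hχ hz x
    rw [hJ, ← integral_const_mul]
    refine norm_integral_le_of_norm_le (hwS.const_mul _) ?_
    filter_upwards [h0] with ξ hξ
    exact hpt x hξ (hχ _) (hz ξ)
  have hbound : ∀ n x, ‖pairing (a n) c x (F 0 0) 1 0‖ ≤ 6 * A * 1 * J + 6 * A * M * J := by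
    intro n x
    rw [hpair n x]
    exact (norm_sub_le _ _).trans (add_le_add (hint (ha1 n) hgS x) (hint (hM n) hbS x))
  have htend : ∀ x, Tendsto (fun n => pairing (a n) c x (F 0 0) 1 0) atTop (𝓝 (v x)) := by
    intro x
    simp only [hpair]
    have t1 : Tendsto (fun n => ∫ ξ, (a n (‖ξ‖ ^ 2) : ℂ) * avgKernel c x ξ * g ξ) atTop
        (𝓝 (v x)) := by
      refine tendsto_integral_of_dominated_convergence _
        (fun n => ((hcm (ha n)).mul (hkm x)).mul hgl.aestronglyMeasurable)
        (hwS.const_mul (6 * A * 1)) (fun n => ?_) ?_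
      · filter_upwards [h0] with ξ hξ
        exact hpt x hξ (ha1 n _) (hgS ξ)
      · filter_upwards [h0] with ξ hξ
        refine tendsto_const_nhds.congr' ?_
        filter_upwards [hlim (‖ξ‖ ^ 2) (by positivity)] with n hn
        rw [hn, Complex.ofReal_one, one_mul]
    have t2 : Tendsto (fun n => ∫ ξ, (scaleCutoff (a n) (‖ξ‖ ^ 2) : ℂ) * avgKernel c x ξ * b ξ)
        atTop (𝓝 (∫ _ : Plane, (0 : ℂ))) := by
      refine tendsto_integral_of_dominated_convergence _
        (fun n => ((hcm (ha n).scaleCutoff).mul (hkm x)).mul hbl.aestronglyMeasurable)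
        (hwS.const_mul (6 * A * M)) (fun n => ?_) ?_
      · filter_upwards [h0] with ξ hξ
        exact hpt x hξ (hM n _) (hbS ξ)
      · filter_upwards [h0] with ξ hξ
        refine tendsto_const_nhds.congr' ?_
        filter_upwards [hlim' (‖ξ‖ ^ 2) (by positivity)] with n hn
        rw [hn, Complex.ofReal_zero, zero_mul, zero_mul]
    have t3 := t1.sub t2
    rwa [integral_zero, sub_zero] at t3
  refine (multiplierNorm_groupSymbol_le_of_tendsto (hF 0 (by norm_num) 0 (by norm_num)) ha ha1
    hlim hbound htend).trans ?_
  rw [eLpNorm_exponent_top]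
  refine eLpNormEssSup_le_of_ae_enorm_bound (.of_forall fun x => ?_)
  calc ‖v x‖ₑ ≤ ENNReal.ofReal (6 * A * J) := by
        rw [← ofReal_norm]
        refine ENNReal.ofReal_le_ofReal ?_
        rw [hJ, ← integral_const_mul]
        refine norm_integral_le_of_norm_le (hwS.const_mul _) ?_
        filter_upwards [h0] with ξ hξ
        simpa using hpt (s := 1) (B := 1) x hξ (by simp) (hgS ξ)
    _ = ENNReal.ofReal A * (6 * ∫⁻ ξ, ENNReal.ofReal (w ξ * S ξ)) := by
        rw [← ofReal_integral_eq_lintegral_ofReal hwS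
          (.of_forall fun ξ => mul_nonneg (hw0 ξ) (by positivity)),
          show 6 * A * J = A * (6 * J) by ring,
          ENNReal.ofReal_mul hA0, ENNReal.ofReal_mul (p := 6) (by norm_num), ENNReal.ofReal_ofNat]
    _ ≤ _ := by
        rw [mul_assoc 6]
        gcongr

theorem exists_multiplierNorm_groupSymbol_le {ι : ℝ} (hι : 0 < ι) :
    ∃ C : ℝ, 0 < C ∧ ∀ β : ℝ, 0 ≤ β → β < 1 / 2 → ∀ t : ℝ, 0 < t → ∀ f : 𝓢'(Plane, ℂ),
      multiplierNorm (groupSymbol t) ⊤ f ≤ ENNReal.ofReal (C * t ^ (-1 + 2 * β / 3)) *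
        ∑ j ∈ Finset.range 2, ∑ k ∈ Finset.range 4,
          multiplierNorm (weightSymbol ι (β - 1 / 2)) 2
            (scalingField^[j] (rotationField^[k] f)) := by
  set K := eLpNorm (fun ξ : Plane => sumWeight ι ‖(2 * Real.pi) • ξ‖) 2 with hK
  have hKtop : K ≠ ⊤ := (memLp_sumWeight hι).2.ne
  have hK0 : 0 ≤ K.toReal := ENNReal.toReal_nonneg
  -- Here 4050 = 675 · 6, and the added 1 makes positivity immediate. The constant depends only on
  -- ι, through K.
  refine ⟨4050 * K.toReal + 1, by positivity, fun β hβ hβ' t ht f => ?_⟩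
  have hT : 0 < t ^ (-1 + 2 * β / 3) := Real.rpow_pos_of_pos ht _
  by_cases h : ∀ j < 2, ∀ k < 4, multiplierNorm (weightSymbol ι (β - 1 / 2)) 2
      (scalingField^[j] (rotationField^[k] f)) < ⊤
  · choose! F hF using fun j hj k hk =>
      exists_representation_of_multiplierNorm_lt_top (h j hj k hk)
    refine (multiplierNorm_groupSymbol_le_of_representations hι hβ hβ' ht hF fun j hj k hk =>
      (eLpNorm_le_multiplierNorm (hF j hj k hk)).trans_lt (h j hj k hk)).trans ?_
    rw [← mul_assoc]
    refine mul_le_mul' ?_ (Finset.sum_le_sum fun j hj => Finset.sum_le_sum fun k hk =>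
      eLpNorm_le_multiplierNorm (hF j (Finset.mem_range.1 hj) k (Finset.mem_range.1 hk)))
    have hK6 : 6 * K = ENNReal.ofReal (6 * K.toReal) := by
      rw [ENNReal.ofReal_mul (by norm_num), ENNReal.ofReal_toReal hKtop, ENNReal.ofReal_ofNat]
    rw [hK6, ← ENNReal.ofReal_mul (by positivity)]
    refine ENNReal.ofReal_le_ofReal ?_
    linarith
  · push Not at h
    obtain ⟨j, hj, k, hk, h⟩ := h
    have hsum : ∑ j ∈ Finset.range 2, ∑ k ∈ Finset.range 4,
        multiplierNorm (weightSymbol ι (β - 1 / 2)) 2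
          (scalingField^[j] (rotationField^[k] f)) = ⊤ :=
      ENNReal.sum_eq_top.2 ⟨j, Finset.mem_range.2 hj,
        ENNReal.sum_eq_top.2 ⟨k, Finset.mem_range.2 hk, top_le_iff.1 h⟩⟩
    -- If some norm on the right is infinite, the bound is trivial because the prefactor is nonzero.
    rw [hsum, ENNReal.mul_top (by simpa using by positivity)]
    exact le_top

end CapillaryWaves

end

theorem mainTheorem5 (ι : ℝ) (hι : 0 < ι) :
    ∃ C : ℝ, 0 < C ∧
      (∀ β : ℝ, 0 ≤ β → β < 1 / 2 → ∀ t : ℝ, 0 < t →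
        ∀ f : TemperedDistribution CapillaryWaves.Plane ℂ,
          CapillaryWaves.multiplierNorm (CapillaryWaves.groupSymbol t) ⊤ f ≤
            ENNReal.ofReal (C * t ^ (-1 + 2 * β / 3)) *
              ∑ j ∈ Finset.range 2, ∑ k ∈ Finset.range 4,
                CapillaryWaves.multiplierNorm (CapillaryWaves.weightSymbol ι (β - 1 / 2)) 2
                  (CapillaryWaves.scalingField^[j] (CapillaryWaves.rotationField^[k] f))) ∧
      (∀ t : ℝ, 0 < t → ∀ f : TemperedDistribution CapillaryWaves.Plane ℂ,
          CapillaryWaves.multiplierNorm (CapillaryWaves.groupSymbol t) ⊤ f ≤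
            ENNReal.ofReal (C / t) *
              ∑ j ∈ Finset.range 2, ∑ k ∈ Finset.range 4,
                CapillaryWaves.multiplierNorm (CapillaryWaves.weightSymbol ι (-1 / 2)) 2
                  (CapillaryWaves.scalingField^[j] (CapillaryWaves.rotationField^[k] f))) := by
  obtain ⟨C, hC, h⟩ := CapillaryWaves.exists_multiplierNorm_groupSymbol_le hι
  refine ⟨C, hC, h, fun t ht f => ?_⟩
  have h0 := h 0 le_rfl (by norm_num) t ht f
  have e1 : C * t ^ (-1 + 2 * (0 : ℝ) / 3) = C / t := by
    rw [mul_zero, zero_div, add_zero, Real.rpow_neg_one, div_eq_mul_inv]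
  have e2 : (0 : ℝ) - 1 / 2 = -1 / 2 := by norm_num
  rwa [e1, e2] at h0
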